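/- Let $s\in(0,1)$, $d\in\mathbb N$ with $d>2s$, $m>1$, $\gamma\in[0,2s)\cap[0,d-2s]$, $\gamma_0\in[0,\gamma]$, and let $\rho:\mathbb R^d\to\mathbb R$ be a (Lebesgue) measurable weight such that, for some constants $0<c<C$, $c|x|^{-\gamma_0}\le\rho(x)\le C|x|^{-\gamma_0}$ for a.e. $|x|<1$ and $c|x|^{-\gamma}\le\rho(x)\le C|x|^{-\gamma}$ for a.e. $|x|\ge1$. Write $L^1_\rho=L^1(\mathbb R^d;\rho\,\mathrm dx)$. For $\sigma\in(0,1)$ and $\phi\in C_c^\infty(\mathbb R^d)$ put $(-\Delta)^{\sigma}\phi(x)=\mathrm{p.v.}\;C_{d,\sigma}\int_{\mathbb R^d}\frac{\phi(x)-\phi(y)}{|x-y|^{d+2\sigma}}\,\mathrm dy$ with $C_{d,\sigma}=\Big(\int_{\mathbb R^d}\frac{1-\cos\zeta_1}{|\zeta|^{d+2\sigma}}\,\mathrm d\zeta\Big)^{-1}$; let $\dot H^s(\mathbb R^d)$ be the closure of $C_c^\infty(\mathbb R^d)$ with respect to $\|\phi\|_{\dot H^s}^2=\frac{C_{d,s}}2\iint\frac{(\phi(x)-\phi(y))^2}{|x-y|^{d+2s}}\,\mathrm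 dx\,\mathrm dy$, regarded as a space of functions in $L^{2d/(d-2s)}(\mathbb R^d)$ through the Sobolev embedding; for $v\in\dot H^s(\mathbb R^d)$, $(-\Delta)^{s/2}v$ is meant in the sense of distributions. Let $u\ge0$ be a measurable function on $\mathbb R^d\times(0,\infty)$ such that (i) $u\in L^\infty((0,\infty);L^1_\rho(\mathbb R^d))$; (ii) $u^m\in L^2_{\rm loc}((0,\infty);\dot H^s(\mathbb R^d))$; (iii) for all $\varphi\in C_c^\infty(\mathbb R^d\times(0,\infty))$, $$-\int_0^\infty\!\!\int_{\mathbb R^d}u\,\varphi_t\,\rho\,\mathrm dx\,\mathrm dt+\int_0^\infty\!\!\int_{\mathbb R^d}(-\Delta)^{s/2}(u^m)\,(-\Delta)^{s/2}(\varphi)\,\mathrm dx\,\mathrm dt=0;$$ (iv) either $u\in L^\infty(\mathbb R^d\times(\tau,\infty))$ for all $\tau>0$, or $\int_{t_1}^{t_2}u^m(\cdot,\tau)\,\mathrm d\tau\in L^1_\rho(\mathbb R^d)$ for all $t_2>t_1>0$. Then there exists a unique positive (i.e. nonnegative) finite Radon measure $\mu$ on $\mathbb R^d$ which is the initial trace of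 $u$, in the sense that $\operatorname{ess\,lim}_{t\to0^+}\int_{\mathbb R^d}\phi(x)\,u(x,t)\,\rho(x)\,\mathrm dx=\int_{\mathbb R^d}\phi\,\mathrm d\mu$ for all bounded continuous $\phi:\mathbb R^d\to\mathbb R$, with an exceptional null set of times independent of $\phi$. Moreover $\mu(\mathbb R^d)=\int_{\mathbb R^d}u(x,t)\,\rho(x)\,\mathrm dx$ for a.e. $t>0$. -/

import Mathlib

open MeasureTheory Filter Topology Set
open scoped ContDiff ENNReal NNReal BoundedContinuousFunction

noncomputable section

namespace FracPME

/-- The normalising constant `C_{d,σ} = (∫ (1 - cos ζ₁) / |ζ|^{d+2σ} dζ)⁻¹`, for which `(-Δ)^σ`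
has Fourier symbol `|ξ|^{2σ}`. -/
def normConst (d : ℕ) [NeZero d] (σ : ℝ) : ℝ :=
  (∫ ζ : EuclideanSpace ℝ (Fin d), (1 - Real.cos (ζ 0)) / ‖ζ‖ ^ ((d : ℝ) + 2 * σ))⁻¹

/-- `φ ∈ 𝒟(ℝ^d) = C_c^∞(ℝ^d)`. -/
def IsTest {d : ℕ} (φ : EuclideanSpace ℝ (Fin d) → ℝ) : Prop :=
  ContDiff ℝ ∞ φ ∧ HasCompactSupport φ

/-- `φ ∈ C_c^∞(ℝ^d × (0,∞))`. -/
def IsSpaceTimeTest {d : ℕ} (φ : EuclideanSpace ℝ (Fin d) × ℝ → ℝ) : Prop :=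
  ContDiff ℝ ∞ φ ∧ HasCompactSupport φ ∧ tsupport φ ⊆ univ ×ˢ Ioi (0 : ℝ)

/-- The fractional Laplacian `(-Δ)^σ φ (x) = p.v. C_{d,σ} ∫ (φ(x) - φ(y)) / |x - y|^{d+2σ} dy`
(the principal value exists for test functions). -/
def fracLap {d : ℕ} [NeZero d] (σ : ℝ) (φ : EuclideanSpace ℝ (Fin d) → ℝ)
    (x : EuclideanSpace ℝ (Fin d)) : ℝ :=
  limUnder (𝓝[>] (0 : ℝ)) fun ε =>
    normConst d σ * ∫ y in {y | ε < ‖x - y‖}, (φ x - φ y) / ‖x - y‖ ^ ((d : ℝ) + 2 * σ)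

/-- The locally integrable function `g` is `(-Δ)^σ v` in the sense of distributions. -/
def IsDistribFracLap {d : ℕ} [NeZero d] (σ : ℝ) (v g : EuclideanSpace ℝ (Fin d) → ℝ) : Prop :=
  LocallyIntegrable g ∧
    ∀ ψ : EuclideanSpace ℝ (Fin d) → ℝ, IsTest ψ →
      Integrable (fun x => v x * fracLap σ ψ x) ∧
        ∫ x, g x * ψ x = ∫ x, v x * fracLap σ ψ x

/-- The squared norm
`‖v‖²_{Ḣ^s} = (C_{d,s} / 2) ∫∫ (v(x) - v(y))² / |x - y|^{d+2s} dx dy`, with values in `[0,∞]`. -/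
def hdotNormSq {d : ℕ} [NeZero d] (s : ℝ) (v : EuclideanSpace ℝ (Fin d) → ℝ) : ℝ≥0∞ :=
  ENNReal.ofReal (normConst d s / 2) *
    ∫⁻ x, ∫⁻ y, ENNReal.ofReal ((v x - v y) ^ 2 / ‖x - y‖ ^ ((d : ℝ) + 2 * s))

/-- `v ∈ Ḣ^s(ℝ^d)`, the closure of `𝒟(ℝ^d)` with respect to the `Ḣ^s` norm. For `d > 2s` it is
a space of functions through the Sobolev embedding in `L^{2d/(d-2s)}`: the limit of a sequence
of test functions in the `Ḣ^s` norm is identified with its limit in `L^{2d/(d-2s)}`. -/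
def MemHdot {d : ℕ} [NeZero d] (s : ℝ) (v : EuclideanSpace ℝ (Fin d) → ℝ) : Prop :=
  AEStronglyMeasurable v ∧
    ∃ φ : ℕ → EuclideanSpace ℝ (Fin d) → ℝ, (∀ n, IsTest (φ n)) ∧
      Tendsto (fun n => hdotNormSq s (fun x => v x - φ n x)) atTop (𝓝 0) ∧
      Tendsto (fun n => eLpNorm (fun x => v x - φ n x)
        (ENNReal.ofReal (2 * d / (d - 2 * s))) volume) atTop (𝓝 0)

/-- The two-sided power bounds on the weight: `|x|^{-γ₀}` in `B₁`, `|x|^{-γ}` outside `B₁`. -/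
def WeightBounds {d : ℕ} (γ₀ γ : ℝ) (ρ : EuclideanSpace ℝ (Fin d) → ℝ) : Prop :=
  ∃ c C : ℝ, 0 < c ∧ c < C ∧ ∀ᵐ x : EuclideanSpace ℝ (Fin d),
    (‖x‖ < 1 → c * ‖x‖ ^ (-γ₀) ≤ ρ x ∧ ρ x ≤ C * ‖x‖ ^ (-γ₀)) ∧
    (1 ≤ ‖x‖ → c * ‖x‖ ^ (-γ) ≤ ρ x ∧ ρ x ≤ C * ‖x‖ ^ (-γ))

/-- The measure `ρ(x) dx`. -/
def weightMeasure {d : ℕ} (ρ : EuclideanSpace ℝ (Fin d) → ℝ) :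
    Measure (EuclideanSpace ℝ (Fin d)) :=
  volume.withDensity fun x => ENNReal.ofReal (ρ x)

/-- `u ∈ L^∞((0,∞); L¹_ρ(ℝ^d))`. -/
def LinftyL1 {d : ℕ} (ρ : EuclideanSpace ℝ (Fin d) → ℝ)
    (u : EuclideanSpace ℝ (Fin d) → ℝ → ℝ) : Prop :=
  ∃ M : ℝ≥0, ∀ᵐ t ∂(volume.restrict (Ioi (0 : ℝ))),
    AEStronglyMeasurable (fun x => u x t) (weightMeasure ρ) ∧
      ∫⁻ x, ‖u x t‖ₑ ∂(weightMeasure ρ) ≤ M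

/-- `u ∈ L^∞(ℝ^d × (τ,∞))` for every `τ > 0`. -/
def BoundedAwayFromZero {d : ℕ} (u : EuclideanSpace ℝ (Fin d) → ℝ → ℝ) : Prop :=
  ∀ τ : ℝ, 0 < τ → ∃ M : ℝ,
    ∀ᵐ z : EuclideanSpace ℝ (Fin d) × ℝ ∂(volume.restrict (univ ×ˢ Ioi τ)), |u z.1 z.2| ≤ M

/-- `∫_{t₁}^{t₂} u^m(·,τ) dτ ∈ L¹_ρ(ℝ^d)` for all `t₂ > t₁ > 0` (for nonnegative `u`). -/
def PowerTimeIntegrable {d : ℕ} (m : ℝ) (ρ : EuclideanSpace ℝ (Fin d) → ℝ)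
    (u : EuclideanSpace ℝ (Fin d) → ℝ → ℝ) : Prop :=
  ∀ t₁ t₂ : ℝ, 0 < t₁ → t₁ < t₂ →
    ∫⁻ x, (∫⁻ τ in Ioo t₁ t₂, ENNReal.ofReal (u x τ ^ m)) ∂(weightMeasure ρ) < ⊤

/-- `v ∈ L²_loc((0,∞); Ḣ^s(ℝ^d))` (for `v` measurable in space-time). -/
def L2locHdot {d : ℕ} [NeZero d] (s : ℝ) (v : EuclideanSpace ℝ (Fin d) → ℝ → ℝ) : Prop :=
  (∀ᵐ t ∂(volume.restrict (Ioi (0 : ℝ))), MemHdot s (fun x => v x t)) ∧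
    ∀ t₁ t₂ : ℝ, 0 < t₁ → t₁ < t₂ → (∫⁻ t in Ioo t₁ t₂, hdotNormSq s (fun x => v x t)) < ⊤

/-- The weak formulation of `ρ u_t + (-Δ)^s (u^m) = 0` on `ℝ^d × (0,∞)`:
`-∫∫ u φ_t ρ + ∫∫ (-Δ)^{s/2}(u^m) (-Δ)^{s/2}(φ) = 0` for all `φ ∈ C_c^∞(ℝ^d × (0,∞))`.
Here `g` is the (a.e. unique) function `(-Δ)^{s/2}(u^m)`. -/
def WeakFormulation {d : ℕ} [NeZero d] (s m : ℝ) (ρ : EuclideanSpace ℝ (Fin d) → ℝ)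
    (u : EuclideanSpace ℝ (Fin d) → ℝ → ℝ) : Prop :=
  ∃ g : EuclideanSpace ℝ (Fin d) → ℝ → ℝ,
    AEStronglyMeasurable (fun z : EuclideanSpace ℝ (Fin d) × ℝ => g z.1 z.2)
      (volume.restrict (univ ×ˢ Ioi (0 : ℝ))) ∧
    (∀ᵐ t ∂(volume.restrict (Ioi (0 : ℝ))),
      IsDistribFracLap (s / 2) (fun x => u x t ^ m) (fun x => g x t)) ∧
    ∀ φ : EuclideanSpace ℝ (Fin d) × ℝ → ℝ, IsSpaceTimeTest φ →
      -(∫ t in Ioi (0 : ℝ), ∫ x, u x t * deriv (fun τ => φ (x, τ)) t * ρ x) +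
        ∫ t in Ioi (0 : ℝ), ∫ x, g x t * fracLap (s / 2) (fun y => φ (y, t)) x = 0

/-- The nonnegative function `u` solves `ρ u_t + (-Δ)^s (u^m) = 0` weakly, with no prescribed
initial condition and no boundedness requirement. -/
structure IsWeakSolution {d : ℕ} [NeZero d] (s m : ℝ) (ρ : EuclideanSpace ℝ (Fin d) → ℝ)
    (u : EuclideanSpace ℝ (Fin d) → ℝ → ℝ) : Prop where
  measurable : AEStronglyMeasurable (fun z : EuclideanSpace ℝ (Fin d) × ℝ => u z.1 z.2)
    (volume.restrict (univ ×ˢ Ioi (0 : ℝ)))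
  nonneg : ∀ᵐ z : EuclideanSpace ℝ (Fin d) × ℝ ∂(volume.restrict (univ ×ˢ Ioi (0 : ℝ))),
    0 ≤ u z.1 z.2
  linftyL1 : LinftyL1 ρ u
  energy : L2locHdot s (fun x t => u x t ^ m)
  weak : WeakFormulation s m ρ u

/-- `μ = ess lim_{t → 0} ρ u(·,t)` in `σ(ℳ(ℝ^d), C_b(ℝ^d))`: off a null set `N` of times,
`ρ u(·,t)` is integrable and `∫ φ u(·,t) ρ → ∫ φ dμ` as `t → 0⁺` for every `φ ∈ C_b(ℝ^d)`. -/
def IsInitialTrace {d : ℕ} (ρ : EuclideanSpace ℝ (Fin d) → ℝ)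
    (u : EuclideanSpace ℝ (Fin d) → ℝ → ℝ)
    (μ : FiniteMeasure (EuclideanSpace ℝ (Fin d))) : Prop :=
  ∃ N : Set ℝ, volume N = 0 ∧
    (∀ t ∈ Ioi (0 : ℝ) \ N, Integrable (fun x => u x t) (weightMeasure ρ)) ∧
    ∀ φ : EuclideanSpace ℝ (Fin d) →ᵇ ℝ,
      Tendsto (fun t => ∫ x, φ x * u x t ∂(weightMeasure ρ)) (𝓝[Ioi 0 \ N] 0)
        (𝓝 (∫ x, φ x ∂(μ : Measure (EuclideanSpace ℝ (Fin d)))))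

end FracPME

end

/-!
Write `lam t = u(·,t) ρ dx` and `W = u ^ m ≥ 0`, so that `∂ₜ lam = -(-Δ)^s W`, and let `b` be a
smooth radially decreasing bump. The potential `P_L(t) = ∫_L^∞ r^{-1-d+2s} (∫ b(x/r) dlam t) dr`
pairs `lam t` with the Riesz kernel `|x|^{2s-d}` smoothed at scale `L`. By rearrangement `(-Δ)^s`
of this smoothed kernel is nonnegative, and at scale one it dominates a multiple of
`(1 + |x|)^{-(d+2s)}`, which is the decay of `(-Δ)^s χ` for every test function `χ`. Hence `P_L` is
nonincreasing in time, and the increments of `∫ χ dlam t` are controlled by those of the bounded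
monotone function `P_1`, so that `∫ χ dlam t` has a limit as `t → 0⁺`.

Testing with `b(x/r)` and letting `r → ∞` shows that the mass is conserved. As `P_L(t) ≥ P_L(t₀)`
for `t < t₀`, the mass of `lam t` cannot lie further from the origin than that of `lam t₀`: the
measures `lam t`, `t < t₀`, are tight. By Prokhorov's theorem they converge weakly.
-/

namespace FracPME

noncomputable section

section LevyOperator

variable {E : Type*} [NormedAddCommGroup E]

/-- The symmetric second difference of `φ` at `x` in direction `z`, with the sign of `-Δ`. -/
def secondDiff (φ : E → ℝ) (x z : E) : ℝ := 2 * φ x - φ (x + z) - φ (x - z)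

lemma continuous_secondDiff {φ : E → ℝ} (hφ : Continuous φ) :
    Continuous fun p : E × E => secondDiff φ p.1 p.2 := by
  unfold secondDiff
  fun_prop

lemma abs_secondDiff_le_four_mul {φ : E → ℝ} {B : ℝ} (hB : ∀ x, ‖φ x‖ ≤ B) (x z : E) :
    |secondDiff φ x z| ≤ 4 * B := by
  have hx := abs_le.1 (hB x)
  have hadd := abs_le.1 (hB (x + z))
  have hsub := abs_le.1 (hB (x - z))
  unfold secondDiff
  exact abs_le.2 ⟨by linarith, by linarith⟩

variable [NormedSpace ℝ E]

lemma abs_secondDiff_le_mul_norm_sq {φ : E → ℝ} (hφ : Differentiable ℝ φ) {K : ℝ≥0}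
    (hK : LipschitzWith K (fderiv ℝ φ)) (x z : E) :
    |secondDiff φ x z| ≤ 2 * K * ‖z‖ ^ 2 := by
  have hderiv (t : ℝ) : HasDerivAt (fun t : ℝ => φ (x + t • z) + φ (x - t • z))
      (fderiv ℝ φ (x + t • z) z - fderiv ℝ φ (x - t • z) z) t := by
    have hline : HasDerivAt (fun t : ℝ => t • z) z t := by
      simpa using (hasDerivAt_id t).smul_const z
    refine (((hφ _).hasFDerivAt.comp_hasDerivAt t (hline.const_add x)).add
      ((hφ _).hasFDerivAt.comp_hasDerivAt t (hline.const_sub x))).congr_deriv ?_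
    simp only [map_neg, ← sub_eq_add_neg]
  have hbound : ∀ t ∈ Ico (0 : ℝ) 1,
      ‖fderiv ℝ φ (x + t • z) z - fderiv ℝ φ (x - t • z) z‖ ≤ 2 * K * ‖z‖ ^ 2 := by
    intro t ht
    have hlip := hK.norm_sub_le (x + t • z) (x - t • z)
    rw [show x + t • z - (x - t • z) = (2 * t) • z by module, norm_smul,
      Real.norm_of_nonneg (by linarith [ht.1])] at hlip
    calc ‖fderiv ℝ φ (x + t • z) z - fderiv ℝ φ (x - t • z) z‖
        = ‖(fderiv ℝ φ (x + t • z) - fderiv ℝ φ (x - t • z)) z‖ := rfl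
      _ ≤ K * (2 * t * ‖z‖) * ‖z‖ := ContinuousLinearMap.le_of_opNorm_le _ hlip z
      _ ≤ K * (2 * 1 * ‖z‖) * ‖z‖ := by gcongr; exact ht.2.le
      _ = 2 * K * ‖z‖ ^ 2 := by ring
  have hmvt := norm_image_sub_le_of_norm_deriv_le_segment_01'
    (fun t _ => (hderiv t).hasDerivWithinAt) hbound
  simp only [one_smul, zero_smul, add_zero, sub_zero] at hmvt
  calc |secondDiff φ x z| = ‖φ (x + z) + φ (x - z) - (φ x + φ x)‖ := by
        rw [Real.norm_eq_abs, abs_sub_comm]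
        unfold secondDiff
        congr 1
        ring
    _ ≤ 2 * K * ‖z‖ ^ 2 := hmvt

lemma exists_abs_secondDiff_le {φ : E → ℝ} (hφ : ContDiff ℝ 2 φ) (hc : HasCompactSupport φ) :
    ∃ C, 0 ≤ C ∧ ∀ x z, |secondDiff φ x z| ≤ C * min 1 (‖z‖ ^ 2) := by
  obtain ⟨K, hK⟩ := (hφ.fderiv_right (m := 1) (by norm_num)).lipschitzWith_of_hasCompactSupport
    (hc.fderiv (𝕜 := ℝ)) one_ne_zero
  obtain ⟨B, hB⟩ := hφ.continuous.bounded_above_of_compact_support hc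
  refine ⟨max (4 * B) (2 * K), by positivity, fun x z => ?_⟩
  rw [mul_min_of_nonneg _ _ (by positivity), mul_one]
  refine le_min ((abs_secondDiff_le_four_mul hB x z).trans (le_max_left _ _))
    ((abs_secondDiff_le_mul_norm_sq (hφ.differentiable two_ne_zero) hK x z).trans ?_)
  gcongr
  exact le_max_right _ _

end LevyOperator

section LevyKernel

variable {E : Type*} [NormedAddCommGroup E] [InnerProductSpace ℝ E] [FiniteDimensional ℝ E]
  [MeasurableSpace E] [BorelSpace E]

/-- A density of a symmetric Lévy measure: it may be singular at the origin, but integrates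
`min 1 |z|²`. -/
structure IsLevyKernel (K : E → ℝ) : Prop where
  nonneg : ∀ z, 0 ≤ K z
  even : ∀ z, K (-z) = K z
  measurable : Measurable K
  integrable : Integrable fun z => min 1 (‖z‖ ^ 2) * K z

/-- The nonlocal operator `p.v. ∫ (φ(x) - φ(y)) K(x - y) dy` with Lévy kernel `K`, as the absolutely
convergent integral obtained by symmetrising in `z = x - y`. -/
def levyOp (K : E → ℝ) (φ : E → ℝ) (x : E) : ℝ := ∫ z, secondDiff φ x z / 2 * K z

variable {K : E → ℝ} {φ : E → ℝ}

namespace IsLevyKernel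

lemma norm_secondDiff_mul_le (hK : IsLevyKernel K) {C : ℝ}
    (hC : ∀ x z, |secondDiff φ x z| ≤ C * min 1 (‖z‖ ^ 2)) (x z : E) :
    ‖secondDiff φ x z / 2 * K z‖ ≤ C / 2 * (min 1 (‖z‖ ^ 2) * K z) := by
  rw [norm_mul, norm_div, Real.norm_of_nonneg (hK.nonneg z), Real.norm_two, ← mul_assoc]
  refine mul_le_mul_of_nonneg_right ?_ (hK.nonneg z)
  calc |secondDiff φ x z| / 2 ≤ C * min 1 (‖z‖ ^ 2) / 2 := by gcongr; exact hC x z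
    _ = C / 2 * min 1 (‖z‖ ^ 2) := by ring

lemma measurable_secondDiff_mul (hK : IsLevyKernel K) (hφ : Continuous φ) :
    Measurable fun p : E × E => secondDiff φ p.1 p.2 / 2 * K p.2 :=
  ((continuous_secondDiff hφ).measurable.div_const 2).mul (hK.measurable.comp measurable_snd)

lemma aestronglyMeasurable_secondDiff_mul (hK : IsLevyKernel K) (hφ : Continuous φ) (x : E) :
    AEStronglyMeasurable fun z => secondDiff φ x z / 2 * K z :=
  ((hK.measurable_secondDiff_mul hφ).comp measurable_prodMk_left).aestronglyMeasurable

lemma integrable_secondDiff_mul (hK : IsLevyKernel K) (hφ : ContDiff ℝ 2 φ)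
    (hc : HasCompactSupport φ) (x : E) : Integrable fun z => secondDiff φ x z / 2 * K z := by
  obtain ⟨C, -, hC⟩ := exists_abs_secondDiff_le hφ hc
  exact (hK.integrable.const_mul (C / 2)).mono'
    (hK.aestronglyMeasurable_secondDiff_mul hφ.continuous x)
    (ae_of_all _ (hK.norm_secondDiff_mul_le hC x))

lemma continuous_levyOp (hK : IsLevyKernel K) (hφ : ContDiff ℝ 2 φ) (hc : HasCompactSupport φ) :
    Continuous (levyOp K φ) := by
  obtain ⟨C, -, hC⟩ := exists_abs_secondDiff_le hφ hc
  refine continuous_of_dominated (hK.aestronglyMeasurable_secondDiff_mul hφ.continuous)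
    (fun x => ae_of_all _ (hK.norm_secondDiff_mul_le hC x)) (hK.integrable.const_mul (C / 2))
    (ae_of_all _ fun z => ?_)
  have hsec := continuous_secondDiff hφ.continuous
  fun_prop

lemma exists_abs_levyOp_le (hK : IsLevyKernel K) (hφ : ContDiff ℝ 2 φ)
    (hc : HasCompactSupport φ) : ∃ B, 0 ≤ B ∧ ∀ x, |levyOp K φ x| ≤ B := by
  obtain ⟨C, -, hC⟩ := exists_abs_secondDiff_le hφ hc
  have hB (x : E) : |levyOp K φ x| ≤ ∫ z, C / 2 * (min 1 (‖z‖ ^ 2) * K z) :=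
    norm_integral_le_of_norm_le (hK.integrable.const_mul (C / 2))
      (ae_of_all _ (hK.norm_secondDiff_mul_le hC x))
  exact ⟨_, (abs_nonneg _).trans (hB 0), hB⟩

lemma abs_levyOp_le_of_eq_zero (hK : IsLevyKernel K) (hφ : Integrable φ) {x : E} (hx : φ x = 0)
    {A : ℝ} (hA : ∀ y, φ y ≠ 0 → K (x - y) ≤ A) : |levyOp K φ x| ≤ A * ∫ y, |φ y| := by
  have hsub (z : E) : |φ (x - z)| * K z ≤ A * |φ (x - z)| := by
    by_cases hz : φ (x - z) = 0
    · simp [hz]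
    · rw [mul_comm]
      gcongr
      simpa only [sub_sub_cancel] using hA _ hz
  have hadd (z : E) : |φ (x + z)| * K z ≤ A * |φ (x + z)| := by
    simpa only [sub_neg_eq_add, hK.even] using hsub (-z)
  have hpt (z : E) : ‖secondDiff φ x z / 2 * K z‖ ≤ A / 2 * (|φ (x + z)| + |φ (x - z)|) := by
    rw [norm_mul, norm_div, Real.norm_of_nonneg (hK.nonneg z), Real.norm_two]
    have htri : ‖secondDiff φ x z‖ ≤ |φ (x + z)| + |φ (x - z)| := by
      rw [secondDiff, hx, mul_zero, zero_sub, ← neg_add', norm_neg]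
      exact norm_add_le _ _
    have := mul_le_mul_of_nonneg_right htri (hK.nonneg z)
    linarith [hadd z, hsub z]
  have hiadd : Integrable fun z => |φ (x + z)| := hφ.abs.comp_add_left x
  have hisub : Integrable fun z => |φ (x - z)| := hφ.abs.comp_sub_left x
  refine (norm_integral_le_of_norm_le ((hiadd.add hisub).const_mul (A / 2))
    (ae_of_all _ hpt)).trans_eq ?_
  simp only [Pi.add_apply]
  rw [integral_const_mul, integral_add hiadd hisub,
    integral_add_left_eq_self (fun y => |φ y|) x,
    integral_sub_left_eq_self (fun y => |φ y|) volume x]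
  ring

lemma integrableOn_lt_norm (hK : IsLevyKernel K) {ε : ℝ} (hε : 0 < ε) :
    IntegrableOn K {z | ε < ‖z‖} := by
  have hmin : 0 < min 1 (ε ^ 2) := by positivity
  refine (hK.integrable.integrableOn.const_mul (min 1 (ε ^ 2))⁻¹).mono'
    hK.measurable.aestronglyMeasurable (ae_restrict_of_forall_mem
      (measurableSet_lt measurable_const measurable_norm) fun z hz => ?_)
  rw [Real.norm_of_nonneg (hK.nonneg z), ← mul_assoc, ← div_eq_inv_mul]
  refine le_mul_of_one_le_left (hK.nonneg z) ((one_le_div hmin).2 ?_)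
  gcongr
  exact hz.le

lemma setIntegral_sub_mul_eq (hK : IsLevyKernel K) (hφ : Continuous φ)
    (hc : HasCompactSupport φ) (x : E) {ε : ℝ} (hε : 0 < ε) :
    ∫ y in {y | ε < ‖x - y‖}, (φ x - φ y) * K (x - y) =
      ∫ z in {z | ε < ‖z‖}, secondDiff φ x z / 2 * K z := by
  have hS : MeasurableSet {z : E | ε < ‖z‖} := measurableSet_lt measurable_const measurable_norm
  have hSx : MeasurableSet {y : E | ε < ‖x - y‖} :=
    measurableSet_lt measurable_const (by fun_prop)
  set k : E → ℝ := {z | ε < ‖z‖}.indicator fun z => (φ x - φ (x - z)) * K z with hk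
  have hki : Integrable k := by
    obtain ⟨B, hB⟩ := hφ.bounded_above_of_compact_support hc
    refine (integrable_indicator_iff hS).2 ((hK.integrableOn_lt_norm hε).bdd_mul (c := B + B)
      (by fun_prop) (ae_of_all _ fun z => (norm_sub_le _ _).trans (add_le_add (hB _) (hB _))))
  calc ∫ y in {y | ε < ‖x - y‖}, (φ x - φ y) * K (x - y) = ∫ y, k (x - y) := by
        rw [← integral_indicator hSx]
        simp only [hk, indicator_apply, mem_ofPred_eq, sub_sub_cancel]
    _ = ∫ z, k z := integral_sub_left_eq_self k volume x
    _ = ∫ z, (k z + k (-z)) / 2 := by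
        rw [integral_div, integral_add hki hki.comp_neg, integral_neg_eq_self k volume]
        ring
    _ = ∫ z in {z | ε < ‖z‖}, secondDiff φ x z / 2 * K z := by
        rw [← integral_indicator hS]
        refine integral_congr_ae (ae_of_all _ fun z => ?_)
        simp only [hk, indicator_apply, mem_ofPred_eq, norm_neg, sub_neg_eq_add, hK.even]
        split_ifs
        · unfold secondDiff
          ring
        · simp

lemma tendsto_setIntegral_sub_mul [Nontrivial E] (hK : IsLevyKernel K) (hφ : ContDiff ℝ 2 φ)
    (hc : HasCompactSupport φ) (x : E) :
    Tendsto (fun ε => ∫ y in {y | ε < ‖x - y‖}, (φ x - φ y) * K (x - y)) (𝓝[>] 0)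
      (𝓝 (levyOp K φ x)) := by
  have hcover : AECover volume (𝓝[>] (0 : ℝ)) fun ε => {z : E | ε < ‖z‖} :=
    { ae_eventually_mem := by
        filter_upwards [volume.ae_ne (0 : E)] with z hz
        exact mem_nhdsWithin_of_mem_nhds (Iio_mem_nhds (norm_pos_iff.2 hz))
      measurableSet := fun ε => measurableSet_lt measurable_const measurable_norm }
  refine (hcover.integral_tendsto_of_countably_generated
    (hK.integrable_secondDiff_mul hφ hc x)).congr' ?_
  filter_upwards [self_mem_nhdsWithin] with ε hε
  exact (hK.setIntegral_sub_mul_eq hφ.continuous hc x hε).symm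

end IsLevyKernel

end LevyKernel

section FractionalKernel

/-- The Lévy kernel of `(-Δ)^σ`. -/
def fracKernel (d : ℕ) [NeZero d] (σ : ℝ) (z : EuclideanSpace ℝ (Fin d)) : ℝ :=
  normConst d σ / ‖z‖ ^ ((d : ℝ) + 2 * σ)

variable {d : ℕ}

lemma integrable_min_one_norm_sq_div [NeZero d] {σ : ℝ} (h0 : 0 < σ) (h1 : σ < 1) :
    Integrable fun z : EuclideanSpace ℝ (Fin d) =>
      min 1 (‖z‖ ^ 2) / ‖z‖ ^ ((d : ℝ) + 2 * σ) := by
  refine (integrable_fun_norm_addHaar (volume : Measure (EuclideanSpace ℝ (Fin d)))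
    (f := fun r : ℝ => min 1 (r ^ 2) / r ^ ((d : ℝ) + 2 * σ))).2 ?_
  rw [finrank_euclideanSpace_fin, ← Ioc_union_Ioi_eq_Ioi zero_le_one]
  have hpow (r : ℝ) : r ^ (d - 1) = r ^ ((d : ℝ) - 1) := by
    rw [← Real.rpow_natCast, Nat.cast_pred (Nat.pos_of_neZero d)]
  have hnear : IntegrableOn (fun r : ℝ => r ^ (1 - 2 * σ)) (Ioc 0 1) := by
    rw [← intervalIntegrable_iff_integrableOn_Ioc_of_le zero_le_one]
    exact intervalIntegral.intervalIntegrable_rpow' (by linarith)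
  have hfar : IntegrableOn (fun r : ℝ => r ^ (-1 - 2 * σ)) (Ioi 1) :=
    (integrableOn_Ioi_rpow_iff one_pos).2 (by linarith)
  refine IntegrableOn.union (hnear.congr_fun (fun r hr => ?_) measurableSet_Ioc)
    (hfar.congr_fun (fun r hr => ?_) measurableSet_Ioi)
  · simp only [smul_eq_mul]
    rw [min_eq_right (pow_le_one₀ hr.1.le hr.2), hpow, ← Real.rpow_natCast r 2,
      ← Real.rpow_sub hr.1, ← Real.rpow_add hr.1]
    congr 1
    push_cast
    ring
  · have hr1 : (1 : ℝ) < r := hr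
    have hr0 : 0 < r := one_pos.trans hr1
    simp only [smul_eq_mul]
    rw [min_eq_left (one_le_pow₀ hr1.le), hpow, one_div, ← Real.rpow_neg hr0.le,
      ← Real.rpow_add hr0]
    congr 1
    ring

lemma normConst_nonneg [NeZero d] (σ : ℝ) : 0 ≤ normConst d σ :=
  inv_nonneg.2 (integral_nonneg fun ζ =>
    div_nonneg (sub_nonneg.2 (Real.cos_le_one _)) (by positivity))

lemma isLevyKernel_fracKernel [NeZero d] {σ : ℝ} (h0 : 0 < σ) (h1 : σ < 1) :
    IsLevyKernel (fracKernel d σ) where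
  nonneg z := div_nonneg (normConst_nonneg σ) (by positivity)
  even z := by rw [fracKernel, norm_neg, fracKernel]
  measurable := (measurable_norm.pow_const _).const_div _
  integrable := by
    refine ((integrable_min_one_norm_sq_div h0 h1).const_mul (normConst d σ)).congr
      (ae_of_all _ fun z => ?_)
    unfold fracKernel
    ring

namespace IsTest

variable {φ : EuclideanSpace ℝ (Fin d) → ℝ}

lemma contDiff_two (h : IsTest φ) : ContDiff ℝ 2 φ := h.1.of_le (WithTop.coe_le_coe.2 le_top)

lemma integrable (h : IsTest φ) : Integrable φ :=
  h.1.continuous.integrable_of_hasCompactSupport h.2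

lemma exists_radius (h : IsTest φ) : ∃ R, 1 ≤ R ∧ ∀ x, φ x ≠ 0 → ‖x‖ ≤ R := by
  obtain ⟨R, hR⟩ := h.2.isCompact.isBounded.subset_closedBall 0
  exact ⟨max R 1, le_max_right _ _, fun x hx =>
    (mem_closedBall_zero_iff.1 (hR (subset_tsupport _ hx))).trans (le_max_left R 1)⟩

variable [NeZero d] {σ : ℝ}

lemma fracLap_eq_levyOp (h : IsTest φ) (h0 : 0 < σ) (h1 : σ < 1) :
    fracLap σ φ = levyOp (fracKernel d σ) φ := by
  funext x
  refine Tendsto.limUnder_eq (((isLevyKernel_fracKernel h0 h1).tendsto_setIntegral_sub_mul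
    h.contDiff_two h.2 x).congr fun ε => ?_)
  rw [← integral_const_mul]
  refine integral_congr_ae (ae_of_all _ fun y => ?_)
  unfold fracKernel
  ring

lemma continuous_fracLap (h : IsTest φ) (h0 : 0 < σ) (h1 : σ < 1) :
    Continuous (fracLap σ φ) := by
  rw [h.fracLap_eq_levyOp h0 h1]
  exact (isLevyKernel_fracKernel h0 h1).continuous_levyOp h.contDiff_two h.2

lemma exists_abs_fracLap_le_of_far (h : IsTest φ) (h0 : 0 < σ) (h1 : σ < 1) :
    ∃ R C, 0 ≤ R ∧ 0 ≤ C ∧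
      ∀ x, R < ‖x‖ → |fracLap σ φ x| ≤ C * (1 + ‖x‖) ^ (-((d : ℝ) + 2 * σ)) := by
  obtain ⟨R, hR1, hR⟩ := h.exists_radius
  have hc := normConst_nonneg (d := d) σ
  refine ⟨2 * R, normConst d σ * 4 ^ ((d : ℝ) + 2 * σ) * ∫ y, |φ y|, by positivity, by positivity,
    fun x hx => ?_⟩
  have hx0 : φ x = 0 := by
    by_contra hne
    linarith [hR x hne]
  have hkernel (y : EuclideanSpace ℝ (Fin d)) (hy : φ y ≠ 0) : fracKernel d σ (x - y) ≤
      normConst d σ * 4 ^ ((d : ℝ) + 2 * σ) * (1 + ‖x‖) ^ (-((d : ℝ) + 2 * σ)) := by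
    have hxy : (1 + ‖x‖) / 4 ≤ ‖x - y‖ := by linarith [hR y hy, norm_sub_norm_le x y]
    calc fracKernel d σ (x - y)
        ≤ normConst d σ / ((1 + ‖x‖) / 4) ^ ((d : ℝ) + 2 * σ) := by unfold fracKernel; gcongr
      _ = _ := by
          rw [Real.div_rpow (by positivity) (by norm_num), Real.rpow_neg (by positivity),
            div_div_eq_mul_div, div_eq_mul_inv]
  rw [h.fracLap_eq_levyOp h0 h1]
  refine ((isLevyKernel_fracKernel h0 h1).abs_levyOp_le_of_eq_zero h.integrable hx0
    hkernel).trans_eq ?_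
  ring

lemma exists_abs_fracLap_le (h : IsTest φ) (h0 : 0 < σ) (h1 : σ < 1) :
    ∃ C, 0 ≤ C ∧ ∀ x, |fracLap σ φ x| ≤ C * (1 + ‖x‖) ^ (-((d : ℝ) + 2 * σ)) := by
  obtain ⟨R, C, -, hC0, hC⟩ := h.exists_abs_fracLap_le_of_far h0 h1
  obtain ⟨B, hB0, hB⟩ : ∃ B, 0 ≤ B ∧ ∀ x, |fracLap σ φ x| ≤ B := by
    rw [h.fracLap_eq_levyOp h0 h1]
    exact (isLevyKernel_fracKernel h0 h1).exists_abs_levyOp_le h.contDiff_two h.2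
  refine ⟨max C (B * (1 + R) ^ ((d : ℝ) + 2 * σ)), le_max_of_le_left hC0, fun x => ?_⟩
  rcases lt_or_ge R ‖x‖ with hx | hx
  · exact (hC x hx).trans (by gcongr; exact le_max_left _ _)
  · calc |fracLap σ φ x| ≤ B := hB x
      _ = B * (1 + ‖x‖) ^ ((d : ℝ) + 2 * σ) * (1 + ‖x‖) ^ (-((d : ℝ) + 2 * σ)) := by
          rw [mul_assoc, ← Real.rpow_add (by positivity), add_neg_cancel, Real.rpow_zero, mul_one]
      _ ≤ B * (1 + R) ^ ((d : ℝ) + 2 * σ) * (1 + ‖x‖) ^ (-((d : ℝ) + 2 * σ)) := by gcongr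
      _ ≤ _ := by gcongr; exact le_max_right _ _

lemma integrable_fracLap (h : IsTest φ) (h0 : 0 < σ) (h1 : σ < 1) : Integrable (fracLap σ φ) := by
  obtain ⟨C, -, hC⟩ := h.exists_abs_fracLap_le h0 h1
  refine ((integrable_one_add_norm (r := (d : ℝ) + 2 * σ) ?_).const_mul C).mono'
    (h.continuous_fracLap h0 h1).aestronglyMeasurable (ae_of_all _ hC)
  rw [finrank_euclideanSpace_fin]
  linarith

end IsTest

end FractionalKernel

section LevySymbol

open scoped FourierTransform RealInnerProductSpace

lemma secondDiff_eq_zero_of_tsupport_subset_closedBall {E : Type*} [NormedAddCommGroup E]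
    {φ : E → ℝ} {R : ℝ}
    (hR : tsupport φ ⊆ Metric.closedBall 0 R) {x z : E} (hz : ‖z‖ ≤ 1) (hx : R + 1 < ‖x‖) :
    secondDiff φ x z = 0 := by
  have hzero {y : E} (hy : R < ‖y‖) : φ y = 0 := image_eq_zero_of_notMem_tsupport fun hmem =>
    hy.not_ge (mem_closedBall_zero_iff.1 (hR hmem))
  have hadd : R < ‖x + z‖ := by linarith [norm_sub_le_norm_add x z]
  have hsub : R < ‖x - z‖ := by linarith [norm_sub_norm_le x z]
  rw [secondDiff, hzero (by linarith : R < ‖x‖), hzero hadd, hzero hsub]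
  ring

variable {E : Type*} [NormedAddCommGroup E] [InnerProductSpace ℝ E] [FiniteDimensional ℝ E]
  [MeasurableSpace E] [BorelSpace E] {K φ : E → ℝ}

lemma integrable_secondDiff (hφ : Integrable φ) (z : E) : Integrable fun x => secondDiff φ x z :=
  ((hφ.const_mul 2).sub (hφ.comp_add_right z)).sub (hφ.comp_sub_right z)

lemma integral_abs_secondDiff_le_four_mul (hφ : Integrable φ) (z : E) :
    ∫ x, |secondDiff φ x z| ≤ 4 * ∫ x, |φ x| := by
  have hadd : Integrable fun x => |φ (x + z)| := hφ.abs.comp_add_right z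
  have hsub : Integrable fun x => |φ (x - z)| := hφ.abs.comp_sub_right z
  have htwo : Integrable fun x => 2 * |φ x| := hφ.abs.const_mul 2
  have htwoadd : Integrable fun x => 2 * |φ x| + |φ (x + z)| := htwo.add hadd
  have htri (x : E) : |secondDiff φ x z| ≤ 2 * |φ x| + |φ (x + z)| + |φ (x - z)| := by
    refine (abs_sub _ _).trans (add_le_add_left ((abs_sub _ _).trans_eq ?_) _)
    rw [abs_mul, abs_two]
  calc ∫ x, |secondDiff φ x z| ≤ ∫ x, (2 * |φ x| + |φ (x + z)| + |φ (x - z)|) :=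
        integral_mono (integrable_secondDiff hφ z).abs (htwoadd.add hsub) htri
    _ = 4 * ∫ x, |φ x| := by
        rw [integral_add htwoadd hsub, integral_add htwo hadd, integral_const_mul,
          integral_add_right_eq_self (fun y => |φ y|) z,
          integral_sub_right_eq_self (fun y => |φ y|) z]
        ring

lemma exists_integral_abs_secondDiff_le (hφ : ContDiff ℝ 2 φ) (hc : HasCompactSupport φ) :
    ∃ C, 0 ≤ C ∧ ∀ z, ∫ x, |secondDiff φ x z| ≤ C * min 1 (‖z‖ ^ 2) := by
  obtain ⟨C, hC0, hC⟩ := exists_abs_secondDiff_le hφ hc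
  obtain ⟨R, hR⟩ := hc.isCompact.isBounded.subset_closedBall 0
  have hi : Integrable φ := hφ.continuous.integrable_of_hasCompactSupport hc
  set V := volume.real (Metric.closedBall (0 : E) (R + 1))
  have hI0 : 0 ≤ ∫ x, |φ x| := integral_nonneg fun _ => abs_nonneg _
  refine ⟨4 * (∫ x, |φ x|) + C * V, by positivity, fun z => ?_⟩
  rcases lt_or_ge 1 ‖z‖ with hz | hz
  · rw [min_eq_left (one_le_pow₀ hz.le), mul_one]
    exact (integral_abs_secondDiff_le_four_mul hi z).trans (le_add_of_nonneg_right (by positivity))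
  · rw [min_eq_right (pow_le_one₀ (norm_nonneg z) hz)]
    have hsupp : ∀ x ∉ Metric.closedBall (0 : E) (R + 1), |secondDiff φ x z| = 0 := by
      intro x hx
      rw [mem_closedBall_zero_iff, not_le] at hx
      rw [secondDiff_eq_zero_of_tsupport_subset_closedBall hR hz hx, abs_zero]
    calc ∫ x, |secondDiff φ x z| = ∫ x in Metric.closedBall 0 (R + 1), |secondDiff φ x z| :=
          (setIntegral_eq_integral_of_forall_compl_eq_zero hsupp).symm
      _ ≤ ∫ _ in Metric.closedBall (0 : E) (R + 1), C * ‖z‖ ^ 2 :=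
          integral_mono (integrable_secondDiff hi z).abs.integrableOn
            (integrableOn_const measure_closedBall_lt_top.ne)
            fun x => (hC x z).trans (by gcongr; exact min_le_right _ _)
      _ = C * V * ‖z‖ ^ 2 := by rw [setIntegral_const, smul_eq_mul]; ring
      _ ≤ (4 * (∫ x, |φ x|) + C * V) * ‖z‖ ^ 2 := by gcongr; linarith

lemma IsLevyKernel.integrable_prod_secondDiff_mul (hK : IsLevyKernel K) (hφ : ContDiff ℝ 2 φ)
    (hc : HasCompactSupport φ) :
    Integrable (fun p : E × E => secondDiff φ p.1 p.2 / 2 * K p.2) (volume.prod volume) := by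
  obtain ⟨C, -, hC⟩ := exists_integral_abs_secondDiff_le hφ hc
  have hm := (hK.measurable_secondDiff_mul hφ.continuous).aestronglyMeasurable
    (μ := (volume : Measure E).prod volume)
  refine (integrable_prod_iff' hm).2 ⟨ae_of_all _ fun z => ((integrable_secondDiff
    (hφ.continuous.integrable_of_hasCompactSupport hc) z).div_const 2).mul_const (K z), ?_⟩
  refine (hK.integrable.const_mul (C / 2)).mono' hm.norm.prod_swap.integral_prod_right'
    (ae_of_all _ fun z => ?_)
  rw [Real.norm_of_nonneg (integral_nonneg fun _ => norm_nonneg _)]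
  calc ∫ x, ‖secondDiff φ x z / 2 * K z‖ = (∫ x, |secondDiff φ x z|) / 2 * K z := by
        simp only [norm_mul, norm_div, Real.norm_two, Real.norm_of_nonneg (hK.nonneg z)]
        rw [integral_mul_const, integral_div]
        rfl
    _ ≤ C * min 1 (‖z‖ ^ 2) / 2 * K z :=
        mul_le_mul_of_nonneg_right (by linarith [hC z]) (hK.nonneg z)
    _ = C / 2 * (min 1 (‖z‖ ^ 2) * K z) := by ring

/-- The Lévy–Khintchine symbol of the kernel `K`, with the normalisation `exp (-2πi⟪x, ξ⟫)` of the
Fourier transform. -/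
def levySymbol (K : E → ℝ) (ξ : E) : ℝ := ∫ z, (1 - Real.cos (2 * Real.pi * ⟪z, ξ⟫)) * K z

lemma fourier_comp_add_right (f : E → ℂ) (z ξ : E) :
    𝓕 (fun x => f (x + z)) ξ = 𝐞 ⟪z, ξ⟫ • 𝓕 f ξ :=
  congrFun (VectorFourier.fourierIntegral_comp_add_right 𝐞 volume (innerₗ E) f z) ξ

lemma fourier_secondDiff (hφ : Integrable φ) (z ξ : E) :
    𝓕 (fun x => (secondDiff φ x z : ℂ)) ξ =
      (2 * (1 - Real.cos (2 * Real.pi * ⟪z, ξ⟫)) : ℝ) * 𝓕 (fun x => (φ x : ℂ)) ξ := by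
  have hconv {f : E → ℂ} (hf : Integrable f) : Integrable fun x => 𝐞 (-⟪x, ξ⟫) • f x :=
    (Real.fourierIntegral_convergent_iff ξ).2 hf
  have hC : Integrable fun x => (φ x : ℂ) := hφ.ofReal
  have hlin : 𝓕 (fun x => (secondDiff φ x z : ℂ)) ξ = 2 * 𝓕 (fun x => (φ x : ℂ)) ξ -
      𝓕 (fun x => (φ (x + z) : ℂ)) ξ - 𝓕 (fun x => (φ (x + -z) : ℂ)) ξ := by
    simp only [Real.fourier_eq]
    have htwo := (hconv hC).const_mul 2
    have hadd := hconv (hC.comp_add_right z)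
    rw [← integral_const_mul, ← integral_sub' htwo hadd,
      ← integral_sub' (htwo.sub hadd) (hconv (hC.comp_add_right (-z)))]
    congr 1 with x
    simp only [Pi.sub_apply, secondDiff, Circle.smul_def, smul_eq_mul, ← sub_eq_add_neg]
    push_cast
    ring
  rw [hlin, fourier_comp_add_right (fun x => (φ x : ℂ)),
    fourier_comp_add_right (fun x => (φ x : ℂ))]
  simp only [Circle.smul_def, Real.fourierChar_apply, inner_neg_left, smul_eq_mul]
  push_cast
  rw [Complex.cos]
  ring_nf

lemma fourier_secondDiff_mul_const (hφ : Integrable φ) (z ξ : E) (k : ℝ) :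
    ∫ x, 𝐞 (-⟪x, ξ⟫) • ((secondDiff φ x z / 2 * k : ℝ) : ℂ) =
      ((1 - Real.cos (2 * Real.pi * ⟪z, ξ⟫)) * k : ℝ) * 𝓕 (fun x => (φ x : ℂ)) ξ := by
  have h := fourier_secondDiff hφ z ξ
  rw [Real.fourier_eq] at h
  calc ∫ x, 𝐞 (-⟪x, ξ⟫) • ((secondDiff φ x z / 2 * k : ℝ) : ℂ)
      = ∫ x, 𝐞 (-⟪x, ξ⟫) • (secondDiff φ x z : ℂ) * (k / 2 : ℝ) := by
        congr 1 with x
        simp only [Circle.smul_def, smul_eq_mul]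
        push_cast
        ring
    _ = _ := by
        rw [integral_mul_const, h]
        push_cast
        ring

lemma IsLevyKernel.fourier_levyOp (hK : IsLevyKernel K) (hφ : ContDiff ℝ 2 φ)
    (hc : HasCompactSupport φ) (ξ : E) :
    𝓕 (fun x => (levyOp K φ x : ℂ)) ξ = levySymbol K ξ * 𝓕 (fun x => (φ x : ℂ)) ξ := by
  have hprod := (hK.integrable_prod_secondDiff_mul hφ hc).ofReal (𝕜 := ℂ)
  have hint : Integrable (Function.uncurry fun x z : E =>
      𝐞 (-⟪x, ξ⟫) • ((secondDiff φ x z / 2 * K z : ℝ) : ℂ)) (volume.prod volume) := by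
    refine hprod.norm.mono' (AEStronglyMeasurable.smul (f := fun p : E × E => 𝐞 (-⟪p.1, ξ⟫))
      (Real.continuous_fourierChar.comp (by fun_prop)).aestronglyMeasurable
      hprod.aestronglyMeasurable) (ae_of_all _ fun p => ?_)
    exact (Circle.norm_smul _ _).le
  rw [Real.fourier_eq]
  calc ∫ x, 𝐞 (-⟪x, ξ⟫) • (levyOp K φ x : ℂ)
      = ∫ x, ∫ z, 𝐞 (-⟪x, ξ⟫) • ((secondDiff φ x z / 2 * K z : ℝ) : ℂ) := by
        congr 1 with x
        simp only [Circle.smul_def]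
        rw [integral_smul, integral_complex_ofReal]
        rfl
    _ = ∫ z, ∫ x, 𝐞 (-⟪x, ξ⟫) • ((secondDiff φ x z / 2 * K z : ℝ) : ℂ) :=
        integral_integral_swap hint
    _ = levySymbol K ξ * 𝓕 (fun x => (φ x : ℂ)) ξ := by
        simp only [fourier_secondDiff_mul_const
          (hφ.continuous.integrable_of_hasCompactSupport hc)]
        rw [integral_mul_const, integral_complex_ofReal]
        rfl

lemma integral_mul_eq_integral_fourier {f g : E → ℝ} (hf : Integrable f) (hg : Integrable g)
    (hgc : Continuous g) (hgF : Integrable (𝓕 fun x => (g x : ℂ))) :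
    ((∫ x, f x * g x : ℝ) : ℂ) =
      ∫ ξ, 𝓕 (fun x => (f x : ℂ)) (-ξ) * 𝓕 (fun x => (g x : ℂ)) ξ := by
  have hinv : 𝓕⁻ (𝓕 fun x => (g x : ℂ)) = fun x => (g x : ℂ) :=
    Continuous.fourierInv_fourier_eq (Complex.continuous_ofReal.comp hgc) hg.ofReal hgF
  rw [Real.fourierInv_eq_fourier_comp_neg] at hinv
  have hflip : ∫ ξ, 𝓕 (fun x => (f x : ℂ)) ξ • 𝓕 (fun x => (g x : ℂ)) (-ξ) =
      ∫ x, (f x : ℂ) • 𝓕 (fun ξ => 𝓕 (fun x => (g x : ℂ)) (-ξ)) x := by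
    have h := VectorFourier.integral_fourierIntegral_smul_eq_flip
      (L := innerₗ E) (μ := volume) (ν := volume) Real.continuous_fourierChar continuous_inner
      (hf.ofReal (𝕜 := ℂ)) hgF.comp_neg
    rwa [flip_innerₗ] at h
  rw [hinv, ← integral_neg_eq_self] at hflip
  simp only [smul_eq_mul, neg_neg, ← Complex.ofReal_mul] at hflip
  rw [hflip, integral_complex_ofReal]

end LevySymbol

section FractionalSymbol

open scoped FourierTransform RealInnerProductSpace

variable {d : ℕ}

lemma IsTest.integrable_rpow_mul_fourier {φ : EuclideanSpace ℝ (Fin d) → ℝ} (h : IsTest φ) {a : ℝ}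
    (ha0 : 0 ≤ a) (ha2 : a ≤ 2) :
    Integrable fun ξ => ((2 * Real.pi * ‖ξ‖) ^ a : ℝ) * 𝓕 (fun x => (φ x : ℂ)) ξ := by
  have hsmooth : ContDiff ℝ ∞ fun x => (φ x : ℂ) := Complex.ofRealCLM.contDiff.comp h.1
  let Φ := 𝓕 ((h.2.comp_left (g := Complex.ofReal) rfl).toSchwartzMap hsmooth)
  change Integrable fun ξ => ((2 * Real.pi * ‖ξ‖) ^ a : ℝ) * Φ ξ
  refine ((Φ.integrable_pow_mul volume 0).add
    ((Φ.integrable_pow_mul volume 2).const_mul ((2 * Real.pi) ^ 2))).mono' ?_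
    (ae_of_all _ fun ξ => ?_)
  · refine (Complex.continuous_ofReal.comp ?_).aestronglyMeasurable.mul
      Φ.continuous.aestronglyMeasurable
    exact Continuous.rpow_const (by fun_prop) fun _ => Or.inr ha0
  · have hpow {y : ℝ} (hy : 0 ≤ y) : y ^ a ≤ 1 + y ^ 2 := by
      rcases le_or_gt y 1 with hy1 | hy1
      · exact (Real.rpow_le_one hy hy1 ha0).trans (le_add_of_nonneg_right (sq_nonneg y))
      · rw [← Real.rpow_two]
        exact (Real.rpow_le_rpow_of_exponent_le hy1.le ha2).trans
          (le_add_of_nonneg_left zero_le_one)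
    rw [norm_mul, Complex.norm_real, Real.norm_of_nonneg (by positivity)]
    calc (2 * Real.pi * ‖ξ‖) ^ a * ‖Φ ξ‖ ≤ (1 + (2 * Real.pi * ‖ξ‖) ^ 2) * ‖Φ ξ‖ := by
          gcongr
          exact hpow (by positivity)
      _ = ‖ξ‖ ^ 0 * ‖Φ ξ‖ + (2 * Real.pi) ^ 2 * (‖ξ‖ ^ 2 * ‖Φ ξ‖) := by ring

variable [NeZero d] {σ : ℝ}

lemma integrable_one_sub_cos_div (h0 : 0 < σ) (h1 : σ < 1) :
    Integrable fun ζ : EuclideanSpace ℝ (Fin d) =>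
      (1 - Real.cos (ζ 0)) / ‖ζ‖ ^ ((d : ℝ) + 2 * σ) := by
  refine ((integrable_min_one_norm_sq_div h0 h1).const_mul 2).mono'
    (Measurable.div (by fun_prop) (measurable_norm.pow_const _)).aestronglyMeasurable
    (ae_of_all _ fun ζ => ?_)
  have hcoord : (ζ 0) ^ 2 ≤ ‖ζ‖ ^ 2 := by
    rw [← sq_abs]
    gcongr
    exact PiLp.norm_apply_le ζ 0
  have hcos : 1 - Real.cos (ζ 0) ≤ 2 * min 1 (‖ζ‖ ^ 2) := by
    rw [mul_min_of_nonneg _ _ zero_le_two]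
    refine le_min (by linarith [Real.neg_one_le_cos (ζ 0)]) ?_
    linarith [Real.one_sub_sq_div_two_le_cos (x := ζ 0), sq_nonneg ‖ζ‖]
  rw [norm_div, Real.norm_of_nonneg (sub_nonneg.2 (Real.cos_le_one _)),
    Real.norm_of_nonneg (by positivity), ← mul_div_assoc]
  gcongr

lemma normConst_pos (h0 : 0 < σ) (h1 : σ < 1) : 0 < normConst d σ := by
  unfold normConst
  rw [inv_pos, integral_pos_iff_support_of_nonneg (fun ζ =>
    div_nonneg (sub_nonneg.2 (Real.cos_le_one _)) (by positivity))
    (integrable_one_sub_cos_div h0 h1)]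
  have hcont : Continuous fun ζ : EuclideanSpace ℝ (Fin d) => ζ 0 := by fun_prop
  have hopen : IsOpen {ζ : EuclideanSpace ℝ (Fin d) | ζ 0 ∈ Ioo 0 1} :=
    isOpen_Ioo.preimage hcont
  have hne : {ζ : EuclideanSpace ℝ (Fin d) | ζ 0 ∈ Ioo 0 1}.Nonempty :=
    ⟨EuclideanSpace.single 0 (1 / 2), by norm_num⟩
  refine (hopen.measure_pos volume hne).trans_le (measure_mono fun ζ hζ => ?_)
  have hnorm : 0 < ‖ζ‖ := hζ.1.trans_le ((le_abs_self _).trans (PiLp.norm_apply_le ζ 0))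
  have hcos : Real.cos (ζ 0) < 1 := Real.cos_zero ▸
    Real.cos_lt_cos_of_nonneg_of_le_pi le_rfl (by linarith [hζ.2, Real.pi_gt_three]) hζ.1
  exact (div_pos (sub_pos.2 hcos) (Real.rpow_pos_of_pos hnorm _)).ne'

/-- Rotate `ξ` onto the first coordinate axis, then rescale by `2π‖ξ‖`. -/
lemma levySymbol_fracKernel (h0 : 0 < σ) (h1 : σ < 1) (ξ : EuclideanSpace ℝ (Fin d)) :
    levySymbol (fracKernel d σ) ξ = (2 * Real.pi * ‖ξ‖) ^ (2 * σ) := by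
  rcases eq_or_ne ξ 0 with rfl | hξ
  · simp [levySymbol, Real.zero_rpow (by positivity : 2 * σ ≠ 0)]
  set c := 2 * Real.pi * ‖ξ‖ with hc
  have hc0 : 0 < c := by positivity
  obtain ⟨A, hA⟩ : ∃ A : EuclideanSpace ℝ (Fin d) ≃ₗᵢ[ℝ] EuclideanSpace ℝ (Fin d),
      A (EuclideanSpace.single 0 ‖ξ‖) = ξ := ⟨_, Submodule.reflection_sub (by simp)⟩
  have hinner (z) : ⟪A z, ξ⟫ = ‖ξ‖ * z 0 := by
    rw [← hA, A.inner_map_map, EuclideanSpace.inner_single_right, A.norm_map]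
    simp
  let g : EuclideanSpace ℝ (Fin d) → ℝ := fun ζ => (1 - Real.cos (ζ 0)) / ‖ζ‖ ^ ((d : ℝ) + 2 * σ)
  have hg : ∫ ζ, g ζ = (normConst d σ)⁻¹ := (inv_inv _).symm
  have hscaled : levySymbol (fracKernel d σ) ξ =
      normConst d σ * c ^ ((d : ℝ) + 2 * σ) * ∫ z, g (c • z) := by
    unfold levySymbol
    rw [← A.measurePreserving.integral_comp A.toHomeomorph.measurableEmbedding,
      ← integral_const_mul]
    congr 1 with z
    simp only [g, fracKernel, hinner, norm_smul, PiLp.smul_apply, smul_eq_mul,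
      Real.norm_of_nonneg hc0.le, A.norm_map]
    rw [Real.mul_rpow hc0.le (norm_nonneg _), ← mul_assoc, ← hc]
    field_simp
  have hpos := normConst_pos (d := d) h0 h1
  rw [hscaled, Measure.integral_comp_smul, finrank_euclideanSpace_fin, hg, smul_eq_mul,
    abs_of_nonneg (by positivity), Real.rpow_add hc0, Real.rpow_natCast]
  field_simp

namespace IsTest

variable {φ ψ : EuclideanSpace ℝ (Fin d) → ℝ}

lemma fourier_fracLap (h : IsTest φ) (h0 : 0 < σ) (h1 : σ < 1) (ξ : EuclideanSpace ℝ (Fin d)) :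
    𝓕 (fun x => (fracLap σ φ x : ℂ)) ξ =
      ((2 * Real.pi * ‖ξ‖) ^ (2 * σ) : ℝ) * 𝓕 (fun x => (φ x : ℂ)) ξ := by
  rw [h.fracLap_eq_levyOp h0 h1, (isLevyKernel_fracKernel h0 h1).fourier_levyOp h.contDiff_two h.2,
    levySymbol_fracKernel h0 h1]

lemma integrable_fourier_fracLap (h : IsTest φ) (h0 : 0 < σ) (h1 : σ < 1) :
    Integrable (𝓕 fun x => (fracLap σ φ x : ℂ)) := by
  rw [funext (h.fourier_fracLap h0 h1)]
  exact h.integrable_rpow_mul_fourier (by positivity) (by linarith)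

lemma integral_fracLap_mul_fracLap (hφ : IsTest φ) (hψ : IsTest ψ) {τ : ℝ} (hσ : 0 < σ)
    (hτ : 0 < τ) (hστ : σ + τ < 1) :
    ∫ x, fracLap σ φ x * fracLap τ ψ x = ∫ x, φ x * fracLap (σ + τ) ψ x := by
  have hσ1 : σ < 1 := by linarith
  have hτ1 : τ < 1 := by linarith
  rw [← Complex.ofReal_inj,
    integral_mul_eq_integral_fourier (hφ.integrable_fracLap hσ hσ1) (hψ.integrable_fracLap hτ hτ1)
      (hψ.continuous_fracLap hτ hτ1) (hψ.integrable_fourier_fracLap hτ hτ1),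
    integral_mul_eq_integral_fourier hφ.integrable (hψ.integrable_fracLap (add_pos hσ hτ) hστ)
      (hψ.continuous_fracLap (add_pos hσ hτ) hστ)
      (hψ.integrable_fourier_fracLap (add_pos hσ hτ) hστ)]
  congr 1 with ξ
  rw [hφ.fourier_fracLap hσ hσ1, hψ.fourier_fracLap hτ hτ1,
    hψ.fourier_fracLap (add_pos hσ hτ) hστ, norm_neg, mul_add,
    Real.rpow_add_of_nonneg (by positivity) (by positivity) (by positivity)]
  push_cast
  ring

lemma integral_fracLap_half_mul_fracLap_half (hφ : IsTest φ) (hψ : IsTest ψ) {s : ℝ} (h0 : 0 < s)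
    (h1 : s < 1) :
    ∫ x, fracLap (s / 2) φ x * fracLap (s / 2) ψ x = ∫ x, φ x * fracLap s ψ x := by
  rw [hφ.integral_fracLap_mul_fracLap hψ (half_pos h0) (half_pos h0) (by rwa [add_halves]),
    add_halves]

lemma integral_fracLap_mul (hφ : IsTest φ) (hψ : IsTest ψ) (h0 : 0 < σ) (h1 : σ < 1) :
    ∫ x, fracLap σ φ x * ψ x = ∫ x, φ x * fracLap σ ψ x := by
  simp only [mul_comm _ (ψ _)]
  rw [← hψ.integral_fracLap_half_mul_fracLap_half hφ h0 h1,
    ← hφ.integral_fracLap_half_mul_fracLap_half hψ h0 h1]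
  simp only [mul_comm]

end IsTest

end FractionalSymbol

section LevyEnergy

variable {E : Type*} [NormedAddCommGroup E] [InnerProductSpace ℝ E] [FiniteDimensional ℝ E]
  [MeasurableSpace E] [BorelSpace E] {K φ : E → ℝ}

lemma integral_sq_sub_eq_integral_mul_secondDiff (hφ : Continuous φ) (hc : HasCompactSupport φ)
    (z : E) : ∫ x, (φ x - φ (x + z)) ^ 2 = ∫ x, φ x * secondDiff φ x z := by
  have hint {f g : E → ℝ} (hf : Continuous f) (hg : Continuous g) (hfc : HasCompactSupport f) :
      Integrable fun x => f x * g x :=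
    (hf.mul hg).integrable_of_hasCompactSupport hfc.mul_right
  have hdiag : Integrable fun x => φ x * φ x := hint hφ hφ hc
  have hshift : Integrable fun x => φ (x + z) * φ (x + z) := hdiag.comp_add_right z
  have hadd : Integrable fun x => φ x * φ (x + z) := hint hφ (by fun_prop) hc
  have hsub : Integrable fun x => φ x * φ (x - z) := hint hφ (by fun_prop) hc
  have hsub_eq : ∫ x, φ x * φ (x - z) = ∫ x, φ x * φ (x + z) := by
    rw [← integral_add_right_eq_self _ z]
    simp only [add_sub_cancel_right, mul_comm]
  have hsum : Integrable fun x => φ x * φ x + φ (x + z) * φ (x + z) := hdiag.add hshift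
  have hdiff : Integrable fun x => 2 * (φ x * φ x) - φ x * φ (x + z) :=
    (hdiag.const_mul 2).sub hadd
  calc ∫ x, (φ x - φ (x + z)) ^ 2
      = ∫ x, (φ x * φ x + φ (x + z) * φ (x + z) - 2 * (φ x * φ (x + z))) := by
        congr 1 with x
        ring
    _ = 2 * (∫ x, φ x * φ x) - (∫ x, φ x * φ (x + z)) - ∫ x, φ x * φ (x - z) := by
        rw [integral_sub hsum (hadd.const_mul 2),
          integral_add hdiag hshift, integral_const_mul, hsub_eq,
          integral_add_right_eq_self (fun x => φ x * φ x) z]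
        ring
    _ = ∫ x, (2 * (φ x * φ x) - φ x * φ (x + z) - φ x * φ (x - z)) := by
        rw [integral_sub hdiff hsub,
          integral_sub (hdiag.const_mul 2) hadd, integral_const_mul]
    _ = ∫ x, φ x * secondDiff φ x z := by
        congr 1 with x
        unfold secondDiff
        ring

lemma two_mul_integral_mul_secondDiff_mul (hφ : Continuous φ) (hc : HasCompactSupport φ) (z : E)
    (k : ℝ) : 2 * ∫ x, φ x * (secondDiff φ x z / 2 * k) = (∫ x, (φ x - φ (x + z)) ^ 2) * k := by
  rw [integral_sq_sub_eq_integral_mul_secondDiff hφ hc, ← integral_const_mul, ← integral_mul_const]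
  congr 1 with x
  ring

lemma lintegral_sq_sub_mul (hφ : Continuous φ) (hc : HasCompactSupport φ) (z : E) {k : ℝ}
    (hk : 0 ≤ k) : ∫⁻ x, ENNReal.ofReal ((φ x - φ (x + z)) ^ 2 * k) =
      ENNReal.ofReal (2 * ∫ x, φ x * (secondDiff φ x z / 2 * k)) := by
  have hsq : Integrable fun x => (φ x - φ (x + z)) ^ 2 := by
    have hdiff : HasCompactSupport fun x => φ x - φ (x + z) :=
      hc.sub (hc.comp_homeomorph (Homeomorph.addRight z))
    exact Continuous.integrable_of_hasCompactSupport (by fun_prop)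
      (hdiff.comp_left (g := fun t : ℝ => t ^ 2) (by simp))
  rw [← ofReal_integral_eq_lintegral_ofReal (hsq.mul_const k)
    (ae_of_all _ fun x => mul_nonneg (sq_nonneg _) hk), integral_mul_const,
    two_mul_integral_mul_secondDiff_mul hφ hc]

lemma IsLevyKernel.lintegral_lintegral_sq_sub_mul (hK : IsLevyKernel K) (hφ : ContDiff ℝ 2 φ)
    (hc : HasCompactSupport φ) :
    ∫⁻ x, ∫⁻ y, ENNReal.ofReal ((φ x - φ y) ^ 2 * K (x - y)) =
      ENNReal.ofReal (2 * ∫ x, φ x * levyOp K φ x) := by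
  have hcont := hφ.continuous
  have hmeas : Measurable fun p : E × E =>
      ENNReal.ofReal ((φ p.1 - φ (p.1 + p.2)) ^ 2 * K p.2) :=
    (Measurable.mul (Continuous.measurable (by fun_prop))
      (hK.measurable.comp measurable_snd)).ennreal_ofReal
  have hprod : Integrable (fun p : E × E => φ p.1 * (secondDiff φ p.1 p.2 / 2 * K p.2))
      (volume.prod volume) := by
    obtain ⟨B, hB⟩ := hcont.bounded_above_of_compact_support hc
    exact (hK.integrable_prod_secondDiff_mul hφ hc).bdd_mul (c := B)
      (hcont.comp continuous_fst).aestronglyMeasurable (ae_of_all _ fun p => hB p.1)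
  calc ∫⁻ x, ∫⁻ y, ENNReal.ofReal ((φ x - φ y) ^ 2 * K (x - y))
      = ∫⁻ x, ∫⁻ z, ENNReal.ofReal ((φ x - φ (x + z)) ^ 2 * K z) := by
        congr 1 with x
        rw [← lintegral_add_left_eq_self _ x]
        simp only [sub_add_cancel_left, hK.even]
    _ = ∫⁻ z, ∫⁻ x, ENNReal.ofReal ((φ x - φ (x + z)) ^ 2 * K z) :=
        lintegral_lintegral_swap hmeas.aemeasurable
    _ = ∫⁻ z, ENNReal.ofReal (2 * ∫ x, φ x * (secondDiff φ x z / 2 * K z)) :=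
        lintegral_congr fun z => lintegral_sq_sub_mul hcont hc z (hK.nonneg z)
    _ = ENNReal.ofReal (2 * ∫ z, ∫ x, φ x * (secondDiff φ x z / 2 * K z)) := by
        rw [← ofReal_integral_eq_lintegral_ofReal (hprod.integral_prod_right.const_mul 2)
          (ae_of_all _ fun z => ?_), integral_const_mul]
        simp only [two_mul_integral_mul_secondDiff_mul hcont hc]
        exact mul_nonneg (integral_nonneg fun _ => sq_nonneg _) (hK.nonneg z)
    _ = ENNReal.ofReal (2 * ∫ x, φ x * levyOp K φ x) := by
        rw [← integral_integral_swap
          (f := fun x z => φ x * (secondDiff φ x z / 2 * K z)) hprod]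
        simp only [integral_const_mul, levyOp]

lemma IsLevyKernel.levyOp_sub (hK : IsLevyKernel K) {ψ : E → ℝ} (hφ : ContDiff ℝ 2 φ)
    (hφc : HasCompactSupport φ) (hψ : ContDiff ℝ 2 ψ) (hψc : HasCompactSupport ψ) :
    levyOp K (fun x => φ x - ψ x) = levyOp K φ - levyOp K ψ := by
  ext x
  rw [Pi.sub_apply]
  unfold levyOp
  rw [← integral_sub (hK.integrable_secondDiff_mul hφ hφc x)
    (hK.integrable_secondDiff_mul hψ hψc x)]
  congr 1 with z
  unfold secondDiff
  ring

end LevyEnergy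

section LebesgueSpaces

variable {α : Type*} [MeasurableSpace α] {μ : Measure α}

lemma memLp_ofReal_of_integrable_of_bound {f : α → ℝ} (hf : Integrable f μ) {C : ℝ}
    (hC : ∀ x, |f x| ≤ C) {q : ℝ} (hq : 1 ≤ q) : MemLp f (ENNReal.ofReal q) μ := by
  rw [← integrable_norm_rpow_iff hf.aestronglyMeasurable
    (ENNReal.ofReal_pos.2 (by linarith)).ne' ENNReal.ofReal_ne_top,
    ENNReal.toReal_ofReal (by linarith)]
  refine (hf.norm.const_mul (C ^ (q - 1))).mono'
    (hf.aestronglyMeasurable.norm.aemeasurable.pow_const q).aestronglyMeasurable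
    (ae_of_all _ fun x => ?_)
  rw [Real.norm_of_nonneg (by positivity)]
  calc ‖f x‖ ^ q = ‖f x‖ ^ (q - 1) * ‖f x‖ := by
        rw [← Real.rpow_add_one' (norm_nonneg _) (by linarith), sub_add_cancel]
    _ ≤ C ^ (q - 1) * ‖f x‖ := by
        gcongr
        exact hC x

lemma tendsto_integral_mul_of_tendsto_eLpNorm {p q : ℝ≥0∞} [p.HolderConjugate q]
    {F : ℕ → α → ℝ} {f g : α → ℝ} (hF : ∀ n, MemLp (F n) p μ) (hf : MemLp f p μ)
    (hg : MemLp g q μ) (hlim : Tendsto (fun n => eLpNorm (F n - f) p μ) atTop (𝓝 0)) :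
    Tendsto (fun n => ∫ x, F n x * g x ∂μ) atTop (𝓝 (∫ x, f x * g x ∂μ)) := by
  refine tendsto_integral_of_L1' _ (hf.1.mul hg.1)
    (Eventually.of_forall fun n => (hF n).integrable_mul hg) ?_
  have hbound : Tendsto (fun n => eLpNorm (F n - f) p μ * eLpNorm g q μ) atTop (𝓝 0) := by
    simpa only [zero_mul] using ENNReal.Tendsto.mul_const hlim (Or.inr hg.2.ne)
  refine tendsto_of_tendsto_of_tendsto_of_le_of_le tendsto_const_nhds hbound (fun _ => zero_le)
    fun n => ?_
  have hholder := eLpNorm_smul_le_mul_eLpNorm (p := p) (q := q) (r := 1) hg.1 ((hF n).1.sub hf.1)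
  simpa only [smul_eq_mul, Pi.sub_def, Pi.mul_def, sub_mul] using hholder

lemma exists_memLp_two_tendsto_eLpNorm {F : ℕ → α → ℝ} (hF : ∀ n, MemLp (F n) 2 μ)
    {a : ℕ → ℝ≥0∞} (ha : Tendsto a atTop (𝓝 0))
    (hcauchy : ∀ n k, eLpNorm (F n - F k) 2 μ ^ 2 ≤ 2 * (a n + a k)) :
    ∃ G, MemLp G 2 μ ∧ Tendsto (fun n => eLpNorm (F n - G) 2 μ) atTop (𝓝 0) := by
  let A : ℕ → Lp ℝ 2 μ := fun n => (hF n).toLp (F n)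
  have hdist (n k : ℕ) : eLpNorm (⇑(A n) - ⇑(A k)) 2 μ ≤ (2 * (a n + a k)) ^ (2⁻¹ : ℝ) := by
    rw [eLpNorm_congr_ae ((hF n).coeFn_toLp.sub (hF k).coeFn_toLp),
      ENNReal.le_rpow_inv_iff zero_lt_two, ENNReal.rpow_ofNat]
    exact hcauchy n k
  have hbound : Tendsto (fun n : ℕ × ℕ => (2 * (a n.1 + a n.2)) ^ (2⁻¹ : ℝ)) atTop (𝓝 0) := by
    rw [← prod_atTop_atTop_eq]
    have hsum := ENNReal.Tendsto.const_mul ((ha.comp tendsto_fst).add (ha.comp tendsto_snd))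
      (Or.inr ENNReal.ofNat_ne_top) (a := 2)
    simpa [Function.comp_def] using
      ((ENNReal.continuous_rpow_const (y := 2⁻¹)).tendsto _).comp hsum
  have hA : CauchySeq A := (Lp.cauchySeq_Lp_iff_cauchySeq_eLpNorm A).2
    (tendsto_of_tendsto_of_tendsto_of_le_of_le tendsto_const_nhds hbound (fun _ => zero_le)
      fun n => hdist n.1 n.2)
  obtain ⟨G, hG⟩ := cauchySeq_tendsto_of_complete hA
  refine ⟨G, Lp.memLp G, ?_⟩
  rw [← Lp.toLp_coeFn G (Lp.memLp G)] at hG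
  exact (Lp.tendsto_Lp_iff_tendsto_eLpNorm'' F hF G (Lp.memLp G)).1 hG

end LebesgueSpaces

section HomogeneousSobolev

variable {d : ℕ}

namespace IsTest

variable {φ ψ : EuclideanSpace ℝ (Fin d) → ℝ}

lemma sub (hφ : IsTest φ) (hψ : IsTest ψ) : IsTest fun x => φ x - ψ x :=
  ⟨hφ.1.sub hψ.1, hφ.2.sub hψ.2⟩

lemma memLp (h : IsTest φ) (p : ℝ≥0∞) : MemLp φ p :=
  h.1.continuous.memLp_of_hasCompactSupport h.2

variable [NeZero d] {s σ : ℝ}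

lemma fracLap_sub (hφ : IsTest φ) (hψ : IsTest ψ) (h0 : 0 < σ) (h1 : σ < 1) :
    fracLap σ (fun x => φ x - ψ x) = fracLap σ φ - fracLap σ ψ := by
  rw [(hφ.sub hψ).fracLap_eq_levyOp h0 h1, hφ.fracLap_eq_levyOp h0 h1,
    hψ.fracLap_eq_levyOp h0 h1, (isLevyKernel_fracKernel h0 h1).levyOp_sub hφ.contDiff_two hφ.2
      hψ.contDiff_two hψ.2]

lemma memLp_fracLap (h : IsTest φ) (h0 : 0 < σ) (h1 : σ < 1) {q : ℝ} (hq : 1 ≤ q) :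
    MemLp (fracLap σ φ) (ENNReal.ofReal q) := by
  have hLevy := isLevyKernel_fracKernel (d := d) h0 h1
  obtain ⟨B, -, hB⟩ := hLevy.exists_abs_levyOp_le h.contDiff_two h.2
  exact memLp_ofReal_of_integrable_of_bound (h.integrable_fracLap h0 h1)
    (h.fracLap_eq_levyOp h0 h1 ▸ hB) hq

lemma memLp_two_fracLap (h : IsTest φ) (h0 : 0 < σ) (h1 : σ < 1) : MemLp (fracLap σ φ) 2 := by
  simpa using h.memLp_fracLap h0 h1 one_le_two

lemma hdotNormSq_eq (h : IsTest φ) (h0 : 0 < s) (h1 : s < 1) :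
    hdotNormSq s φ = ENNReal.ofReal (∫ x, φ x * fracLap s φ x) := by
  have hC : 0 ≤ normConst d s / 2 := by linarith [normConst_nonneg (d := d) s]
  calc hdotNormSq s φ = ENNReal.ofReal (1 / 2) *
        ∫⁻ x, ∫⁻ y, ENNReal.ofReal ((φ x - φ y) ^ 2 * fracKernel d s (x - y)) := by
        unfold hdotNormSq
        simp only [← lintegral_const_mul' _ _ ENNReal.ofReal_ne_top]
        refine lintegral_congr fun x => lintegral_congr fun y => ?_
        rw [← ENNReal.ofReal_mul hC, ← ENNReal.ofReal_mul (by norm_num)]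
        unfold fracKernel
        ring_nf
    _ = ENNReal.ofReal (∫ x, φ x * fracLap s φ x) := by
        rw [(isLevyKernel_fracKernel h0 h1).lintegral_lintegral_sq_sub_mul h.contDiff_two h.2,
          ← h.fracLap_eq_levyOp h0 h1, ← ENNReal.ofReal_mul (by norm_num), ← mul_assoc,
          one_div_mul_cancel two_ne_zero, one_mul]

lemma eLpNorm_fracLap_half_sq (h : IsTest φ) (h0 : 0 < s) (h1 : s < 1) :
    eLpNorm (fracLap (s / 2) φ) 2 volume ^ 2 = hdotNormSq s φ := by
  have hmem := h.memLp_two_fracLap (half_pos h0) (by linarith)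
  rw [h.hdotNormSq_eq h0 h1, ← h.integral_fracLap_half_mul_fracLap_half h h0 h1,
    ofReal_integral_eq_lintegral_ofReal (f := fun x => fracLap (s / 2) φ x * fracLap (s / 2) φ x)
      (hmem.integrable_mul hmem) (ae_of_all _ fun x => mul_self_nonneg _)]
  have hpow := eLpNorm_nnreal_pow_eq_lintegral (f := fracLap (s / 2) φ) (μ := volume) (p := 2)
    two_ne_zero
  simp only [NNReal.coe_ofNat, ENNReal.rpow_ofNat, ENNReal.coe_ofNat] at hpow
  rw [hpow]
  refine lintegral_congr fun x => ?_
  rw [← ofReal_norm, ← ENNReal.ofReal_pow (norm_nonneg _), Real.norm_eq_abs, sq_abs, sq]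

end IsTest

variable [NeZero d] {s : ℝ} {v w : EuclideanSpace ℝ (Fin d) → ℝ}

lemma hdotNormSq_sub_le (hv : AEStronglyMeasurable v) (hw : AEStronglyMeasurable w) (s : ℝ) :
    hdotNormSq s (fun x => v x - w x) ≤ 2 * (hdotNormSq s v + hdotNormSq s w) := by
  let q (f : EuclideanSpace ℝ (Fin d) → ℝ)
      (p : EuclideanSpace ℝ (Fin d) × EuclideanSpace ℝ (Fin d)) : ℝ≥0∞ :=
    ENNReal.ofReal ((f p.1 - f p.2) ^ 2 / ‖p.1 - p.2‖ ^ ((d : ℝ) + 2 * s))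
  have hq {f : EuclideanSpace ℝ (Fin d) → ℝ} (hf : AEStronglyMeasurable f) :
      AEMeasurable (q f) (volume.prod volume) := by
    have hfst := hf.aemeasurable.comp_quasiMeasurePreserving
      (Measure.quasiMeasurePreserving_fst (μ := volume)
        (ν := (volume : Measure (EuclideanSpace ℝ (Fin d)))))
    have hsnd := hf.aemeasurable.comp_quasiMeasurePreserving
      (Measure.quasiMeasurePreserving_snd (ν := volume)
        (μ := (volume : Measure (EuclideanSpace ℝ (Fin d)))))
    exact (((hfst.sub hsnd).pow_const 2).div
      (Measurable.aemeasurable (by fun_prop))).ennreal_ofReal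
  have hnorm {f : EuclideanSpace ℝ (Fin d) → ℝ} (hf : AEStronglyMeasurable f) :
      hdotNormSq s f = ENNReal.ofReal (normConst d s / 2) * ∫⁻ p, q f p ∂volume.prod volume := by
    rw [lintegral_prod _ (hq hf), hdotNormSq]
  have hpt (p) : q (fun x => v x - w x) p ≤ 2 * (q v p + q w p) := by
    have htwo (a : ℝ) : 2 * ENNReal.ofReal a = ENNReal.ofReal (2 * a) := by
      rw [ENNReal.ofReal_mul zero_le_two, ENNReal.ofReal_ofNat]
    simp only [q]
    rw [← ENNReal.ofReal_add (by positivity) (by positivity), ← add_div, htwo, ← mul_div_assoc]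
    gcongr
    linarith [sq_nonneg (v p.1 - v p.2 + (w p.1 - w p.2))]
  rw [hnorm hv, hnorm hw, hnorm (f := fun x => v x - w x) (hv.sub hw), ← mul_add,
    ← lintegral_add_left' (hq hv), mul_left_comm, ← lintegral_const_mul' _ _ ENNReal.ofNat_ne_top]
  gcongr
  exact hpt _

lemma IsTest.eLpNorm_fracLap_half_sub_sq_le {φ ψ : EuclideanSpace ℝ (Fin d) → ℝ} (hφ : IsTest φ)
    (hψ : IsTest ψ) (hv : AEStronglyMeasurable v) (h0 : 0 < s) (h1 : s < 1) :
    eLpNorm (fracLap (s / 2) φ - fracLap (s / 2) ψ) 2 volume ^ 2 ≤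
      2 * (hdotNormSq s (fun x => v x - φ x) + hdotNormSq s (fun x => v x - ψ x)) := by
  rw [← hφ.fracLap_sub hψ (half_pos h0) (by linarith),
    (hφ.sub hψ).eLpNorm_fracLap_half_sq h0 h1, add_comm]
  simpa only [Pi.sub_apply, Pi.sub_def, sub_sub_sub_cancel_left] using
    hdotNormSq_sub_le (hv.sub hψ.1.continuous.aestronglyMeasurable)
      (hv.sub hφ.1.continuous.aestronglyMeasurable) s

namespace MemHdot

lemma memLp (hv : MemHdot s v) : MemLp v (ENNReal.ofReal (2 * d / (d - 2 * s))) := by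
  obtain ⟨hvm, φ, hφ, -, hlim⟩ := hv
  obtain ⟨n, hn⟩ := (hlim.eventually (gt_mem_nhds ENNReal.zero_lt_top)).exists
  have hsub : MemLp (fun x => v x - φ n x) (ENNReal.ofReal (2 * d / (d - 2 * s))) :=
    ⟨hvm.sub (hφ n).1.continuous.aestronglyMeasurable, hn⟩
  simpa only [Pi.add_def, sub_add_cancel] using hsub.add ((hφ n).memLp _)

/-- The `L²` limit `G` of `(-Δ)^{s/2} φₙ`, for test functions `φₙ → v`, is `(-Δ)^{s/2} v`; it can be
paired with `(-Δ)^{s/2} χ`, which is not compactly supported. -/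
lemma exists_memLp_two_integral_mul_eq (hv : MemHdot s v) (h0 : 0 < s) (h1 : s < 1)
    (hd : 2 * s < d) : ∃ G, MemLp G 2 ∧ ∀ χ : EuclideanSpace ℝ (Fin d) → ℝ, IsTest χ →
      ∫ x, G x * χ x = ∫ x, v x * fracLap (s / 2) χ x ∧
      ∫ x, G x * fracLap (s / 2) χ x = ∫ x, v x * fracLap s χ x := by
  have hvL := hv.memLp
  obtain ⟨hvm, φ, hφ, hlimH, hlimL⟩ := hv
  have h0' : 0 < s / 2 := half_pos h0
  have h1' : s / 2 < 1 := by linarith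
  have hmem (n : ℕ) : MemLp (fracLap (s / 2) (φ n)) 2 := (hφ n).memLp_two_fracLap h0' h1'
  obtain ⟨G, hG, hlimG⟩ := exists_memLp_two_tendsto_eLpNorm hmem hlimH fun n k =>
    (hφ n).eLpNorm_fracLap_half_sub_sq_le (hφ k) hvm h0 h1
  set p : ℝ := 2 * d / (d - 2 * s)
  have hp : 1 < p := (one_lt_div (by linarith)).2 (by linarith)
  have hconj := Real.HolderConjugate.conjExponent hp
  have : (ENNReal.ofReal p).HolderConjugate (ENNReal.ofReal p.conjExponent) := hconj.ennrealOfReal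
  have hlimL' : Tendsto (fun n => eLpNorm (φ n - v) (ENNReal.ofReal p) volume) atTop (𝓝 0) :=
    hlimL.congr fun n => eLpNorm_sub_comm v (φ n) _ _
  have hlim_v {χ : EuclideanSpace ℝ (Fin d) → ℝ} (hχ : IsTest χ) {σ : ℝ} (hσ0 : 0 < σ)
      (hσ1 : σ < 1) :
      Tendsto (fun n => ∫ x, φ n x * fracLap σ χ x) atTop (𝓝 (∫ x, v x * fracLap σ χ x)) :=
    tendsto_integral_mul_of_tendsto_eLpNorm (fun n => (hφ n).memLp _) hvL
      (hχ.memLp_fracLap hσ0 hσ1 hconj.symm.lt.le) hlimL'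
  have hlim_G {χ : EuclideanSpace ℝ (Fin d) → ℝ} (hχ : MemLp χ 2) :
      Tendsto (fun n => ∫ x, fracLap (s / 2) (φ n) x * χ x) atTop (𝓝 (∫ x, G x * χ x)) :=
    tendsto_integral_mul_of_tendsto_eLpNorm hmem hG hχ hlimG
  refine ⟨G, hG, fun χ hχ => ⟨?_, ?_⟩⟩
  · refine tendsto_nhds_unique (hlim_G (hχ.memLp 2)) ((hlim_v hχ h0' h1').congr fun n => ?_)
    exact ((hφ n).integral_fracLap_mul hχ h0' h1').symm
  · refine tendsto_nhds_unique (hlim_G (hχ.memLp_two_fracLap h0' h1'))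
      ((hlim_v hχ h0 h1).congr fun n => ?_)
    exact ((hφ n).integral_fracLap_half_mul_fracLap_half hχ h0 h1).symm

lemma integral_mul_fracLap_half {g χ : EuclideanSpace ℝ (Fin d) → ℝ} (hv : MemHdot s v)
    (hg : IsDistribFracLap (s / 2) v g) (hχ : IsTest χ) (h0 : 0 < s) (h1 : s < 1)
    (hd : 2 * s < d) : ∫ x, g x * fracLap (s / 2) χ x = ∫ x, v x * fracLap s χ x := by
  obtain ⟨G, hG, hGχ⟩ := hv.exists_memLp_two_integral_mul_eq h0 h1 hd
  have hgG : g =ᵐ[volume] G := by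
    refine ae_eq_of_integral_contDiff_smul_eq hg.1 (hG.locallyIntegrable one_le_two)
      fun ψ hψ hψc => ?_
    simp only [smul_eq_mul, mul_comm (ψ _)]
    rw [(hg.2 ψ ⟨hψ, hψc⟩).2, (hGχ ψ ⟨hψ, hψc⟩).1]
  rw [← (hGχ χ hχ).2]
  exact integral_congr_ae (hgG.mono fun x hx => by simp only [hx])

end MemHdot

end HomogeneousSobolev

section WeakDerivative

/-- `θ ∈ C_c^∞(U)`, for a set `U` of times. -/
structure IsTestOn (U : Set ℝ) (θ : ℝ → ℝ) : Prop where
  contDiff : ContDiff ℝ ∞ θ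
  hasCompactSupport : HasCompactSupport θ
  tsupport_subset : tsupport θ ⊆ U

variable {U : Set ℝ} {θ ζ F A : ℝ → ℝ}

lemma exists_subset_Ioo_of_isCompact (hU : IsOpen U) {K : Set ℝ} (hK : IsCompact K)
    (hne : K.Nonempty) (hKU : K ⊆ U) : ∃ a ∈ U, ∃ b ∈ U, K ⊆ Ioo a b := by
  obtain ⟨l, hlK, hl⟩ := hK.exists_isLeast hne
  obtain ⟨g, hgK, hg⟩ := hK.exists_isGreatest hne
  obtain ⟨a, hal, haU⟩ := exists_Ioc_subset_of_mem_nhds (hU.mem_nhds (hKU hlK)) (exists_lt l)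
  obtain ⟨b, hgb, hbU⟩ := exists_Ico_subset_of_mem_nhds (hU.mem_nhds (hKU hgK)) (exists_gt g)
  obtain ⟨a', ha'⟩ := exists_between hal
  obtain ⟨b', hb'⟩ := exists_between hgb
  exact ⟨a', haU ⟨ha'.1, ha'.2.le⟩, b', hbU ⟨hb'.1.le, hb'.2⟩, fun x hx =>
    ⟨ha'.2.trans_le (hl hx), (hg hx).trans_lt hb'.1⟩⟩

lemma intervalIntegrable_of_mem (hU : U.OrdConnected)
    (hA : LocallyIntegrableOn A U) {a b : ℝ} (ha : a ∈ U) (hb : b ∈ U) :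
    IntervalIntegrable A volume a b :=
  (hA.integrableOn_compact_subset (hU.uIcc_subset ha hb) isCompact_uIcc).intervalIntegrable

lemma continuousOn_primitive_of_locallyIntegrableOn (hU : IsOpen U) (hUc : U.OrdConnected)
    (hA : LocallyIntegrableOn A U) {t₀ : ℝ} (ht₀ : t₀ ∈ U) :
    ContinuousOn (fun t => ∫ τ in t₀..t, A τ) U := by
  intro t ht
  obtain ⟨a, ha, b, hb, hab⟩ := exists_subset_Ioo_of_isCompact hU (isCompact_singleton.insert t₀)
    (insert_nonempty _ _) (insert_subset ht₀ (singleton_subset_iff.2 ht))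
  have ht₀ab : t₀ ∈ Ioo a b := hab (mem_insert _ _)
  have htab : t ∈ Ioo a b := hab (mem_insert_of_mem _ rfl)
  have hcont := intervalIntegral.continuousOn_primitive_interval'
    (intervalIntegrable_of_mem hUc hA ha hb) (Icc_subset_uIcc (Ioo_subset_Icc_self ht₀ab))
  rw [uIcc_of_le (htab.1.trans htab.2).le] at hcont
  exact (hcont.continuousAt (Icc_mem_nhds htab.1 htab.2)).continuousWithinAt

lemma exists_isTestOn_integral_eq_one (hU : IsOpen U) (hne : U.Nonempty) :
    ∃ η, IsTestOn U η ∧ ∫ t, η t = 1 := by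
  obtain ⟨t, ht⟩ := hne
  obtain ⟨r, hr, hball⟩ := Metric.nhds_basis_closedBall.mem_iff.1 (hU.mem_nhds ht)
  let β : ContDiffBump t := ⟨r / 2, r, half_pos hr, half_lt_self hr⟩
  exact ⟨β.normed volume, ⟨β.contDiff_normed, β.hasCompactSupport_normed,
    β.tsupport_normed_eq.trans_subset hball⟩, β.integral_normed⟩

namespace IsTestOn

lemma eq_zero_of_notMem (hθ : IsTestOn U θ) {t : ℝ} (ht : t ∉ U) : θ t = 0 :=
  image_eq_zero_of_notMem_tsupport fun h => ht (hθ.tsupport_subset h)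

lemma deriv (hθ : IsTestOn U θ) : IsTestOn U (deriv θ) :=
  ⟨(contDiff_infty_iff_deriv.1 hθ.contDiff).2, hθ.hasCompactSupport.deriv,
    tsupport_deriv_subset.trans hθ.tsupport_subset⟩

lemma sub_const_mul (hθ : IsTestOn U θ) (hζ : IsTestOn U ζ) (a : ℝ) :
    IsTestOn U fun t => θ t - a * ζ t :=
  ⟨hθ.contDiff.sub (contDiff_const.mul hζ.contDiff),
    hθ.hasCompactSupport.sub hζ.hasCompactSupport.mul_left,
    (tsupport_sub θ fun t => a * ζ t).trans (union_subset hθ.tsupport_subset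
      ((tsupport_mul_subset_right).trans hζ.tsupport_subset))⟩

lemma integrable (hθ : IsTestOn U θ) : Integrable θ :=
  hθ.contDiff.continuous.integrable_of_hasCompactSupport hθ.hasCompactSupport

lemma integrable_mul (hθ : IsTestOn U θ) (hF : LocallyIntegrableOn F U) :
    Integrable fun t => θ t * F t :=
  (integrableOn_iff_integrable_of_support_subset fun _ ht =>
    subset_tsupport θ (left_ne_zero_of_mul ht)).1
    ((hF.integrableOn_compact_subset hθ.tsupport_subset
      hθ.hasCompactSupport).continuousOn_mul hθ.contDiff.continuous.continuousOn
        hθ.hasCompactSupport)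

lemma exists_Ioo (hθ : IsTestOn U θ) (hU : IsOpen U) {t₀ : ℝ} (ht₀ : t₀ ∈ U) :
    ∃ a ∈ U, ∃ b ∈ U, t₀ ∈ Ioo a b ∧ tsupport θ ⊆ Ioo a b := by
  obtain ⟨a, ha, b, hb, hab⟩ := exists_subset_Ioo_of_isCompact hU
    (hθ.hasCompactSupport.isCompact.insert t₀) (insert_nonempty _ _)
    (insert_subset ht₀ hθ.tsupport_subset)
  exact ⟨a, ha, b, hb, hab (mem_insert _ _), (subset_insert _ _).trans hab⟩

lemma integral_deriv_mul_primitive (hθ : IsTestOn U θ) (hU : IsOpen U) (hUc : U.OrdConnected)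
    (hA : LocallyIntegrableOn A U) {t₀ : ℝ} (ht₀ : t₀ ∈ U) :
    ∫ t, _root_.deriv θ t * ∫ τ in t₀..t, A τ = -∫ t, θ t * A t := by
  obtain ⟨a, ha, b, hb, ht₀ab, hsupp⟩ := hθ.exists_Ioo hU ht₀
  have hAab := intervalIntegrable_of_mem hUc hA ha hb
  have ht₀' : t₀ ∈ uIcc a b := Icc_subset_uIcc (Ioo_subset_Icc_self ht₀ab)
  have hinterval {f g : ℝ → ℝ} (hf : tsupport f ⊆ Ioo a b) :
      ∫ t, f t * g t = ∫ t in a..b, f t * g t := by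
    rw [intervalIntegral.integral_eq_integral_of_support_subset]
    exact fun t ht => Ioo_subset_Ioc_self (hf (subset_tsupport f (left_ne_zero_of_mul ht)))
  have hzero (t : ℝ) (ht : t ∉ Ioo a b) : θ t = 0 :=
    image_eq_zero_of_notMem_tsupport fun h => ht (hsupp h)
  have hderiv : ∫ t in a..b, θ t * _root_.deriv (fun t => ∫ τ in t₀..t, A τ) t =
      ∫ t in a..b, θ t * A t := by
    refine intervalIntegral.integral_congr_ae ?_
    filter_upwards [hAab.ae_hasDerivAt_integral] with t ht htm
    rw [(ht (uIoc_subset_uIcc htm) t₀ ht₀').deriv]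
  rw [hinterval (tsupport_deriv_subset.trans hsupp), hinterval hsupp, ← hderiv,
    AbsolutelyContinuousOnInterval.integral_mul_deriv_eq_deriv_mul
      (hθ.contDiff.of_le (by simp)).contDiffOn.absolutelyContinuousOnInterval
      (hAab.absolutelyContinuousOnInterval_intervalIntegral ht₀'),
    hzero a left_notMem_Ioo, hzero b right_notMem_Ioo]
  ring

lemma exists_deriv_eq (hζ : IsTestOn U ζ) (hU : IsOpen U) (hUc : U.OrdConnected)
    (hne : U.Nonempty) (hint : ∫ t, ζ t = 0) : ∃ θ, IsTestOn U θ ∧ _root_.deriv θ = ζ := by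
  obtain ⟨t₀, ht₀⟩ := hne
  obtain ⟨a, ha, b, hb, -, hsupp⟩ := hζ.exists_Ioo hU ht₀
  have hζc := hζ.contDiff.continuous
  have hzero (t : ℝ) (ht : t ∉ Ioo a b) : ζ t = 0 :=
    image_eq_zero_of_notMem_tsupport fun h => ht (hsupp h)
  let θ : ℝ → ℝ := fun t => ∫ τ in a..t, ζ τ
  have hderiv (t : ℝ) : HasDerivAt θ (ζ t) t :=
    intervalIntegral.integral_hasDerivAt_right (hζc.intervalIntegrable a t)
      (hζc.stronglyMeasurableAtFilter _ _) hζc.continuousAt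
  have hderiv_eq : _root_.deriv θ = ζ := funext fun t => (hderiv t).deriv
  have hθ_zero (t : ℝ) (ht : t ∉ Icc a b) : θ t = 0 := by
    rcases lt_or_ge t a with hta | hta
    · refine intervalIntegral.integral_zero_ae (ae_of_all _ fun τ hτ => hzero τ fun h => ?_)
      rw [uIoc_of_ge hta.le] at hτ
      exact h.1.not_ge hτ.2
    · have hbt : b < t := not_le.1 fun h => ht ⟨hta, h⟩
      refine Eq.trans (intervalIntegral.integral_eq_integral_of_support_subset ?_) hint
      exact (subset_tsupport ζ).trans (hsupp.trans fun τ hτ => ⟨hτ.1, (hτ.2.trans hbt).le⟩)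
  have hθ_supp : Function.support θ ⊆ Icc a b := Function.support_subset_iff'.2 hθ_zero
  exact ⟨θ, ⟨contDiff_infty_iff_deriv.2 ⟨fun t => (hderiv t).differentiableAt,
      hderiv_eq ▸ hζ.contDiff⟩,
    HasCompactSupport.of_support_subset_isCompact isCompact_Icc hθ_supp,
    (closure_minimal hθ_supp isClosed_Icc).trans (hUc.out ha hb)⟩, hderiv_eq⟩

end IsTestOn

/-- The du Bois-Reymond lemma: `η - (∫ η) η₀` is a derivative of a test function when
`∫ η₀ = 1`. -/
lemma exists_ae_eq_const_of_integral_deriv_mul_eq_zero (hU : IsOpen U) (hUc : U.OrdConnected)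
    (hne : U.Nonempty) (hF : LocallyIntegrableOn F U)
    (h : ∀ θ, IsTestOn U θ → ∫ t, deriv θ t * F t = 0) : ∃ c, ∀ᵐ t, t ∈ U → F t = c := by
  obtain ⟨η₀, hη₀, hη₀_one⟩ := exists_isTestOn_integral_eq_one hU hne
  refine ⟨∫ t, η₀ t * F t, ?_⟩
  set c := ∫ t, η₀ t * F t
  have hmean (η : ℝ → ℝ) (hη : IsTestOn U η) : ∫ t, η t * F t = (∫ t, η t) * c := by
    have hzero : ∫ t, (η t - (∫ t, η t) * η₀ t) = 0 := by
      rw [integral_sub hη.integrable (hη₀.integrable.const_mul _), integral_const_mul, hη₀_one,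
        mul_one, sub_self]
    obtain ⟨θ, hθ, hderiv⟩ := (hη.sub_const_mul hη₀ _).exists_deriv_eq hU hUc hne hzero
    have hθF := h θ hθ
    simp only [hderiv, sub_mul, mul_assoc] at hθF
    rw [integral_sub (hη.integrable_mul hF) ((hη₀.integrable_mul hF).const_mul _),
      integral_const_mul] at hθF
    exact sub_eq_zero.1 hθF
  have hae := hU.ae_eq_zero_of_integral_contDiff_smul_eq_zero (μ := volume)
    (hF.sub ((locallyIntegrable_const c).locallyIntegrableOn U)) fun η hη hηc hηU => by
      have hηU : IsTestOn U η := ⟨hη, hηc, hηU⟩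
      simp only [Pi.sub_apply, smul_eq_mul, mul_sub]
      rw [integral_sub (hηU.integrable_mul hF) (hηU.integrable.mul_const c), hmean η hηU,
        integral_mul_const, sub_self]
  exact hae.mono fun t ht htU => sub_eq_zero.1 (ht htU)

lemma exists_ae_eq_sub_integral_of_weak_deriv (hU : IsOpen U) (hUc : U.OrdConnected)
    (hF : LocallyIntegrableOn F U) (hA : LocallyIntegrableOn A U) {t₀ : ℝ} (ht₀ : t₀ ∈ U)
    (h : ∀ θ, IsTestOn U θ → ∫ t, deriv θ t * F t = ∫ t, θ t * A t) :
    ∃ c, ∀ᵐ t, t ∈ U → F t = c - ∫ τ in t₀..t, A τ := by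
  have hprim : LocallyIntegrableOn (fun t => ∫ τ in t₀..t, A τ) U :=
    (continuousOn_primitive_of_locallyIntegrableOn hU hUc hA ht₀).locallyIntegrableOn
      hU.measurableSet
  obtain ⟨c, hc⟩ := exists_ae_eq_const_of_integral_deriv_mul_eq_zero hU hUc ⟨t₀, ht₀⟩
    (hF.add hprim) fun θ hθ => by
      simp only [Pi.add_apply, mul_add]
      rw [integral_add (hθ.deriv.integrable_mul hF) (hθ.deriv.integrable_mul hprim), h θ hθ,
        hθ.integral_deriv_mul_primitive hU hUc hA ht₀, add_neg_cancel]
  exact ⟨c, hc.mono fun t ht htU => eq_sub_of_add_eq (ht htU)⟩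

end WeakDerivative

section ProductMeasure

variable {α β : Type*} [MeasurableSpace α] [MeasurableSpace β] {μ : Measure α} {ν : Measure β}

lemma volume_restrict_univ_prod {α β : Type*} [MeasureSpace α] [MeasureSpace β]
    [SFinite (volume : Measure α)] [SFinite (volume : Measure β)] (S : Set β) :
    (volume : Measure (α × β)).restrict (univ ×ˢ S) = volume.prod (volume.restrict S) := by
  rw [Measure.volume_eq_prod, ← Measure.prod_restrict, Measure.restrict_univ]

lemma ae_ae_swap_of_ae_prod [SFinite μ] [SFinite ν] {p : α × β → Prop}
    (h : ∀ᵐ z ∂μ.prod ν, p z) : ∀ᵐ y ∂ν, ∀ᵐ x ∂μ, p (x, y) :=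
  Measure.ae_ae_of_ae_prod (p := fun z : β × α => p z.swap)
    (Measure.measurePreserving_swap.quasiMeasurePreserving.ae h)

lemma integrable_mul_of_abs_le_mul {f w h : α → ℝ} (hfw : Integrable (fun x => f x * w x) μ)
    (hw : AEStronglyMeasurable w μ) (hpos : ∀ x, 0 < w x) (hh : AEStronglyMeasurable h μ) {C : ℝ}
    (hC : ∀ᵐ x ∂μ, |h x| ≤ C * w x) : Integrable (fun x => f x * h x) μ := by
  refine (hfw.mul_bdd (c := C) (hh.div₀ hw) (hC.mono fun x hx => ?_)).congr
    (ae_of_all _ fun x => ?_)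
  · rw [Pi.div_apply, norm_div, Real.norm_eq_abs, Real.norm_of_nonneg (hpos x).le,
      div_le_iff₀ (hpos x)]
    exact hx
  · simp only [Pi.div_apply]
    rw [mul_assoc, mul_div_cancel₀ _ (hpos x).ne']

end ProductMeasure

section Weight

variable {d : ℕ} {γ₀ γ : ℝ} {ρ : EuclideanSpace ℝ (Fin d) → ℝ}

lemma WeightBounds.ae_nonneg (hρ : WeightBounds γ₀ γ ρ) : ∀ᵐ x, 0 ≤ ρ x := by
  obtain ⟨c, C, hc, -, hbounds⟩ := hρ
  filter_upwards [hbounds] with x hx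
  rcases lt_or_ge ‖x‖ 1 with hx1 | hx1
  · exact le_trans (by positivity) (hx.1 hx1).1
  · exact le_trans (by positivity) (hx.2 hx1).1

lemma WeightBounds.exists_one_add_norm_rpow_le [NeZero d] (hρ : WeightBounds γ₀ γ ρ)
    (hγ₀ : 0 ≤ γ₀) {a : ℝ} (ha : 0 ≤ a) (hγa : γ ≤ a) :
    ∃ K, 0 ≤ K ∧ ∀ᵐ x : EuclideanSpace ℝ (Fin d), (1 + ‖x‖) ^ (-a) ≤ K * ρ x := by
  obtain ⟨c, C, hc, -, hbounds⟩ := hρ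
  refine ⟨c⁻¹, inv_nonneg.2 hc.le, ?_⟩
  filter_upwards [hbounds, Measure.ae_ne volume 0] with x hx hx0
  have hxpos : 0 < ‖x‖ := norm_pos_iff.2 hx0
  rw [← div_eq_inv_mul, le_div_iff₀ hc, mul_comm]
  rcases lt_or_ge ‖x‖ 1 with hx1 | hx1
  · refine le_trans (mul_le_mul_of_nonneg_left ?_ hc.le) (hx.1 hx1).1
    exact (Real.rpow_le_one_of_one_le_of_nonpos (by linarith) (by linarith)).trans
      (Real.one_le_rpow_of_pos_of_le_one_of_nonpos hxpos hx1.le (by linarith))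
  · refine le_trans (mul_le_mul_of_nonneg_left ?_ hc.le) (hx.2 hx1).1
    exact (Real.rpow_le_rpow_of_nonpos hxpos (by linarith) (by linarith)).trans
      (Real.rpow_le_rpow_of_exponent_le hx1 (by linarith))

lemma lintegral_weightMeasure (hρm : AEMeasurable ρ)
    (f : EuclideanSpace ℝ (Fin d) → ℝ≥0∞) :
    ∫⁻ x, f x ∂weightMeasure ρ = ∫⁻ x, ENNReal.ofReal (ρ x) * f x :=
  lintegral_withDensity_eq_lintegral_mul_non_measurable₀ _ hρm.ennreal_ofReal
    (ae_of_all _ fun _ => ENNReal.ofReal_lt_top) _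

lemma integral_weightMeasure (hρm : AEMeasurable ρ) (hρ0 : ∀ᵐ x, 0 ≤ ρ x)
    (f : EuclideanSpace ℝ (Fin d) → ℝ) : ∫ x, f x ∂weightMeasure ρ = ∫ x, f x * ρ x := by
  unfold weightMeasure
  rw [integral_withDensity_eq_integral_toReal_smul₀ hρm.ennreal_ofReal
    (ae_of_all _ fun _ => ENNReal.ofReal_lt_top)]
  refine integral_congr_ae (hρ0.mono fun x hx => ?_)
  simp only [ENNReal.toReal_ofReal hx, smul_eq_mul, mul_comm]

variable {u : EuclideanSpace ℝ (Fin d) → ℝ → ℝ} {t : ℝ}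

/-- The measure `u(·,t) ρ dx`, whose limit as `t → 0⁺` is the initial trace. -/
def flowMeasure (ρ : EuclideanSpace ℝ (Fin d) → ℝ) (u : EuclideanSpace ℝ (Fin d) → ℝ → ℝ)
    (t : ℝ) : Measure (EuclideanSpace ℝ (Fin d)) :=
  (weightMeasure ρ).withDensity fun x => ENNReal.ofReal (u x t)

lemma flowMeasure_univ_le (ρ : EuclideanSpace ℝ (Fin d) → ℝ)
    (u : EuclideanSpace ℝ (Fin d) → ℝ → ℝ) (t : ℝ) :
    flowMeasure ρ u t univ ≤ ∫⁻ x, ‖u x t‖ₑ ∂weightMeasure ρ := by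
  unfold flowMeasure
  rw [withDensity_apply _ MeasurableSet.univ, Measure.restrict_univ]
  exact lintegral_mono fun x => Real.ofReal_le_enorm _

lemma integral_flowMeasure (hm : AEStronglyMeasurable (fun x => u x t) (weightMeasure ρ))
    (hu0 : ∀ᵐ x, 0 ≤ u x t) (f : EuclideanSpace ℝ (Fin d) → ℝ) :
    ∫ x, f x ∂flowMeasure ρ u t = ∫ x, f x * u x t ∂weightMeasure ρ := by
  unfold flowMeasure
  rw [integral_withDensity_eq_integral_toReal_smul₀ hm.aemeasurable.ennreal_ofReal
    (ae_of_all _ fun _ => ENNReal.ofReal_lt_top)]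
  have hu0' : ∀ᵐ x ∂weightMeasure ρ, 0 ≤ u x t :=
    (withDensity_absolutelyContinuous volume _).ae_le hu0
  refine integral_congr_ae (hu0'.mono fun x hx => ?_)
  simp only [ENNReal.toReal_ofReal hx, smul_eq_mul, mul_comm]

end Weight

section WeakSolution

variable {d : ℕ} {s m : ℝ} {ρ : EuclideanSpace ℝ (Fin d) → ℝ}
  {u : EuclideanSpace ℝ (Fin d) → ℝ → ℝ} {χ : EuclideanSpace ℝ (Fin d) → ℝ}

lemma IsTest.isSpaceTimeTest_mul {θ : ℝ → ℝ} (hχ : IsTest χ) (hθ : IsTestOn (Ioi 0) θ) :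
    IsSpaceTimeTest fun z : EuclideanSpace ℝ (Fin d) × ℝ => χ z.1 * θ z.2 := by
  have hsupp : Function.support (fun z : EuclideanSpace ℝ (Fin d) × ℝ => χ z.1 * θ z.2) ⊆
      tsupport χ ×ˢ tsupport θ := fun z hz =>
    ⟨subset_tsupport _ (left_ne_zero_of_mul hz), subset_tsupport _ (right_ne_zero_of_mul hz)⟩
  refine ⟨(hχ.1.comp contDiff_fst).mul (hθ.contDiff.comp contDiff_snd),
    HasCompactSupport.of_support_subset_isCompact
      (hχ.2.isCompact.prod hθ.hasCompactSupport.isCompact) hsupp, ?_⟩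
  exact (closure_minimal hsupp ((isClosed_tsupport χ).prod (isClosed_tsupport θ))).trans
    (prod_mono (subset_univ _) hθ.tsupport_subset)

variable [NeZero d]

lemma IsTest.fracLap_mul_const (hχ : IsTest χ) {σ : ℝ} (h0 : 0 < σ) (h1 : σ < 1) (c : ℝ) :
    fracLap σ (fun x => χ x * c) = fun x => fracLap σ χ x * c := by
  have hχc : IsTest fun x => χ x * c := ⟨hχ.1.mul contDiff_const, hχ.2.mul_right⟩
  rw [hχc.fracLap_eq_levyOp h0 h1, hχ.fracLap_eq_levyOp h0 h1]
  ext x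
  unfold levyOp
  rw [← integral_mul_const]
  congr 1 with z
  unfold secondDiff
  ring

lemma IsTest.exists_abs_fracLap_le_rpow (hχ : IsTest χ) (h0 : 0 < s) (h1 : s < 1) :
    ∃ C, 0 ≤ C ∧ ∀ x, |fracLap s χ x| ≤ C * (1 + ‖x‖) ^ (-(2 * s)) := by
  obtain ⟨C, hC0, hC⟩ := hχ.exists_abs_fracLap_le h0 h1
  refine ⟨C, hC0, fun x => (hC x).trans ?_⟩
  gcongr
  · linarith [norm_nonneg x]
  · linarith [(Nat.cast_nonneg d : (0 : ℝ) ≤ d)]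

/-- A family of measures `lam t`, `t > 0`, evolving by `∂ₜ lam + (-Δ)^s W = 0`, with finite
masses and with `W ≥ 0` locally integrable in time against the weight `(1 + |x|)^{-2s}`. For a weak
solution `u`, `W` is `u^m` and `lam` is `u ρ dx`. -/
structure IsDiffusionFlow (s : ℝ) (W : EuclideanSpace ℝ (Fin d) → ℝ → ℝ)
    (lam : ℝ → Measure (EuclideanSpace ℝ (Fin d))) : Prop where
  nonneg : ∀ᵐ z : EuclideanSpace ℝ (Fin d) × ℝ ∂volume.prod (volume.restrict (Ioi (0 : ℝ))),
    0 ≤ W z.1 z.2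
  integrable : ∀ t₁ t₂ : ℝ, 0 < t₁ → t₁ < t₂ →
    Integrable (fun z : EuclideanSpace ℝ (Fin d) × ℝ => W z.1 z.2 * (1 + ‖z.1‖) ^ (-(2 * s)))
      (volume.prod (volume.restrict (Ioo t₁ t₂)))
  finite : ∀ᵐ t ∂volume.restrict (Ioi (0 : ℝ)), IsFiniteMeasure (lam t)
  evolution : ∀ χ : EuclideanSpace ℝ (Fin d) → ℝ, IsTest χ →
    ∃ c : ℝ, ∀ᵐ t ∂volume.restrict (Ioi (0 : ℝ)),
      ∫ x, χ x ∂lam t = c - ∫ τ in (1 : ℝ)..t, ∫ x, W x τ * fracLap s χ x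

lemma integrable_mul_fracLap_of_integrable_rpow {W : EuclideanSpace ℝ (Fin d) → ℝ → ℝ}
    {ν : Measure ℝ} [SFinite ν]
    (hW : Integrable (fun z : EuclideanSpace ℝ (Fin d) × ℝ =>
      W z.1 z.2 * (1 + ‖z.1‖) ^ (-(2 * s))) (volume.prod ν))
    (hχ : IsTest χ) (h0 : 0 < s) (h1 : s < 1) :
    Integrable (fun z : EuclideanSpace ℝ (Fin d) × ℝ => W z.1 z.2 * fracLap s χ z.1)
      (volume.prod ν) := by
  obtain ⟨C, -, hC⟩ := hχ.exists_abs_fracLap_le_rpow h0 h1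
  exact integrable_mul_of_abs_le_mul hW (Measurable.aestronglyMeasurable (by fun_prop))
    (fun z => by positivity)
    ((hχ.continuous_fracLap h0 h1).comp continuous_fst).aestronglyMeasurable
    (ae_of_all _ fun z => hC z.1)

namespace IsWeakSolution

lemma aestronglyMeasurable_prod (hu : IsWeakSolution s m ρ u) :
    AEStronglyMeasurable (fun z : EuclideanSpace ℝ (Fin d) × ℝ => u z.1 z.2)
      (volume.prod (volume.restrict (Ioi 0))) :=
  volume_restrict_univ_prod (α := EuclideanSpace ℝ (Fin d)) (Ioi (0 : ℝ)) ▸ hu.measurable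

lemma ae_prod_nonneg (hu : IsWeakSolution s m ρ u) :
    ∀ᵐ z : EuclideanSpace ℝ (Fin d) × ℝ ∂volume.prod (volume.restrict (Ioi (0 : ℝ))),
      0 ≤ u z.1 z.2 :=
  volume_restrict_univ_prod (α := EuclideanSpace ℝ (Fin d)) (Ioi (0 : ℝ)) ▸ hu.nonneg

lemma ae_isFiniteMeasure_flowMeasure (hu : IsWeakSolution s m ρ u) :
    ∀ᵐ t ∂volume.restrict (Ioi (0 : ℝ)), IsFiniteMeasure (flowMeasure ρ u t) := by
  obtain ⟨M, hM⟩ := hu.linftyL1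
  filter_upwards [hM] with t ht
  exact ⟨((flowMeasure_univ_le ρ u t).trans ht.2).trans_lt ENNReal.coe_lt_top⟩

lemma ae_integral_flowMeasure (hu : IsWeakSolution s m ρ u) :
    ∀ᵐ t ∂volume.restrict (Ioi (0 : ℝ)), ∀ f : EuclideanSpace ℝ (Fin d) → ℝ,
      ∫ x, f x ∂flowMeasure ρ u t = ∫ x, f x * u x t ∂weightMeasure ρ := by
  obtain ⟨M, hM⟩ := hu.linftyL1
  filter_upwards [hM, ae_ae_swap_of_ae_prod hu.ae_prod_nonneg] with t ht ht0
  exact integral_flowMeasure ht.1 ht0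

lemma aestronglyMeasurable_prod_Ioo (hu : IsWeakSolution s m ρ u) (T : ℝ) :
    AEStronglyMeasurable (fun z : EuclideanSpace ℝ (Fin d) × ℝ => u z.1 z.2)
      (volume.prod (volume.restrict (Ioo 0 T))) :=
  hu.aestronglyMeasurable_prod.mono_measure
    (Measure.prod_mono le_rfl (Measure.restrict_mono Ioo_subset_Ioi_self le_rfl))

lemma integrable_mul_weight (hu : IsWeakSolution s m ρ u) (hρm : AEMeasurable ρ)
    (hρ0 : ∀ᵐ x, 0 ≤ ρ x) (T : ℝ) :
    Integrable (fun z : EuclideanSpace ℝ (Fin d) × ℝ => u z.1 z.2 * ρ z.1)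
      (volume.prod (volume.restrict (Ioo 0 T))) := by
  have hmeas : AEStronglyMeasurable (fun z : EuclideanSpace ℝ (Fin d) × ℝ => u z.1 z.2 * ρ z.1)
      (volume.prod (volume.restrict (Ioo 0 T))) :=
    (hu.aestronglyMeasurable_prod_Ioo T).mul (hρm.comp_quasiMeasurePreserving
      Measure.quasiMeasurePreserving_fst).aestronglyMeasurable
  obtain ⟨M, hM⟩ := hu.linftyL1
  have hslice : ∀ᵐ t ∂volume.restrict (Ioo 0 T), ∫⁻ x, ‖u x t * ρ x‖ₑ ≤ M := by
    filter_upwards [ae_mono (Measure.restrict_mono Ioo_subset_Ioi_self le_rfl) hM] with t ht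
    rw [lintegral_weightMeasure hρm] at ht
    refine le_of_eq_of_le (lintegral_congr_ae (hρ0.mono fun x hx => ?_)) ht.2
    simp only [enorm_mul, Real.enorm_of_nonneg hx, mul_comm]
  refine ⟨hmeas, ?_⟩
  calc ∫⁻ z, ‖u z.1 z.2 * ρ z.1‖ₑ ∂volume.prod (volume.restrict (Ioo 0 T))
      = ∫⁻ t in Ioo 0 T, ∫⁻ x, ‖u x t * ρ x‖ₑ := lintegral_prod_symm _ hmeas.enorm
    _ ≤ ∫⁻ _ in Ioo 0 T, M := lintegral_mono_ae hslice
    _ < ⊤ := by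
      rw [setLIntegral_const, Real.volume_Ioo]
      exact ENNReal.mul_lt_top ENNReal.coe_lt_top ENNReal.ofReal_lt_top

lemma integrable_rpow_mul_weight_of_boundedAwayFromZero (hu : IsWeakSolution s m ρ u)
    (hm : 1 ≤ m) (hρm : AEMeasurable ρ) (hρ0 : ∀ᵐ x, 0 ≤ ρ x) (hb : BoundedAwayFromZero u)
    {t₁ t₂ : ℝ} (ht₁ : 0 < t₁) :
    Integrable (fun z : EuclideanSpace ℝ (Fin d) × ℝ => u z.1 z.2 ^ m * ρ z.1)
      (volume.prod (volume.restrict (Ioo t₁ t₂))) := by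
  have hle : ∀ {S : Set ℝ}, Ioo t₁ t₂ ⊆ S →
      (volume : Measure (EuclideanSpace ℝ (Fin d))).prod (volume.restrict (Ioo t₁ t₂)) ≤
        volume.prod (volume.restrict S) := fun hS =>
    Measure.prod_mono le_rfl (Measure.restrict_mono hS le_rfl)
  obtain ⟨B, hB⟩ := hb t₁ ht₁
  rw [volume_restrict_univ_prod] at hB
  have hIoo : Ioo t₁ t₂ ⊆ Ioo 0 t₂ := Ioo_subset_Ioo_left ht₁.le
  have hpow : ∀ {v : ℝ}, 0 ≤ v → v ≤ B → v ^ m ≤ B ^ (m - 1) * v := fun {v} hv hvB => by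
    calc v ^ m = v ^ (m - 1) * v := by
          rw [← Real.rpow_add_one' hv (by linarith), sub_add_cancel]
      _ ≤ B ^ (m - 1) * v := by gcongr
  refine (((hu.integrable_mul_weight hρm hρ0 t₂).mono_measure (hle hIoo)).const_mul
    (B ^ (m - 1))).mono' ?_ ?_
  · exact ((hu.aestronglyMeasurable_prod_Ioo t₂).mono_measure (hle hIoo)).aemeasurable.pow_const m
      |>.aestronglyMeasurable.mul (hρm.comp_quasiMeasurePreserving
        Measure.quasiMeasurePreserving_fst).aestronglyMeasurable
  · filter_upwards [ae_mono (hle Ioo_subset_Ioi_self) hB,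
      ae_mono (hle fun t ht => ht₁.trans ht.1) hu.ae_prod_nonneg,
      Measure.quasiMeasurePreserving_fst.ae hρ0] with z hzB hz0 hzρ
    rw [Real.norm_of_nonneg (mul_nonneg (Real.rpow_nonneg hz0 m) hzρ), ← mul_assoc]
    exact mul_le_mul_of_nonneg_right (hpow hz0 ((le_abs_self _).trans hzB)) hzρ

lemma integrable_rpow_mul_weight_of_powerTimeIntegrable (hu : IsWeakSolution s m ρ u)
    (hρm : AEMeasurable ρ) (hρ0 : ∀ᵐ x, 0 ≤ ρ x) (hb : PowerTimeIntegrable m ρ u)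
    {t₁ t₂ : ℝ} (ht₁ : 0 < t₁) (ht : t₁ < t₂) :
    Integrable (fun z : EuclideanSpace ℝ (Fin d) × ℝ => u z.1 z.2 ^ m * ρ z.1)
      (volume.prod (volume.restrict (Ioo t₁ t₂))) := by
  have hle : (volume : Measure (EuclideanSpace ℝ (Fin d))).prod (volume.restrict (Ioo t₁ t₂)) ≤
      volume.prod (volume.restrict (Ioi 0)) :=
    Measure.prod_mono le_rfl (Measure.restrict_mono (fun t ht => ht₁.trans ht.1) le_rfl)
  have hmeas : AEMeasurable (fun z : EuclideanSpace ℝ (Fin d) × ℝ => u z.1 z.2 ^ m * ρ z.1)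
      (volume.prod (volume.restrict (Ioo t₁ t₂))) :=
    ((hu.aestronglyMeasurable_prod.mono_measure hle).aemeasurable.pow_const m).mul
      (hρm.comp_quasiMeasurePreserving Measure.quasiMeasurePreserving_fst)
  refine ⟨hmeas.aestronglyMeasurable, ?_⟩
  have hfin := hb t₁ t₂ ht₁ ht
  rw [lintegral_weightMeasure hρm] at hfin
  rw [hasFiniteIntegral_iff_ofReal, lintegral_prod _ hmeas.ennreal_ofReal]
  · refine (lintegral_congr_ae (hρ0.mono fun x hx => ?_)).trans_lt hfin
    simp only [ENNReal.ofReal_mul' hx]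
    rw [lintegral_mul_const' _ _ ENNReal.ofReal_ne_top, mul_comm]
  · filter_upwards [ae_mono hle hu.ae_prod_nonneg,
      Measure.quasiMeasurePreserving_fst.ae hρ0] with z hz0 hzρ
    exact mul_nonneg (Real.rpow_nonneg hz0 m) hzρ

lemma integrable_rpow_mul_one_add_norm_rpow (hu : IsWeakSolution s m ρ u) (hm : 1 ≤ m)
    {γ₀ γ a : ℝ} (hρm : AEMeasurable ρ) (hρ : WeightBounds γ₀ γ ρ) (hγ₀ : 0 ≤ γ₀) (ha : 0 ≤ a)
    (hγa : γ ≤ a) (hb : BoundedAwayFromZero u ∨ PowerTimeIntegrable m ρ u)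
    {t₁ t₂ : ℝ} (ht₁ : 0 < t₁) (ht : t₁ < t₂) :
    Integrable (fun z : EuclideanSpace ℝ (Fin d) × ℝ => u z.1 z.2 ^ m * (1 + ‖z.1‖) ^ (-a))
      (volume.prod (volume.restrict (Ioo t₁ t₂))) := by
  have hle : (volume : Measure (EuclideanSpace ℝ (Fin d))).prod (volume.restrict (Ioo t₁ t₂)) ≤
      volume.prod (volume.restrict (Ioi 0)) :=
    Measure.prod_mono le_rfl (Measure.restrict_mono (fun t ht => ht₁.trans ht.1) le_rfl)
  have hint := hb.elim
    (fun hb => hu.integrable_rpow_mul_weight_of_boundedAwayFromZero hm hρm hρ.ae_nonneg hb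
      (t₂ := t₂) ht₁)
    (fun hb => hu.integrable_rpow_mul_weight_of_powerTimeIntegrable hρm hρ.ae_nonneg hb ht₁ ht)
  obtain ⟨K, -, hK⟩ := hρ.exists_one_add_norm_rpow_le hγ₀ ha hγa
  refine (hint.const_mul K).mono' ?_ ?_
  · have hw : Measurable fun z : EuclideanSpace ℝ (Fin d) × ℝ => (1 + ‖z.1‖) ^ (-a) := by fun_prop
    exact (((hu.aestronglyMeasurable_prod.mono_measure hle).aemeasurable.pow_const m).mul
      hw.aemeasurable).aestronglyMeasurable
  · filter_upwards [ae_mono hle hu.ae_prod_nonneg,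
      Measure.quasiMeasurePreserving_fst.ae hK] with z hz0 hzK
    rw [Real.norm_of_nonneg (mul_nonneg (Real.rpow_nonneg hz0 m) (by positivity)), mul_left_comm]
    exact mul_le_mul_of_nonneg_left hzK (Real.rpow_nonneg hz0 m)

lemma integral_deriv_mul_eq (hu : IsWeakSolution s m ρ u) (h0 : 0 < s) (h1 : s < 1)
    (hd : 2 * s < d) (hχ : IsTest χ) {θ : ℝ → ℝ} (hθ : IsTestOn (Ioi 0) θ) :
    ∫ t, deriv θ t * ∫ x, χ x * u x t * ρ x = ∫ t, θ t * ∫ x, u x t ^ m * fracLap s χ x := by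
  obtain ⟨g, -, hg, hweak⟩ := hu.weak
  have hweak := hweak _ (hχ.isSpaceTimeTest_mul hθ)
  have htime : ∫ t in Ioi (0 : ℝ), ∫ x, u x t * deriv (fun τ => χ x * θ τ) t * ρ x =
      ∫ t in Ioi (0 : ℝ), deriv θ t * ∫ x, χ x * u x t * ρ x := by
    congr 1 with t
    rw [← integral_const_mul]
    congr 1 with x
    rw [deriv_const_mul _ (hθ.contDiff.differentiable (by simp) t)]
    ring
  have hspace : ∫ t in Ioi (0 : ℝ), ∫ x, g x t * fracLap (s / 2) (fun y => χ y * θ t) x =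
      ∫ t in Ioi (0 : ℝ), θ t * ∫ x, u x t ^ m * fracLap s χ x := by
    refine integral_congr_ae ?_
    filter_upwards [hg, hu.energy.1] with t hgt hvt
    rw [← hvt.integral_mul_fracLap_half hgt hχ h0 h1 hd, ← integral_const_mul]
    congr 1 with x
    rw [hχ.fracLap_mul_const (by positivity) (by linarith)]
    ring
  have hIoi {f : ℝ → ℝ} (hf : IsTestOn (Ioi 0) f) (G : ℝ → ℝ) :
      ∫ t, f t * G t = ∫ t in Ioi 0, f t * G t :=
    (setIntegral_eq_integral_of_forall_compl_eq_zero fun t ht => by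
      rw [hf.eq_zero_of_notMem ht, zero_mul]).symm
  rw [hIoi hθ.deriv, hIoi hθ, ← htime, ← hspace]
  linarith

lemma locallyIntegrableOn_integral_mul_weight (hu : IsWeakSolution s m ρ u)
    (hρm : AEMeasurable ρ) (hρ0 : ∀ᵐ x, 0 ≤ ρ x) (hχ : IsTest χ) :
    LocallyIntegrableOn (fun t => ∫ x, χ x * u x t * ρ x) (Ioi 0) := by
  obtain ⟨B, hB⟩ := hχ.2.exists_bound_of_continuous hχ.1.continuous
  have hint (T : ℝ) : IntegrableOn (fun t => ∫ x, χ x * u x t * ρ x) (Ioo 0 T) := by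
    refine Integrable.integral_prod_right
      (f := fun z : EuclideanSpace ℝ (Fin d) × ℝ => χ z.1 * u z.1 z.2 * ρ z.1) ?_
    simp only [mul_assoc]
    exact (hu.integrable_mul_weight hρm hρ0 T).bdd_mul
      (hχ.1.continuous.comp continuous_fst).aestronglyMeasurable (ae_of_all _ fun z => hB z.1)
  intro t ht
  exact ⟨Ioo 0 (t + 1), mem_nhdsWithin_of_mem_nhds
    (Ioo_mem_nhds ht (lt_add_one t)), hint _⟩

lemma isDiffusionFlow (hu : IsWeakSolution s m ρ u) (h0 : 0 < s) (h1 : s < 1) (hd : 2 * s < d)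
    (hρm : AEMeasurable ρ) (hρ0 : ∀ᵐ x, 0 ≤ ρ x)
    (hint : ∀ t₁ t₂ : ℝ, 0 < t₁ → t₁ < t₂ → Integrable
      (fun z : EuclideanSpace ℝ (Fin d) × ℝ => u z.1 z.2 ^ m * (1 + ‖z.1‖) ^ (-(2 * s)))
      (volume.prod (volume.restrict (Ioo t₁ t₂)))) :
    IsDiffusionFlow s (fun x t => u x t ^ m) (flowMeasure ρ u) where
  nonneg := hu.ae_prod_nonneg.mono fun z hz => Real.rpow_nonneg hz m
  integrable := hint
  finite := hu.ae_isFiniteMeasure_flowMeasure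
  evolution χ hχ := by
    have hflux : LocallyIntegrableOn (fun t => ∫ x, u x t ^ m * fracLap s χ x) (Ioi 0) :=
      fun t ht => ⟨Ioo (t / 2) (t + 1), mem_nhdsWithin_of_mem_nhds
        (Ioo_mem_nhds (half_lt_self ht) (lt_add_one t)),
        (integrable_mul_fracLap_of_integrable_rpow (W := fun x t => u x t ^ m)
          (hint _ _ (half_pos ht) (by linarith [mem_Ioi.1 ht])) hχ h0 h1).integral_prod_right⟩
    obtain ⟨c, hc⟩ := exists_ae_eq_sub_integral_of_weak_deriv isOpen_Ioi ordConnected_Ioi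
      (hu.locallyIntegrableOn_integral_mul_weight hρm hρ0 hχ) hflux (mem_Ioi.2 one_pos)
      fun θ hθ => hu.integral_deriv_mul_eq h0 h1 hd hχ hθ
    refine ⟨c, ?_⟩
    filter_upwards [hu.ae_integral_flowMeasure, ae_restrict_of_ae hc,
      ae_restrict_mem measurableSet_Ioi] with t hflow hct ht
    rw [hflow, integral_weightMeasure hρm hρ0, hct ht]

end IsWeakSolution

end WeakSolution

section Rearrangement

lemma setIntegral_comp_add_right_le {E : Type*} [MeasurableSpace E] [AddGroup E] [MeasurableAdd E]
    {μ : Measure E} [μ.IsAddRightInvariant] {f : E → ℝ} (hf : Integrable f μ) {B : Set E}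
    (hB : MeasurableSet B) (hBμ : μ B ≠ ⊤) {κ : ℝ} (hin : ∀ x ∈ B, κ ≤ f x)
    (hout : ∀ x ∉ B, f x ≤ κ) (z : E) :
    ∫ x in B, f (x + z) ∂μ ≤ ∫ x in B, f x ∂μ := by
  classical
  have hfz : Integrable (fun x => f (x + z)) μ := hf.comp_add_right z
  have hκ : IntegrableOn (fun _ : E => κ) B μ := integrableOn_const hBμ
  suffices h : ∫ x in B, (f (x + z) - κ) ∂μ ≤ ∫ x in B, (f x - κ) ∂μ by
    rwa [integral_sub hfz.integrableOn hκ, integral_sub hf.integrableOn hκ,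
      sub_le_sub_iff_right] at h
  rw [← integral_indicator hB, ← integral_indicator hB,
    ← integral_sub_right_eq_self (B.indicator fun x => f (x + z) - κ) z]
  refine integral_mono (((integrable_indicator_iff hB).2
    (hfz.integrableOn.sub hκ)).comp_sub_right z)
    ((integrable_indicator_iff hB).2 (hf.integrableOn.sub hκ)) fun y => ?_
  simp only [indicator_apply, sub_add_cancel]
  by_cases hy : y ∈ B
  · rw [if_pos hy]
    split_ifs
    exacts [le_rfl, sub_nonneg.2 (hin y hy)]
  · rw [if_neg hy]
    split_ifs
    exacts [sub_nonpos.2 (hout y hy), le_rfl]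

variable {E : Type*} [NormedAddCommGroup E] [MeasurableSpace E] [BorelSpace E] {μ : Measure E}
  [μ.IsAddRightInvariant] {f : E → ℝ}

lemma setIntegral_secondDiff (hf : Integrable f μ) (S : Set E) (z : E) :
    ∫ x in S, secondDiff f x z ∂μ =
      2 * (∫ x in S, f x ∂μ) - (∫ x in S, f (x + z) ∂μ) - ∫ x in S, f (x - z) ∂μ := by
  have hadd : IntegrableOn (fun x => f (x + z)) S μ := (hf.comp_add_right z).integrableOn
  have hsub : IntegrableOn (fun x => f (x - z)) S μ := (hf.comp_sub_right z).integrableOn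
  have htwo : IntegrableOn (fun x => 2 * f x) S μ := (hf.const_mul 2).integrableOn
  have hdiff : IntegrableOn (fun x => 2 * f x - f (x + z)) S μ := htwo.sub hadd
  unfold secondDiff
  rw [integral_sub hdiff hsub, integral_sub htwo hadd, integral_const_mul]

end Rearrangement

section RadialBump

/-- A smooth, radially nonincreasing function, positive exactly on the open unit ball. -/
def radialBump (d : ℕ) (x : EuclideanSpace ℝ (Fin d)) : ℝ := expNegInvGlue (1 - ‖x‖ ^ 2)

variable {d : ℕ} {x y : EuclideanSpace ℝ (Fin d)}

lemma radialBump_nonneg (x : EuclideanSpace ℝ (Fin d)) : 0 ≤ radialBump d x :=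
  expNegInvGlue.nonneg _

lemma radialBump_pos (h : ‖x‖ < 1) : 0 < radialBump d x :=
  expNegInvGlue.pos_of_pos (by nlinarith [norm_nonneg x])

lemma radialBump_eq_zero (h : 1 ≤ ‖x‖) : radialBump d x = 0 :=
  expNegInvGlue.zero_of_nonpos (by nlinarith)

lemma radialBump_anti (h : ‖x‖ ≤ ‖y‖) : radialBump d y ≤ radialBump d x :=
  expNegInvGlue.monotone (by gcongr)

lemma radialBump_le (x : EuclideanSpace ℝ (Fin d)) : radialBump d x ≤ radialBump d 0 :=
  radialBump_anti (by simp)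

lemma isTest_radialBump : IsTest (radialBump d) := by
  refine ⟨(expNegInvGlue.contDiff (n := ⊤)).comp (contDiff_const.sub (contDiff_norm_sq ℝ)),
    HasCompactSupport.of_support_subset_isCompact
      (isCompact_closedBall (0 : EuclideanSpace ℝ (Fin d)) 1) fun x hx => ?_⟩
  rw [mem_closedBall_zero_iff]
  by_contra! h
  exact hx (radialBump_eq_zero h.le)

lemma setIntegral_ball_radialBump_add_le {R : ℝ} (hR : 0 ≤ R) (z : EuclideanSpace ℝ (Fin d)) :
    ∫ x in Metric.ball 0 R, radialBump d (x + z) ≤ ∫ x in Metric.ball 0 R, radialBump d x := by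
  refine setIntegral_comp_add_right_le (κ := expNegInvGlue (1 - R ^ 2)) isTest_radialBump.integrable
    measurableSet_ball measure_ball_lt_top.ne (fun x hx => ?_) (fun x hx => ?_) z
  · rw [mem_ball_zero_iff] at hx
    exact expNegInvGlue.monotone (by gcongr)
  · rw [mem_ball_zero_iff, not_lt] at hx
    exact expNegInvGlue.monotone (by gcongr)

lemma setIntegral_ball_secondDiff_radialBump_nonneg {R : ℝ} (hR : 0 ≤ R)
    (z : EuclideanSpace ℝ (Fin d)) :
    0 ≤ ∫ x in Metric.ball 0 R, secondDiff (radialBump d) x z := by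
  rw [setIntegral_secondDiff isTest_radialBump.integrable]
  have hadd := setIntegral_ball_radialBump_add_le hR z
  have hsub := setIntegral_ball_radialBump_add_le hR (-z)
  simp only [← sub_eq_add_neg] at hsub
  linarith

lemma setIntegral_ball_radialBump_add_eq_zero {R : ℝ} {z : EuclideanSpace ℝ (Fin d)}
    (hz : R + 1 ≤ ‖z‖) : ∫ x in Metric.ball 0 R, radialBump d (x + z) = 0 := by
  refine setIntegral_eq_zero_of_forall_eq_zero fun x hx => radialBump_eq_zero ?_
  rw [mem_ball_zero_iff] at hx
  linarith [norm_sub_le_norm_add z x, congrArg norm (add_comm x z)]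

lemma setIntegral_ball_secondDiff_radialBump_of_far {R : ℝ} {z : EuclideanSpace ℝ (Fin d)}
    (hz : R + 1 ≤ ‖z‖) :
    ∫ x in Metric.ball 0 R, secondDiff (radialBump d) x z =
      2 * ∫ x in Metric.ball 0 R, radialBump d x := by
  have hsub := setIntegral_ball_radialBump_add_eq_zero (hz.trans_eq (norm_neg z).symm)
  simp only [← sub_eq_add_neg] at hsub
  rw [setIntegral_secondDiff isTest_radialBump.integrable,
    setIntegral_ball_radialBump_add_eq_zero hz, hsub, sub_zero, sub_zero]

lemma measureReal_ball_eq_pow_mul (p : EuclideanSpace ℝ (Fin d)) {R : ℝ} (hR : 0 < R) :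
    (volume : Measure (EuclideanSpace ℝ (Fin d))).real (Metric.ball p R) =
      R ^ d * (volume : Measure (EuclideanSpace ℝ (Fin d))).real (Metric.ball 0 1) := by
  rw [measureReal_def, Measure.addHaar_ball_of_pos _ _ hR, ENNReal.toReal_mul,
    ENNReal.toReal_ofReal (by positivity), finrank_euclideanSpace_fin, ← measureReal_def]

lemma measureReal_unitBall_pos :
    0 < (volume : Measure (EuclideanSpace ℝ (Fin d))).real (Metric.ball 0 1) :=
  ENNReal.toReal_pos (Metric.measure_ball_pos _ _ one_pos).ne' measure_ball_lt_top.ne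

lemma exists_le_setIntegral_ball_radialBump :
    ∃ c, 0 < c ∧ ∀ R : ℝ, 0 < R →
      c * (R / (1 + R)) ^ d ≤ ∫ x in Metric.ball 0 R, radialBump d x := by
  set Ω := (volume : Measure (EuclideanSpace ℝ (Fin d))).real (Metric.ball 0 1)
  have hΩ : 0 < Ω := measureReal_unitBall_pos
  set κ := expNegInvGlue (1 - (1 / 2 : ℝ) ^ 2)
  have hκ : 0 < κ := expNegInvGlue.pos_of_pos (by norm_num)
  have hb := isTest_radialBump (d := d).integrable
  refine ⟨(1 / 2) ^ d * κ * Ω, by positivity, fun R hR => ?_⟩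
  set q := 1 / 2 * (R / (1 + R)) with hq
  have hqR : q ≤ R := by
    rw [hq, div_mul_div_comm, one_mul, div_le_iff₀ (by positivity)]
    nlinarith
  have hq2 : q ≤ 1 / 2 :=
    mul_le_of_le_one_right (by norm_num) ((div_le_one (by positivity)).2 (by linarith))
  calc (1 / 2) ^ d * κ * Ω * (R / (1 + R)) ^ d
      = ∫ _ in Metric.ball (0 : EuclideanSpace ℝ (Fin d)) q, κ := by
        rw [setIntegral_const, measureReal_ball_eq_pow_mul _ (by positivity), hq, mul_pow,
          smul_eq_mul]
        ring
    _ ≤ ∫ x in Metric.ball 0 q, radialBump d x := by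
        refine setIntegral_mono_on (integrableOn_const measure_ball_lt_top.ne) hb.integrableOn
          measurableSet_ball fun x hx => expNegInvGlue.monotone ?_
        have : ‖x‖ < 1 / 2 := (mem_ball_zero_iff.1 hx).trans_le hq2
        gcongr
    _ ≤ ∫ x in Metric.ball 0 R, radialBump d x :=
        setIntegral_mono_set hb.integrableOn (ae_of_all _ radialBump_nonneg)
          (Metric.ball_subset_ball hqR).eventuallyLE

end RadialBump

section SourcePositivity

open scoped Pointwise

lemma IsLevyKernel.integrable_setIntegral_secondDiff_mul {E : Type*} [NormedAddCommGroup E]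
    [InnerProductSpace ℝ E] [FiniteDimensional ℝ E] [MeasurableSpace E] [BorelSpace E]
    {K φ : E → ℝ} (hK : IsLevyKernel K) (hφ : ContDiff ℝ 2 φ) (hc : HasCompactSupport φ)
    (S : Set E) : Integrable fun z => (∫ x in S, secondDiff φ x z) / 2 * K z := by
  have hprod := (hK.integrable_prod_secondDiff_mul hφ hc).mono_measure
    (Measure.prod_mono (Measure.restrict_le_self (s := S)) le_rfl)
  simpa only [integral_mul_const, integral_div] using hprod.integral_prod_right

lemma IsLevyKernel.setIntegral_levyOp {E : Type*} [NormedAddCommGroup E]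
    [InnerProductSpace ℝ E] [FiniteDimensional ℝ E] [MeasurableSpace E] [BorelSpace E]
    {K φ : E → ℝ} (hK : IsLevyKernel K) (hφ : ContDiff ℝ 2 φ) (hc : HasCompactSupport φ)
    (S : Set E) :
    ∫ x in S, levyOp K φ x = ∫ z, (∫ x in S, secondDiff φ x z) / 2 * K z := by
  have hprod := (hK.integrable_prod_secondDiff_mul hφ hc).mono_measure
    (Measure.prod_mono (Measure.restrict_le_self (s := S)) le_rfl)
  simp only [← integral_div, ← integral_mul_const]
  exact integral_integral_swap hprod

variable {d : ℕ} [NeZero d] {s : ℝ}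

lemma fracKernel_smul {r : ℝ} (hr : 0 < r) (z : EuclideanSpace ℝ (Fin d)) :
    fracKernel d s (r • z) = r ^ (-((d : ℝ) + 2 * s)) * fracKernel d s z := by
  unfold fracKernel
  rw [norm_smul, Real.norm_of_nonneg hr.le, Real.mul_rpow hr.le (norm_nonneg z),
    Real.rpow_neg hr.le, div_mul_eq_div_div_swap, div_eq_inv_mul]

lemma setIntegral_lt_norm_fracKernel {r : ℝ} (hr : 0 < r) :
    ∫ z in {z : EuclideanSpace ℝ (Fin d) | r < ‖z‖}, fracKernel d s z =
      r ^ (-(2 * s)) * ∫ z in {z | 1 < ‖z‖}, fracKernel d s z := by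
  have hset : r • {z : EuclideanSpace ℝ (Fin d) | 1 < ‖z‖} = {z | r < ‖z‖} := by
    ext z
    rw [mem_smul_set_iff_inv_smul_mem₀ hr.ne', mem_ofPred_eq, mem_ofPred_eq, norm_smul,
      Real.norm_of_nonneg (inv_nonneg.2 hr.le), ← div_eq_inv_mul, one_lt_div hr]
  have hscale := Measure.setIntegral_comp_smul_of_pos volume (fracKernel d s)
    {z | 1 < ‖z‖} hr
  simp only [fracKernel_smul hr, integral_const_mul, hset, finrank_euclideanSpace_fin,
    smul_eq_mul] at hscale
  rw [eq_inv_mul_iff_mul_eq₀ (by positivity), ← mul_assoc, ← Real.rpow_natCast,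
    ← Real.rpow_add hr] at hscale
  rw [← hscale]
  congr 2
  ring

lemma setIntegral_one_lt_norm_fracKernel_pos (h0 : 0 < s) (h1 : s < 1) :
    0 < ∫ z in {z : EuclideanSpace ℝ (Fin d) | 1 < ‖z‖}, fracKernel d s z := by
  have hK := isLevyKernel_fracKernel (d := d) h0 h1
  rw [setIntegral_pos_iff_support_of_nonneg_ae (ae_of_all _ hK.nonneg)
    (hK.integrableOn_lt_norm one_pos)]
  have hopen : IsOpen {z : EuclideanSpace ℝ (Fin d) | 1 < ‖z‖} :=
    isOpen_lt continuous_const continuous_norm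
  have hne : {z : EuclideanSpace ℝ (Fin d) | 1 < ‖z‖}.Nonempty :=
    ⟨EuclideanSpace.single 0 2, by norm_num⟩
  refine (hopen.measure_pos volume hne).trans_le (measure_mono fun z hz => ?_)
  have hz0 : 0 < ‖z‖ := one_pos.trans hz
  exact ⟨(div_pos (normConst_pos h0 h1) (by positivity)).ne', hz⟩

/-- By rearrangement every shell of second differences contributes with a nonnegative sign, and
those with `‖z‖ ≥ R + 1` contribute the full mass of the bump in the ball. -/
lemma exists_le_setIntegral_ball_fracLap_radialBump (h0 : 0 < s) (h1 : s < 1) :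
    ∃ c, 0 < c ∧ ∀ R : ℝ, 0 < R → c * (R ^ d * (1 + R) ^ (-((d : ℝ) + 2 * s))) ≤
      ∫ x in Metric.ball 0 R, fracLap s (radialBump d) x := by
  have hK := isLevyKernel_fracKernel (d := d) h0 h1
  have hb := isTest_radialBump (d := d)
  obtain ⟨c, hc, hmass⟩ := exists_le_setIntegral_ball_radialBump (d := d)
  set k := ∫ z in {z : EuclideanSpace ℝ (Fin d) | 1 < ‖z‖}, fracKernel d s z
  have hk : 0 < k := setIntegral_one_lt_norm_fracKernel_pos h0 h1
  refine ⟨c * k, by positivity, fun R hR => ?_⟩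
  have hR1 : 0 < 1 + R := by positivity
  set I := ∫ x in Metric.ball 0 R, radialBump d x
  calc c * k * (R ^ d * (1 + R) ^ (-((d : ℝ) + 2 * s)))
      = c * (R / (1 + R)) ^ d * ((1 + R) ^ (-(2 * s)) * k) := by
        rw [neg_add, Real.rpow_add hR1, Real.rpow_neg hR1.le, Real.rpow_natCast, div_pow]
        ring
    _ ≤ I * ((1 + R) ^ (-(2 * s)) * k) := by gcongr; exact hmass R hR
    _ = ∫ z in {z : EuclideanSpace ℝ (Fin d) | 1 + R < ‖z‖}, I * fracKernel d s z := by
        rw [integral_const_mul, setIntegral_lt_norm_fracKernel hR1]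
    _ = ∫ z in {z : EuclideanSpace ℝ (Fin d) | 1 + R < ‖z‖},
          (∫ x in Metric.ball 0 R, secondDiff (radialBump d) x z) / 2 * fracKernel d s z := by
        refine setIntegral_congr_fun (measurableSet_lt measurable_const measurable_norm)
          fun z hz => ?_
        have hfar : R + 1 ≤ ‖z‖ := (add_comm R 1).trans_le (le_of_lt hz)
        simp only [setIntegral_ball_secondDiff_radialBump_of_far hfar,
          mul_div_cancel_left₀ _ (two_ne_zero' ℝ), I]
    _ ≤ ∫ z, (∫ x in Metric.ball 0 R, secondDiff (radialBump d) x z) / 2 * fracKernel d s z :=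
        setIntegral_le_integral (hK.integrable_setIntegral_secondDiff_mul hb.contDiff_two hb.2 _)
          (ae_of_all _ fun z => mul_nonneg (div_nonneg
            (setIntegral_ball_secondDiff_radialBump_nonneg hR.le z) zero_le_two) (hK.nonneg z))
    _ = ∫ x in Metric.ball 0 R, fracLap s (radialBump d) x := by
        rw [hb.fracLap_eq_levyOp h0 h1, hK.setIntegral_levyOp hb.contDiff_two hb.2]

end SourcePositivity

section Dilation

lemma setIntegral_Ioi_comp_inv (g : ℝ → ℝ) {L : ℝ} (hL : 0 < L) :
    ∫ r in Ioi L, r ^ (-2 : ℝ) * g r⁻¹ = ∫ t in Ioo 0 L⁻¹, g t := by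
  have hderiv (r : ℝ) (hr : r ∈ Ioi L) : HasDerivWithinAt Inv.inv (-(r ^ 2)⁻¹) (Ioi L) r :=
    (hasDerivAt_inv (hL.trans hr).ne').hasDerivWithinAt
  rw [← inv_Ioi₀ hL, ← image_inv_eq_inv, integral_image_eq_integral_abs_deriv_smul
    measurableSet_Ioi hderiv inv_injective.injOn]
  refine setIntegral_congr_fun measurableSet_Ioi fun r hr => ?_
  have hr0 : 0 < r := hL.trans hr
  simp only [abs_neg, abs_inv, abs_pow, abs_of_pos hr0, Real.rpow_neg hr0.le, Real.rpow_two,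
    smul_eq_mul]

lemma setIntegral_ball_of_radial {E : Type*} [NormedAddCommGroup E] [NormedSpace ℝ E]
    [FiniteDimensional ℝ E] [MeasurableSpace E] [BorelSpace E] {μ : Measure E}
    [μ.IsAddHaarMeasure] {f : E → ℝ} (hf : ∀ x y, ‖x‖ = ‖y‖ → f x = f y) {x : E} (hx : x ≠ 0)
    (R : ℝ) :
    ∫ y in Metric.ball 0 (‖x‖ * R), f y ∂μ =
      Module.finrank ℝ E * μ.real (Metric.ball 0 1) * ‖x‖ ^ Module.finrank ℝ E *
        ∫ t in Ioo 0 R, t ^ (Module.finrank ℝ E - 1) * f (t • x) := by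
  classical
  have : Nontrivial E := nontrivial_of_ne x 0 hx
  have hx0 : 0 < ‖x‖ := norm_pos_iff.2 hx
  have hpolar (y : E) : (Metric.ball 0 (‖x‖ * R)).indicator f (‖x‖ • y) =
      (Iio R).indicator (fun t => f (t • x)) ‖y‖ := by
    simp only [indicator_apply, mem_ball_zero_iff, norm_smul, norm_norm, mem_Iio,
      mul_lt_mul_iff_right₀ hx0]
    rw [hf (‖x‖ • y) (‖y‖ • x) (by simp only [norm_smul, norm_norm, mul_comm])]
  have hscale := μ.integral_comp_smul ((Metric.ball 0 (‖x‖ * R)).indicator f) ‖x‖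
  simp only [hpolar] at hscale
  rw [integral_fun_norm_addHaar, integral_indicator measurableSet_ball,
    abs_of_nonneg (by positivity), smul_eq_mul, smul_eq_mul, nsmul_eq_mul,
    eq_inv_mul_iff_mul_eq₀ (by positivity)] at hscale
  have hIoo : ∫ t in Ioi 0, t ^ (Module.finrank ℝ E - 1) • (Iio R).indicator (fun t => f (t • x)) t
      = ∫ t in Ioo 0 R, t ^ (Module.finrank ℝ E - 1) * f (t • x) := by
    rw [← Ioi_inter_Iio, ← setIntegral_indicator measurableSet_Iio]
    simp only [smul_eq_mul, indicator_mul_right]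
  rw [← hscale, hIoo]
  ring

variable {E : Type*} [NormedAddCommGroup E] [InnerProductSpace ℝ E] [FiniteDimensional ℝ E]
  [MeasurableSpace E] [BorelSpace E]

lemma levyOp_eq_of_norm_eq {K φ : E → ℝ} (hK : ∀ x y, ‖x‖ = ‖y‖ → K x = K y)
    (hφ : ∀ x y, ‖x‖ = ‖y‖ → φ x = φ y) {x y : E} (h : ‖x‖ = ‖y‖) :
    levyOp K φ x = levyOp K φ y := by
  obtain ⟨A, rfl⟩ : ∃ A : E ≃ₗᵢ[ℝ] E, A x = y := ⟨_, Submodule.reflection_sub h⟩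
  unfold levyOp
  rw [← A.measurePreserving.integral_comp A.toHomeomorph.measurableEmbedding
    fun z => secondDiff φ (A x) z / 2 * K z]
  congr 1 with z
  simp only [secondDiff, ← map_add, ← map_sub]
  rw [hK z (A z) (A.norm_map z).symm, hφ x (A x) h, hφ (x + z) _ (A.norm_map _).symm,
    hφ (x - z) _ (A.norm_map _).symm]

variable {d : ℕ} [NeZero d] {s : ℝ}

lemma levyOp_fracKernel_comp_inv_smul (φ : EuclideanSpace ℝ (Fin d) → ℝ) {r : ℝ} (hr : 0 < r)
    (x : EuclideanSpace ℝ (Fin d)) :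
    levyOp (fracKernel d s) (fun y => φ (r⁻¹ • y)) x =
      r ^ (-(2 * s)) * levyOp (fracKernel d s) φ (r⁻¹ • x) := by
  have hscale := Measure.integral_comp_inv_smul_of_nonneg volume (fun w =>
    secondDiff φ (r⁻¹ • x) w / 2 * (r ^ (-((d : ℝ) + 2 * s)) * fracKernel d s w)) hr.le
  simp only [← fracKernel_smul hr, smul_inv_smul₀ hr.ne'] at hscale
  simp only [fracKernel_smul hr, finrank_euclideanSpace_fin, smul_eq_mul] at hscale
  have hpow : r ^ (-(2 * s)) = r ^ d * r ^ (-((d : ℝ) + 2 * s)) := by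
    rw [← Real.rpow_natCast, ← Real.rpow_add hr]
    congr 1
    ring
  simp only [levyOp, secondDiff, smul_add, smul_sub] at hscale ⊢
  rw [hscale, hpow, mul_assoc, ← integral_const_mul (r ^ (-((d : ℝ) + 2 * s)))]
  simp only [mul_left_comm]

end Dilation

section ScaledBump

/-- The radial bump dilated to the ball of radius `r`. -/
def scaledBump (d : ℕ) (r : ℝ) (x : EuclideanSpace ℝ (Fin d)) : ℝ := radialBump d (r⁻¹ • x)

variable {d : ℕ}

lemma scaledBump_nonneg (r : ℝ) (x : EuclideanSpace ℝ (Fin d)) : 0 ≤ scaledBump d r x :=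
  radialBump_nonneg _

lemma norm_scaledBump_le (r : ℝ) (x : EuclideanSpace ℝ (Fin d)) :
    ‖scaledBump d r x‖ ≤ radialBump d 0 :=
  (Real.norm_of_nonneg (scaledBump_nonneg r x)).trans_le (radialBump_le _)

lemma scaledBump_eq_zero {r : ℝ} (hr : 0 < r) {x : EuclideanSpace ℝ (Fin d)} (hx : r ≤ ‖x‖) :
    scaledBump d r x = 0 := by
  refine radialBump_eq_zero ?_
  rwa [norm_smul, norm_inv, Real.norm_of_nonneg hr.le, ← div_eq_inv_mul, one_le_div hr]

lemma scaledBump_mono {r r' : ℝ} (hr : 0 < r) (h : r ≤ r') (x : EuclideanSpace ℝ (Fin d)) :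
    scaledBump d r x ≤ scaledBump d r' x := by
  refine radialBump_anti ?_
  rw [norm_smul, norm_smul, Real.norm_of_nonneg (inv_nonneg.2 (hr.le.trans h)),
    Real.norm_of_nonneg (inv_nonneg.2 hr.le)]
  gcongr

lemma isTest_scaledBump {r : ℝ} (hr : 0 < r) : IsTest (scaledBump d r) :=
  ⟨isTest_radialBump.1.comp (contDiff_const_smul _),
    isTest_radialBump.2.comp_smul (inv_ne_zero hr.ne')⟩

lemma continuous_scaledBump (r : ℝ) : Continuous (scaledBump d r) :=
  isTest_radialBump.1.continuous.comp (continuous_const_smul _)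

lemma tendsto_scaledBump (x : EuclideanSpace ℝ (Fin d)) :
    Tendsto (fun r => scaledBump d r x) atTop (𝓝 (radialBump d 0)) := by
  refine (isTest_radialBump.1.continuous.tendsto 0).comp ?_
  simpa using (tendsto_inv_atTop_zero (𝕜 := ℝ)).smul_const x

section Integral

variable (ν : Measure (EuclideanSpace ℝ (Fin d)))

lemma integral_scaledBump_nonneg (r : ℝ) : 0 ≤ ∫ x, scaledBump d r x ∂ν :=
  integral_nonneg (scaledBump_nonneg r)

variable [IsFiniteMeasure ν]

lemma integrable_scaledBump (r : ℝ) : Integrable (scaledBump d r) ν :=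
  Integrable.of_bound (continuous_scaledBump r).aestronglyMeasurable _
    (ae_of_all _ (norm_scaledBump_le r))

lemma integral_scaledBump_le (r : ℝ) :
    ∫ x, scaledBump d r x ∂ν ≤ radialBump d 0 * ν.real univ := by
  refine (integral_mono (integrable_scaledBump ν r) (integrable_const _)
    fun x => radialBump_le _).trans_eq ?_
  rw [integral_const, smul_eq_mul, mul_comm]

lemma tendsto_integral_scaledBump_of_tendsto {l : Filter ℝ} [l.IsCountablyGenerated]
    {f : EuclideanSpace ℝ (Fin d) → ℝ}
    (h : ∀ x, Tendsto (fun r => scaledBump d r x) l (𝓝 (f x))) :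
    Tendsto (fun r => ∫ x, scaledBump d r x ∂ν) l (𝓝 (∫ x, f x ∂ν)) :=
  tendsto_integral_filter_of_dominated_convergence (fun _ => radialBump d 0)
    (Eventually.of_forall fun r => (continuous_scaledBump r).aestronglyMeasurable)
    (Eventually.of_forall fun r => ae_of_all _ (norm_scaledBump_le r)) (integrable_const _)
    (ae_of_all _ h)

lemma tendsto_integral_scaledBump :
    Tendsto (fun r => ∫ x, scaledBump d r x ∂ν) atTop (𝓝 (radialBump d 0 * ν.real univ)) := by
  convert tendsto_integral_scaledBump_of_tendsto ν tendsto_scaledBump using 2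
  rw [integral_const, smul_eq_mul, mul_comm]

lemma continuousOn_integral_scaledBump :
    ContinuousOn (fun r => ∫ x, scaledBump d r x ∂ν) (Ioi 0) := fun _ hr =>
  tendsto_integral_scaledBump_of_tendsto ν fun _ =>
    (isTest_radialBump.1.continuous.continuousAt.comp
      ((continuousAt_inv₀ (ne_of_gt hr)).smul continuousAt_const)).continuousWithinAt

end Integral

end ScaledBump

section BumpSource

variable {d : ℕ} [NeZero d] {s : ℝ}

lemma fracLap_scaledBump (h0 : 0 < s) (h1 : s < 1) {r : ℝ} (hr : 0 < r)
    (x : EuclideanSpace ℝ (Fin d)) :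
    fracLap s (scaledBump d r) x = r ^ (-(2 * s)) * fracLap s (radialBump d) (r⁻¹ • x) := by
  rw [(isTest_scaledBump hr).fracLap_eq_levyOp h0 h1, isTest_radialBump.fracLap_eq_levyOp h0 h1]
  exact levyOp_fracKernel_comp_inv_smul _ hr x

lemma exists_abs_fracLap_scaledBump_le (h0 : 0 < s) (h1 : s < 1) {L : ℝ} (hL : 0 < L) :
    ∃ C, 0 ≤ C ∧ ∀ r, L ≤ r → ∀ x : EuclideanSpace ℝ (Fin d),
      |fracLap s (scaledBump d r) x| ≤ C * (1 + ‖x‖) ^ (-(2 * s)) := by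
  obtain ⟨C, hC0, hC⟩ := (isTest_radialBump (d := d)).exists_abs_fracLap_le_rpow h0 h1
  refine ⟨C * min 1 L ^ (-(2 * s)), by positivity, fun r hr x => ?_⟩
  have hr0 : 0 < r := hL.trans_le hr
  have hbase : min 1 L * (1 + ‖x‖) ≤ r * (1 + ‖r⁻¹ • x‖) := by
    rw [norm_smul, Real.norm_of_nonneg (inv_nonneg.2 hr0.le), mul_add, mul_add,
      mul_inv_cancel_left₀ hr0.ne', mul_one, mul_one]
    exact add_le_add ((min_le_right _ _).trans hr)
      (mul_le_of_le_one_left (norm_nonneg x) (min_le_left _ _))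
  rw [fracLap_scaledBump h0 h1 hr0, abs_mul, abs_of_nonneg (by positivity)]
  calc r ^ (-(2 * s)) * |fracLap s (radialBump d) (r⁻¹ • x)|
      ≤ r ^ (-(2 * s)) * (C * (1 + ‖r⁻¹ • x‖) ^ (-(2 * s))) := by gcongr; exact hC _
    _ = C * (r * (1 + ‖r⁻¹ • x‖)) ^ (-(2 * s)) := by
        rw [Real.mul_rpow hr0.le (by positivity), mul_left_comm]
    _ ≤ C * (min 1 L * (1 + ‖x‖)) ^ (-(2 * s)) :=
        mul_le_mul_of_nonneg_left
          (Real.rpow_le_rpow_of_nonpos (by positivity) hbase (by linarith)) hC0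
    _ = C * min 1 L ^ (-(2 * s)) * (1 + ‖x‖) ^ (-(2 * s)) := by
        rw [Real.mul_rpow (by positivity) (by positivity), mul_assoc]

lemma fracLap_radialBump_eq_of_norm_eq (h0 : 0 < s) (h1 : s < 1)
    {x y : EuclideanSpace ℝ (Fin d)} (h : ‖x‖ = ‖y‖) :
    fracLap s (radialBump d) x = fracLap s (radialBump d) y := by
  rw [isTest_radialBump.fracLap_eq_levyOp h0 h1]
  exact levyOp_eq_of_norm_eq (fun x y h => by rw [fracKernel, h, fracKernel])
    (fun x y h => by rw [radialBump, h, radialBump]) h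

/-- `(-Δ)^s` of the superposition `∫_L^∞ r^{-1-d+2s} b(x/r) dr` of dilated bumps, a Riesz kernel
`|x|^{2s-d}` smoothed at scale `L`. -/
def bumpSource (d : ℕ) [NeZero d] (s L : ℝ) (x : EuclideanSpace ℝ (Fin d)) : ℝ :=
  ∫ r in Ioi L, r ^ (-1 - (d : ℝ) + 2 * s) * fracLap s (scaledBump d r) x

/-- In polar coordinates, superposing dilates of a radial function amounts to integrating it over
a ball. -/
lemma setIntegral_ball_fracLap_radialBump (h0 : 0 < s) (h1 : s < 1) {L : ℝ} (hL : 0 < L)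
    {x : EuclideanSpace ℝ (Fin d)} (hx : x ≠ 0) :
    ∫ y in Metric.ball 0 (‖x‖ / L), fracLap s (radialBump d) y =
      d * (volume : Measure (EuclideanSpace ℝ (Fin d))).real (Metric.ball 0 1) * ‖x‖ ^ d *
        bumpSource d s L x := by
  rw [div_eq_mul_inv, setIntegral_ball_of_radial
    (fun x y h => fracLap_radialBump_eq_of_norm_eq h0 h1 h) hx, finrank_euclideanSpace_fin,
    ← setIntegral_Ioi_comp_inv _ hL]
  congr 1
  refine setIntegral_congr_fun measurableSet_Ioi fun r hr => ?_
  have hr0 : 0 < r := hL.trans hr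
  have hpow : (r⁻¹) ^ (d - 1) = r ^ (1 - (d : ℝ)) := by
    rw [inv_pow, ← Real.rpow_natCast, ← Real.rpow_neg hr0.le, Nat.cast_pred (Nat.pos_of_neZero d),
      neg_sub]
  simp only [fracLap_scaledBump h0 h1 hr0, ← mul_assoc]
  rw [hpow, ← Real.rpow_add hr0, ← Real.rpow_add hr0]
  congr 2
  ring

lemma exists_le_bumpSource (h0 : 0 < s) (h1 : s < 1) :
    ∃ c, 0 < c ∧ ∀ L : ℝ, 0 < L → ∀ x : EuclideanSpace ℝ (Fin d), x ≠ 0 →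
      c * (L ^ (-(d : ℝ)) * (1 + ‖x‖ / L) ^ (-((d : ℝ) + 2 * s))) ≤ bumpSource d s L x := by
  obtain ⟨c, hc, hball⟩ := exists_le_setIntegral_ball_fracLap_radialBump (d := d) h0 h1
  set Ω := (volume : Measure (EuclideanSpace ℝ (Fin d))).real (Metric.ball 0 1)
  have hΩ : 0 < Ω := measureReal_unitBall_pos
  have hd : (0 : ℝ) < d := Nat.cast_pos.2 (Nat.pos_of_neZero d)
  refine ⟨c / (d * Ω), by positivity, fun L hL x hx => ?_⟩
  have hbound := hball (‖x‖ / L) (div_pos (norm_pos_iff.2 hx) hL)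
  rw [setIntegral_ball_fracLap_radialBump h0 h1 hL hx] at hbound
  refine le_of_mul_le_mul_left (a := d * Ω * ‖x‖ ^ d) (le_of_eq_of_le ?_ hbound) (by positivity)
  rw [Real.rpow_neg hL.le, Real.rpow_natCast, div_pow]
  field_simp

end BumpSource

section BumpPotential

variable {d : ℕ} {s : ℝ}

/-- The integral against `ν` of the superposition `∫_L^∞ r^{-1-d+2s} b(x/r) dr` of dilated bumps,
that is, the Riesz potential `|x|^{2s-d}` of `ν` at the origin, smoothed at scale `L`. -/
def bumpPotential (s L : ℝ) (ν : Measure (EuclideanSpace ℝ (Fin d))) : ℝ :=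
  ∫ r in Ioi L, r ^ (-1 - (d : ℝ) + 2 * s) * ∫ x, scaledBump d r x ∂ν

lemma integrableOn_Ioi_rpow_bumpPotential (hd : 2 * s < d) {L : ℝ} (hL : 0 < L) :
    IntegrableOn (fun r => r ^ (-1 - (d : ℝ) + 2 * s)) (Ioi L) :=
  integrableOn_Ioi_rpow_of_lt (by linarith) hL

variable (ν : Measure (EuclideanSpace ℝ (Fin d)))

lemma bumpPotential_restrict_compl_ball {L R : ℝ} (hL : 0 < L) (hLR : L ≤ R) :
    bumpPotential s L (ν.restrict (Metric.ball 0 R)ᶜ) =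
      bumpPotential s R (ν.restrict (Metric.ball 0 R)ᶜ) := by
  refine setIntegral_eq_of_subset_of_forall_sdiff_eq_zero measurableSet_Ioi
    (Ioi_subset_Ioi hLR) fun r hr => ?_
  rw [setIntegral_eq_zero_of_forall_eq_zero, mul_zero]
  intro x hx
  rw [mem_compl_iff, mem_ball_zero_iff, not_lt] at hx
  exact scaledBump_eq_zero (hL.trans hr.1) ((not_lt.1 hr.2).trans hx)

variable [IsFiniteMeasure ν]

lemma integrableOn_rpow_mul_integral_scaledBump (hd : 2 * s < d) {L : ℝ} (hL : 0 < L) :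
    IntegrableOn (fun r => r ^ (-1 - (d : ℝ) + 2 * s) * ∫ x, scaledBump d r x ∂ν) (Ioi L) := by
  refine (integrableOn_Ioi_rpow_bumpPotential hd hL).mul_bdd (c := radialBump d 0 * ν.real univ)
    ?_ (ae_of_all _ fun r => ?_)
  · exact ((continuousOn_integral_scaledBump ν).mono (Ioi_subset_Ioi hL.le)).aestronglyMeasurable
      measurableSet_Ioi
  · rw [Real.norm_of_nonneg (integral_scaledBump_nonneg ν r)]
    exact integral_scaledBump_le ν r

lemma bumpPotential_le (hd : 2 * s < d) {L : ℝ} (hL : 0 < L) :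
    bumpPotential s L ν ≤
      (∫ r in Ioi L, r ^ (-1 - (d : ℝ) + 2 * s)) * (radialBump d 0 * ν.real univ) := by
  rw [bumpPotential, ← integral_mul_const]
  refine setIntegral_mono_on (integrableOn_rpow_mul_integral_scaledBump ν hd hL)
    ((integrableOn_Ioi_rpow_bumpPotential hd hL).mul_const _) measurableSet_Ioi fun r hr => ?_
  have hr0 : 0 < r := hL.trans hr
  gcongr
  exact integral_scaledBump_le ν r

lemma bumpPotential_eq_add_compl (hd : 2 * s < d) {L : ℝ} (hL : 0 < L)
    {A : Set (EuclideanSpace ℝ (Fin d))} (hA : MeasurableSet A) :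
    bumpPotential s L ν =
      bumpPotential s L (ν.restrict A) + bumpPotential s L (ν.restrict Aᶜ) := by
  simp only [bumpPotential]
  rw [← integral_add (integrableOn_rpow_mul_integral_scaledBump _ hd hL)
    (integrableOn_rpow_mul_integral_scaledBump _ hd hL)]
  congr 1 with r
  rw [← mul_add, integral_add_compl hA (integrable_scaledBump ν r)]

lemma bumpPotential_le_add_compl_ball (hd : 2 * s < d) {L R : ℝ} (hL : 0 < L) (hLR : L ≤ R) :
    bumpPotential s L ν ≤
      (∫ r in Ioi L, r ^ (-1 - (d : ℝ) + 2 * s)) * (radialBump d 0 * ν.real (Metric.ball 0 R)) +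
      (∫ r in Ioi R, r ^ (-1 - (d : ℝ) + 2 * s)) *
        (radialBump d 0 * ν.real (Metric.ball 0 R)ᶜ) := by
  rw [bumpPotential_eq_add_compl ν hd hL (A := Metric.ball 0 R) measurableSet_ball,
    bumpPotential_restrict_compl_ball ν hL hLR]
  simpa only [measureReal_restrict_apply_univ] using
    add_le_add (bumpPotential_le (ν.restrict (Metric.ball 0 R)) hd hL)
      (bumpPotential_le (ν.restrict (Metric.ball 0 R)ᶜ) hd (hL.trans_le hLR))

lemma le_bumpPotential (hd : 2 * s < d) {L : ℝ} (hL : 0 < L) :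
    (∫ r in Ioi L, r ^ (-1 - (d : ℝ) + 2 * s)) * ∫ x, scaledBump d L x ∂ν ≤
      bumpPotential s L ν := by
  rw [bumpPotential, ← integral_mul_const]
  refine setIntegral_mono_on ((integrableOn_Ioi_rpow_bumpPotential hd hL).mul_const _)
    (integrableOn_rpow_mul_integral_scaledBump ν hd hL) measurableSet_Ioi fun r hr => ?_
  have hr0 : 0 < r := hL.trans hr
  gcongr
  · exact integrable_scaledBump ν L
  · exact integrable_scaledBump ν r
  · exact fun x => scaledBump_mono hL (le_of_lt hr) x

end BumpPotential

section Transition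

variable {d : ℕ} [NeZero d] {s : ℝ} {T : Set (EuclideanSpace ℝ (Fin d) → ℝ)}
  {V : EuclideanSpace ℝ (Fin d) → ℝ} {ν₁ ν₂ : Measure (EuclideanSpace ℝ (Fin d))}

/-- `ν₁ - ν₂ = (-Δ)^s V` when tested against the functions of the family `T`. For a diffusion flow,
`V` is the time integral of `W`, and `T` will be countable so that the identity
holds for almost every pair of times. -/
structure IsTransition (s : ℝ) (T : Set (EuclideanSpace ℝ (Fin d) → ℝ))
    (V : EuclideanSpace ℝ (Fin d) → ℝ) (ν₁ ν₂ : Measure (EuclideanSpace ℝ (Fin d))) : Prop where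
  nonneg : 0 ≤ᵐ[volume] V
  integrable : Integrable fun x => V x * (1 + ‖x‖) ^ (-(2 * s))
  sub_eq : ∀ χ ∈ T, ∫ x, χ x ∂ν₁ - ∫ x, χ x ∂ν₂ = ∫ x, V x * fracLap s χ x

lemma norm_mul_le_mul_norm_mul {α : Type*} {f h w : α → ℝ} {C : ℝ} (hC0 : 0 ≤ C)
    (hC : ∀ x, |h x| ≤ C * w x) (x : α) : ‖f x * h x‖ ≤ C * ‖f x * w x‖ := by
  rw [norm_mul, norm_mul, mul_left_comm]
  exact mul_le_mul_of_nonneg_left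
    ((hC x).trans (mul_le_mul_of_nonneg_left (Real.le_norm_self _) hC0)) (norm_nonneg _)

lemma continuousOn_fracLap_scaledBump (h0 : 0 < s) (h1 : s < 1) :
    ContinuousOn (fun z : EuclideanSpace ℝ (Fin d) × ℝ => fracLap s (scaledBump d z.2) z.1)
      (univ ×ˢ Ioi 0) := by
  have hsmul : ContinuousOn (fun z : EuclideanSpace ℝ (Fin d) × ℝ => z.2 ^ (-(2 * s)) *
      fracLap s (radialBump d) (z.2⁻¹ • z.1)) (univ ×ˢ Ioi 0) := by
    have hne : ∀ z ∈ univ ×ˢ Ioi (0 : ℝ), (z : EuclideanSpace ℝ (Fin d) × ℝ).2 ≠ 0 :=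
      fun z hz => ne_of_gt hz.2
    exact (continuousOn_snd.rpow_const fun z hz => Or.inl (hne z hz)).mul
      ((isTest_radialBump.continuous_fracLap h0 h1).comp_continuousOn
        ((continuousOn_snd.inv₀ hne).smul continuousOn_fst))
  exact hsmul.congr fun z hz => fracLap_scaledBump h0 h1 hz.2 z.1

lemma integrable_mul_fracLap_scaledBump
    (hV : Integrable fun x => V x * (1 + ‖x‖) ^ (-(2 * s))) (h0 : 0 < s) (h1 : s < 1) {r : ℝ}
    (hr : 0 < r) : Integrable fun x => V x * fracLap s (scaledBump d r) x :=
  have ⟨_, _, hC⟩ := (isTest_scaledBump hr).exists_abs_fracLap_le_rpow h0 h1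
  integrable_mul_of_abs_le_mul hV (by fun_prop : Measurable _).aestronglyMeasurable
    (fun x => by positivity)
    ((isTest_scaledBump hr).continuous_fracLap h0 h1).aestronglyMeasurable (ae_of_all _ hC)

lemma tendsto_fracLap_scaledBump (h0 : 0 < s) (h1 : s < 1) (x : EuclideanSpace ℝ (Fin d)) :
    Tendsto (fun r => fracLap s (scaledBump d r) x) atTop (𝓝 0) := by
  have hprod := (tendsto_rpow_neg_atTop (mul_pos two_pos h0)).mul
    (((isTest_radialBump (d := d)).continuous_fracLap h0 h1).tendsto ((0 : ℝ) • x) |>.comp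
      ((tendsto_inv_atTop_zero (𝕜 := ℝ)).smul_const x))
  rw [zero_mul] at hprod
  refine hprod.congr' ?_
  filter_upwards [eventually_gt_atTop 0] with r hr
  exact (fracLap_scaledBump h0 h1 hr x).symm

lemma continuousOn_integral_mul_fracLap_scaledBump
    (hV : Integrable fun x => V x * (1 + ‖x‖) ^ (-(2 * s))) (h0 : 0 < s) (h1 : s < 1) :
    ContinuousOn (fun r => ∫ x, V x * fracLap s (scaledBump d r) x) (Ioi 0) := by
  refine continuousOn_of_forall_continuousAt fun r₀ (hr₀ : 0 < r₀) => ?_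
  obtain ⟨C, hC0, hC⟩ := exists_abs_fracLap_scaledBump_le (d := d) h0 h1 (half_pos hr₀)
  have hnear : ∀ᶠ r in 𝓝 r₀, r₀ / 2 < r := lt_mem_nhds (half_lt_self hr₀)
  refine tendsto_integral_filter_of_dominated_convergence
    (fun x => C * ‖V x * (1 + ‖x‖) ^ (-(2 * s))‖) ?_ ?_ (hV.norm.const_mul _)
    (ae_of_all _ fun x => ?_)
  · filter_upwards [hnear] with r hr
    exact (integrable_mul_fracLap_scaledBump hV h0 h1
      ((half_pos hr₀).trans hr)).aestronglyMeasurable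
  · filter_upwards [hnear] with r hr
    exact ae_of_all _ (norm_mul_le_mul_norm_mul hC0 (hC r hr.le))
  · exact ((continuousOn_fracLap_scaledBump h0 h1).continuousAt
      (prod_mem_nhds univ_mem (Ioi_mem_nhds hr₀))).comp (f := fun r => (x, r)) (by fun_prop)
      |>.const_mul _

namespace IsTransition

variable [IsFiniteMeasure ν₁] [IsFiniteMeasure ν₂]

lemma integral_scaledBump_sub (h : IsTransition s T V ν₁ ν₂) (h0 : 0 < s) (h1 : s < 1)
    (hT : ∀ q : ℚ, scaledBump d (Real.exp q) ∈ T) {r : ℝ} (hr : 0 < r) :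
    ∫ x, scaledBump d r x ∂ν₁ - ∫ x, scaledBump d r x ∂ν₂ =
      ∫ x, V x * fracLap s (scaledBump d r) x := by
  have hexp {f : ℝ → ℝ} (hf : ContinuousOn f (Ioi 0)) : Continuous fun a => f (Real.exp a) :=
    hf.comp_continuous Real.continuous_exp Real.exp_pos
  have heq := (Rat.denseRange_cast (𝕜 := ℝ)).equalizer
    (hexp ((continuousOn_integral_scaledBump ν₁).sub (continuousOn_integral_scaledBump ν₂)))
    (hexp (continuousOn_integral_mul_fracLap_scaledBump h.integrable h0 h1))
    (funext fun q => h.sub_eq _ (hT q))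
  simpa only [Pi.sub_apply, Real.exp_log hr] using congrFun heq (Real.log r)

end IsTransition

lemma integrable_prod_mul_fracLap_scaledBump
    (hV : Integrable fun x => V x * (1 + ‖x‖) ^ (-(2 * s))) (h0 : 0 < s) (h1 : s < 1)
    (hd : 2 * s < d) {L : ℝ} (hL : 0 < L) :
    Integrable (fun z : EuclideanSpace ℝ (Fin d) × ℝ =>
      V z.1 * (z.2 ^ (-1 - (d : ℝ) + 2 * s) * fracLap s (scaledBump d z.2) z.1))
      (volume.prod (volume.restrict (Ioi L))) := by
  obtain ⟨C, -, hC⟩ := exists_abs_fracLap_scaledBump_le (d := d) h0 h1 hL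
  have hprod : Integrable (fun z : EuclideanSpace ℝ (Fin d) × ℝ =>
      V z.1 * z.2 ^ (-1 - (d : ℝ) + 2 * s) * (1 + ‖z.1‖) ^ (-(2 * s)))
      (volume.prod (volume.restrict (Ioi L))) := by
    simpa only [mul_right_comm] using hV.mul_prod (integrableOn_Ioi_rpow_bumpPotential hd hL)
  have hlarge : ∀ᵐ z : EuclideanSpace ℝ (Fin d) × ℝ ∂volume.prod (volume.restrict (Ioi L)),
      L < z.2 := Measure.quasiMeasurePreserving_snd.ae (ae_restrict_mem measurableSet_Ioi)
  have hmeas : AEStronglyMeasurable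
      (fun z : EuclideanSpace ℝ (Fin d) × ℝ => fracLap s (scaledBump d z.2) z.1)
      (volume.prod (volume.restrict (Ioi L))) := by
    rw [← Measure.restrict_univ (μ := (volume : Measure (EuclideanSpace ℝ (Fin d)))),
      Measure.prod_restrict]
    exact ((continuousOn_fracLap_scaledBump h0 h1).mono
      (prod_mono_right (Ioi_subset_Ioi hL.le))).aestronglyMeasurable
      (MeasurableSet.univ.prod measurableSet_Ioi)
  simpa only [mul_assoc] using integrable_mul_of_abs_le_mul hprod
    (by fun_prop : Measurable _).aestronglyMeasurable
    (fun z => by positivity) hmeas (hlarge.mono fun z hz => hC z.2 hz.le z.1)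

lemma integrable_mul_bumpSource (hV : Integrable fun x => V x * (1 + ‖x‖) ^ (-(2 * s)))
    (h0 : 0 < s) (h1 : s < 1) (hd : 2 * s < d) {L : ℝ} (hL : 0 < L) :
    Integrable fun x => V x * bumpSource d s L x := by
  simpa only [bumpSource, integral_const_mul] using
    (integrable_prod_mul_fracLap_scaledBump hV h0 h1 hd hL).integral_prod_left

lemma bumpSource_nonneg (h0 : 0 < s) (h1 : s < 1) {L : ℝ} (hL : 0 < L)
    {x : EuclideanSpace ℝ (Fin d)} (hx : x ≠ 0) : 0 ≤ bumpSource d s L x := by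
  obtain ⟨c, hc, h⟩ := exists_le_bumpSource (d := d) h0 h1
  exact le_trans (by positivity) (h L hL x hx)

namespace IsTransition

variable [IsFiniteMeasure ν₁] [IsFiniteMeasure ν₂]

lemma bumpPotential_sub (h : IsTransition s T V ν₁ ν₂) (h0 : 0 < s) (h1 : s < 1)
    (hd : 2 * s < d) (hT : ∀ q : ℚ, scaledBump d (Real.exp q) ∈ T) {L : ℝ} (hL : 0 < L) :
    bumpPotential s L ν₁ - bumpPotential s L ν₂ = ∫ x, V x * bumpSource d s L x := by
  unfold bumpPotential bumpSource
  rw [← integral_sub (integrableOn_rpow_mul_integral_scaledBump ν₁ hd hL)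
    (integrableOn_rpow_mul_integral_scaledBump ν₂ hd hL)]
  simp_rw [← integral_const_mul (V _)]
  rw [integral_integral_swap (integrable_prod_mul_fracLap_scaledBump h.integrable h0 h1 hd hL)]
  refine setIntegral_congr_fun measurableSet_Ioi fun r hr => ?_
  simp only [mul_left_comm (V _), integral_const_mul]
  rw [← h.integral_scaledBump_sub h0 h1 hT (hL.trans hr), mul_sub]

lemma bumpPotential_le (h : IsTransition s T V ν₁ ν₂) (h0 : 0 < s) (h1 : s < 1)
    (hd : 2 * s < d) (hT : ∀ q : ℚ, scaledBump d (Real.exp q) ∈ T) {L : ℝ} (hL : 0 < L) :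
    bumpPotential s L ν₂ ≤ bumpPotential s L ν₁ := by
  rw [← sub_nonneg, h.bumpPotential_sub h0 h1 hd hT hL]
  refine integral_nonneg_of_ae ?_
  filter_upwards [h.nonneg, Measure.ae_ne volume 0] with x hx hx0
  exact mul_nonneg hx (bumpSource_nonneg h0 h1 hL hx0)

lemma real_univ_eq (h : IsTransition s T V ν₁ ν₂) (h0 : 0 < s) (h1 : s < 1)
    (hT : ∀ q : ℚ, scaledBump d (Real.exp q) ∈ T) : ν₁.real univ = ν₂.real univ := by
  obtain ⟨C, hC0, hC⟩ := exists_abs_fracLap_scaledBump_le (d := d) h0 h1 one_pos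
  have hlim : Tendsto (fun r => ∫ x, V x * fracLap s (scaledBump d r) x) atTop (𝓝 0) := by
    rw [← integral_zero (EuclideanSpace ℝ (Fin d)) ℝ]
    refine tendsto_integral_filter_of_dominated_convergence
      (fun x => C * ‖V x * (1 + ‖x‖) ^ (-(2 * s))‖) ?_ ?_ (h.integrable.norm.const_mul _)
      (ae_of_all _ fun x => ?_)
    · filter_upwards [eventually_gt_atTop 0] with r hr
      exact (integrable_mul_fracLap_scaledBump h.integrable h0 h1 hr).aestronglyMeasurable
    · filter_upwards [eventually_ge_atTop 1] with r hr
      exact ae_of_all _ (norm_mul_le_mul_norm_mul hC0 (hC r hr))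
    · simpa using (tendsto_fracLap_scaledBump h0 h1 x).const_mul (V x)
  have hsub : Tendsto (fun r => ∫ x, scaledBump d r x ∂ν₁ - ∫ x, scaledBump d r x ∂ν₂) atTop
      (𝓝 0) := by
    refine hlim.congr' ?_
    filter_upwards [eventually_gt_atTop 0] with r hr
    exact (h.integral_scaledBump_sub h0 h1 hT hr).symm
  have hmul := tendsto_nhds_unique
    ((tendsto_integral_scaledBump ν₁).sub (tendsto_integral_scaledBump ν₂)) hsub
  exact mul_left_cancel₀ (radialBump_pos (by simp)).ne' (sub_eq_zero.1 hmul)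

end IsTransition

lemma IsTest.exists_abs_integral_sub_le_bumpPotential_sub {χ : EuclideanSpace ℝ (Fin d) → ℝ}
    (hχ : IsTest χ) (h0 : 0 < s) (h1 : s < 1) (hd : 2 * s < d) (hχT : χ ∈ T)
    (hT : ∀ q : ℚ, scaledBump d (Real.exp q) ∈ T) :
    ∃ K, ∀ (V : EuclideanSpace ℝ (Fin d) → ℝ)
      (ν₁ ν₂ : Measure (EuclideanSpace ℝ (Fin d))) [IsFiniteMeasure ν₁] [IsFiniteMeasure ν₂],
      IsTransition s T V ν₁ ν₂ →
        |∫ x, χ x ∂ν₁ - ∫ x, χ x ∂ν₂| ≤ K * (bumpPotential s 1 ν₁ - bumpPotential s 1 ν₂) := by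
  obtain ⟨c, hc, hsource⟩ := exists_le_bumpSource (d := d) h0 h1
  obtain ⟨C, hC0, hC⟩ := hχ.exists_abs_fracLap_le h0 h1
  have hdom (x : EuclideanSpace ℝ (Fin d)) (hx : x ≠ 0) :
      |fracLap s χ x| ≤ C / c * bumpSource d s 1 x := by
    refine (hC x).trans ?_
    rw [div_mul_eq_mul_div, le_div_iff₀ hc, mul_assoc, mul_comm _ c]
    gcongr
    simpa only [Real.one_rpow, one_mul, div_one] using hsource 1 one_pos x hx
  refine ⟨C / c, fun V ν₁ ν₂ _ _ h => ?_⟩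
  rw [h.sub_eq χ hχT, h.bumpPotential_sub h0 h1 hd hT one_pos, ← integral_const_mul,
    ← Real.norm_eq_abs]
  refine norm_integral_le_of_norm_le
    ((integrable_mul_bumpSource h.integrable h0 h1 hd one_pos).const_mul _) ?_
  filter_upwards [h.nonneg, Measure.ae_ne volume 0] with x hx hx0
  rw [norm_mul, Real.norm_of_nonneg hx, mul_left_comm]
  exact mul_le_mul_of_nonneg_left (hdom x hx0) hx

end Transition

section SeparatingTests

variable {d : ℕ}

lemma integral_eq_of_tendsto {α : Type*} [MeasurableSpace α] {μ ν : Measure α} [IsFiniteMeasure μ]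
    [IsFiniteMeasure ν] {χ : ℕ → α → ℝ} {f : α → ℝ} {C : ℝ} (hχ : ∀ n, Measurable (χ n))
    (hC : ∀ n x, |χ n x| ≤ C) (hlim : ∀ x, Tendsto (fun n => χ n x) atTop (𝓝 (f x)))
    (heq : ∀ n, ∫ x, χ n x ∂μ = ∫ x, χ n x ∂ν) : ∫ x, f x ∂μ = ∫ x, f x ∂ν := by
  have htendsto (κ : Measure α) [IsFiniteMeasure κ] :
      Tendsto (fun n => ∫ x, χ n x ∂κ) atTop (𝓝 (∫ x, f x ∂κ)) :=
    tendsto_integral_of_dominated_convergence (fun _ => C) (fun n => (hχ n).aestronglyMeasurable)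
      (integrable_const _) (fun n => ae_of_all _ (hC n)) (ae_of_all _ hlim)
  exact tendsto_nhds_unique (htendsto μ) (by simpa only [heq] using htendsto ν)

lemma exists_seq_isTest_tendsto (f : EuclideanSpace ℝ (Fin d) →ᵇ ℝ) :
    ∃ χ : ℕ → EuclideanSpace ℝ (Fin d) → ℝ, (∀ n, IsTest (χ n)) ∧
      (∀ n x, |χ n x| ≤ ‖f‖ + 1) ∧ ∀ x, Tendsto (fun n => χ n x) atTop (𝓝 (f x)) := by
  have happrox (n : ℕ) := f.continuous.exists_contDiff_approx (⊤ : ℕ∞)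
    (ε := fun _ => 1 / ((n : ℝ) + 1)) continuous_const fun _ => by positivity
  choose g hg hgf _ using happrox
  let ψ (n : ℕ) : ContDiffBump (0 : EuclideanSpace ℝ (Fin d)) :=
    ⟨n + 1, n + 2, by positivity, by linarith⟩
  refine ⟨fun n x => ψ n x * g n x, fun n => ⟨(ψ n).contDiff.mul (hg n),
    (ψ n).hasCompactSupport.mul_right⟩, fun n x => ?_, fun x => ?_⟩
  · have hle : |g n x| ≤ ‖f‖ + 1 := by
      have hdist := (hgf n x).le.trans
        (div_le_one_of_le₀ (le_add_of_nonneg_left n.cast_nonneg) (by positivity))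
      have hfx := f.norm_coe_le_norm x
      rw [Real.dist_eq] at hdist
      rw [Real.norm_eq_abs] at hfx
      linarith [abs_sub_abs_le_abs_sub (g n x) (f x)]
    rw [abs_mul, abs_of_nonneg (ψ n).nonneg]
    exact (mul_le_of_le_one_left (abs_nonneg _) (ψ n).le_one).trans hle
  · have hlim : Tendsto (fun n => g n x) atTop (𝓝 (f x)) :=
      tendsto_iff_dist_tendsto_zero.2 (squeeze_zero (fun _ => dist_nonneg)
        (fun n => (hgf n x).le) tendsto_one_div_add_atTop_nhds_zero_nat)
    refine hlim.congr' ?_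
    filter_upwards [eventually_ge_atTop ⌈‖x‖⌉₊] with n hn
    rw [(ψ n).one_of_mem_closedBall, one_mul]
    rw [mem_closedBall_zero_iff]
    exact (Nat.ceil_le.1 hn).trans (lt_add_one _).le

variable {μ ν : Measure (EuclideanSpace ℝ (Fin d))} [IsFiniteMeasure μ] [IsFiniteMeasure ν]

lemma ext_of_forall_integral_isTest_eq
    (h : ∀ χ : EuclideanSpace ℝ (Fin d) → ℝ, IsTest χ → ∫ x, χ x ∂μ = ∫ x, χ x ∂ν) : μ = ν := by
  refine ext_of_forall_integral_eq_of_IsFiniteMeasure fun f => ?_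
  obtain ⟨χ, hχ, hχC, hlim⟩ := exists_seq_isTest_tendsto f
  exact integral_eq_of_tendsto (fun n => (hχ n).1.continuous.measurable) hχC hlim
    fun n => h _ (hχ n)

variable (d) in
lemma exists_countable_isTest_separating :
    ∃ D : Set (EuclideanSpace ℝ (Fin d) → ℝ), D.Countable ∧ (∀ χ ∈ D, IsTest χ) ∧
      ∀ (μ ν : Measure (EuclideanSpace ℝ (Fin d))) [IsFiniteMeasure μ] [IsFiniteMeasure ν],
        (∀ χ ∈ D, ∫ x, χ x ∂μ = ∫ x, χ x ∂ν) → μ = ν := by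
  let A (n : ℕ) : Set C(EuclideanSpace ℝ (Fin d), ℝ) := {χ | IsTest χ ∧ ∀ x, |χ x| ≤ n}
  choose D hDA hDc hAD using fun n =>
    (TopologicalSpace.IsSeparable.of_separableSpace (A n)).exists_countable_dense_subset
  refine ⟨⋃ n, (⇑) '' D n, countable_iUnion fun n => (hDc n).image _, ?_, ?_⟩
  · simp only [mem_iUnion]
    rintro _ ⟨n, χ, hχ, rfl⟩
    exact (hDA n hχ).1
  · intro μ ν _ _ h
    refine ext_of_forall_integral_isTest_eq fun χ hχ => ?_
    obtain ⟨C, hC⟩ := hχ.2.exists_bound_of_continuous hχ.1.continuous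
    obtain ⟨n, hn⟩ := exists_nat_ge C
    obtain ⟨g, hgD, hg⟩ := mem_closure_iff_seq_limit.1 (hAD n (show ⟨χ, hχ.1.continuous⟩ ∈ A n from
      ⟨hχ, fun x => (hC x).trans hn⟩))
    exact integral_eq_of_tendsto (fun k => (g k).continuous.measurable)
      (fun k => (hDA n (hgD k)).2)
      (fun x => ((continuous_eval_const x).tendsto _).comp hg)
      fun k => h _ (mem_iUnion.2 ⟨n, mem_image_of_mem _ (hgD k)⟩)

end SeparatingTests

section Compactness

lemma integral_Ioi_rpow_pos {a L : ℝ} (ha : a < -1) (hL : 0 < L) :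
    0 < ∫ r in Ioi L, r ^ a := by
  rw [integral_Ioi_rpow_of_lt ha hL, neg_div, ← div_neg]
  exact div_pos (Real.rpow_pos_of_pos hL _) (by linarith)

lemma integral_Ioi_mul_rpow {a c L : ℝ} (ha : a < -1) (hc : 0 < c) (hL : 0 < L) :
    ∫ r in Ioi (c * L), r ^ a = c ^ (a + 1) * ∫ r in Ioi L, r ^ a := by
  rw [integral_Ioi_rpow_of_lt ha hL, integral_Ioi_rpow_of_lt ha (mul_pos hc hL),
    Real.mul_rpow hc.le hL.le]
  ring

variable {d : ℕ} [NeZero d] {s : ℝ} {T : Set (EuclideanSpace ℝ (Fin d) → ℝ)}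

lemma IsTransition.measureReal_compl_ball_le {V : EuclideanSpace ℝ (Fin d) → ℝ}
    {ν₁ ν₂ : Measure (EuclideanSpace ℝ (Fin d))} [IsFiniteMeasure ν₁] [IsFiniteMeasure ν₂]
    (h : IsTransition s T V ν₁ ν₂) (h0 : 0 < s) (h1 : s < 1) (hd : 2 * s < d)
    (hT : ∀ q : ℚ, scaledBump d (Real.exp q) ∈ T) {L : ℝ} (hL : 0 < L) :
    radialBump d 0 * (1 - 2 ^ (2 * s - d)) * ν₁.real (Metric.ball 0 (2 * L))ᶜ ≤
      radialBump d 0 * ν₂.real univ - ∫ x, scaledBump d L x ∂ν₂ := by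
  have hexp : -1 - (d : ℝ) + 2 * s < -1 := by linarith
  have hcompl := measureReal_add_measureReal_compl (μ := ν₁)
    (measurableSet_ball (x := (0 : EuclideanSpace ℝ (Fin d))) (ε := 2 * L))
  have hP := (le_bumpPotential ν₂ hd hL).trans <| (h.bumpPotential_le h0 h1 hd hT hL).trans <|
    bumpPotential_le_add_compl_ball ν₁ hd hL (R := 2 * L) (by linarith)
  rw [integral_Ioi_mul_rpow hexp two_pos hL, mul_comm (2 ^ _), mul_assoc _ (2 ^ _), ← mul_add,
    show -1 - (d : ℝ) + 2 * s + 1 = 2 * s - d by ring] at hP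
  have hbump := le_of_mul_le_mul_left hP (integral_Ioi_rpow_pos hexp hL)
  rw [← h.real_univ_eq h0 h1 hT, ← hcompl]
  linarith

lemma exists_isCompact_forall_isTransition_mem (h0 : 0 < s) (h1 : s < 1) (hd : 2 * s < d)
    (hT : ∀ q : ℚ, scaledBump d (Real.exp q) ∈ T)
    (ν : FiniteMeasure (EuclideanSpace ℝ (Fin d))) :
    ∃ K : Set (FiniteMeasure (EuclideanSpace ℝ (Fin d))), IsCompact K ∧
      ∀ ν' : FiniteMeasure (EuclideanSpace ℝ (Fin d)), (∃ V, IsTransition s T V ν' ν) →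
        ν' ∈ K := by
  have hθ : 0 < 1 - (2 : ℝ) ^ (2 * s - d) :=
    sub_pos.2 (Real.rpow_lt_one_of_one_lt_of_neg one_lt_two (by linarith))
  have hb : 0 < radialBump d 0 := radialBump_pos (by simp)
  let u (n : ℕ) : ℝ≥0 := Real.toNNReal
    ((radialBump d 0 * (ν : Measure (EuclideanSpace ℝ (Fin d))).real univ -
      ∫ x, scaledBump d (n + 1) x ∂(ν : Measure (EuclideanSpace ℝ (Fin d)))) /
      (radialBump d 0 * (1 - 2 ^ (2 * s - d))))
  have hu : Tendsto u atTop (𝓝 0) := by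
    have hlim := (tendsto_integral_scaledBump (ν : Measure (EuclideanSpace ℝ (Fin d)))).comp
      (tendsto_atTop_add_const_right _ (1 : ℝ) tendsto_natCast_atTop_atTop)
    have hdeficit := (hlim.const_sub
      (radialBump d 0 * (ν : Measure (EuclideanSpace ℝ (Fin d))).real univ)).div_const
        (radialBump d 0 * (1 - (2 : ℝ) ^ (2 * s - d)))
    rw [sub_self, zero_div] at hdeficit
    have hcoe := (continuous_real_toNNReal.tendsto 0).comp hdeficit
    rwa [Real.toNNReal_zero] at hcoe
  refine ⟨_, isCompact_setOfPred_finiteMeasure_mass_eq_compl_isCompact_le ν.mass hu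
    (K := fun n => Metric.closedBall 0 (2 * ((n : ℝ) + 1)))
    (fun n => isCompact_closedBall _ _) (Or.inl inferInstance), ?_⟩
  rintro ν' ⟨V, hV⟩
  refine ⟨NNReal.coe_injective (hV.real_univ_eq h0 h1 hT), fun n => ?_⟩
  refine (ν'.apply_mono (compl_subset_compl.2 Metric.ball_subset_closedBall)).trans ?_
  refine NNReal.le_toNNReal_of_coe_le ?_
  rw [le_div_iff₀' (mul_pos hb hθ)]
  exact hV.measureReal_compl_ball_le h0 h1 hd hT n.cast_add_one_pos

end Compactness

section TransitionFamily

lemma tendsto_nhdsWithin_sSup_of_antitoneOn {S : Set ℝ} (hS : S ⊆ Ioi 0)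
    [NeBot (𝓝[S] (0 : ℝ))] {H : ℝ → ℝ} (hH : AntitoneOn H S) (hB : BddAbove (H '' S)) :
    Tendsto H (𝓝[S] 0) (𝓝 (sSup (H '' S))) := by
  have hne : S.Nonempty := nonempty_of_mem (self_mem_nhdsWithin (a := (0 : ℝ)))
  refine tendsto_order.2 ⟨fun a ha => ?_, fun a ha => ?_⟩
  · obtain ⟨_, ⟨t₀, ht₀, rfl⟩, hlt⟩ := exists_lt_of_lt_csSup (hne.image H) ha
    filter_upwards [self_mem_nhdsWithin, mem_nhdsWithin_of_mem_nhds (Iio_mem_nhds (hS ht₀))]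
      with t ht htt₀
    exact hlt.trans_le (hH ht ht₀ (le_of_lt htt₀))
  · filter_upwards [self_mem_nhdsWithin] with t ht
    exact (le_csSup hB (mem_image_of_mem H ht)).trans_lt ha

lemma exists_tendsto_of_abs_sub_le_mul_sub {S : Set ℝ} (hS : S ⊆ Ioi 0)
    [NeBot (𝓝[S] (0 : ℝ))] {F H : ℝ → ℝ} {K : ℝ} (hH : AntitoneOn H S) (hB : BddAbove (H '' S))
    (hF : ∀ t₁ ∈ S, ∀ t₂ ∈ S, t₁ < t₂ → |F t₁ - F t₂| ≤ K * (H t₁ - H t₂)) :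
    ∃ c, Tendsto F (𝓝[S] 0) (𝓝 c) := by
  have hdist : ∀ t₁ ∈ S, ∀ t₂ ∈ S, dist (F t₁) (F t₂) ≤ |K| * dist (H t₁) (H t₂) := by
    intro t₁ ht₁ t₂ ht₂
    wlog hlt : t₁ < t₂ generalizing t₁ t₂
    · rcases (not_lt.1 hlt).eq_or_lt with rfl | hgt
      · simp
      · simpa only [dist_comm] using this t₂ ht₂ t₁ ht₁ hgt
    rw [Real.dist_eq, Real.dist_eq, ← abs_mul]
    exact (hF t₁ ht₁ t₂ ht₂ hlt).trans (le_abs_self _)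
  have hcauchy := (tendsto_nhdsWithin_sSup_of_antitoneOn hS hH hB).cauchy_map
  rw [← cauchy_map_iff_exists_tendsto]
  rw [cauchy_map_iff, tendsto_uniformity_iff_dist_tendsto_zero] at hcauchy ⊢
  refine ⟨hcauchy.1, squeeze_zero' (Eventually.of_forall fun _ => dist_nonneg) ?_
    (by simpa only [mul_zero] using hcauchy.2.const_mul |K|)⟩
  filter_upwards [prod_mem_prod self_mem_nhdsWithin self_mem_nhdsWithin] with p hp
  exact hdist p.1 hp.1 p.2 hp.2

lemma integral_eq_of_mapClusterPt {Ω ι : Type*} [TopologicalSpace Ω] [MeasurableSpace Ω]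
    [OpensMeasurableSpace Ω] {l : Filter ι} {lam : ι → FiniteMeasure Ω} {ν : FiniteMeasure Ω}
    (hν : MapClusterPt ν l lam) (f : Ω →ᵇ ℝ) {c : ℝ}
    (hc : Tendsto (fun t => ∫ x, f x ∂(lam t : Measure Ω)) l (𝓝 c)) :
    ∫ x, f x ∂(ν : Measure Ω) = c := by
  have hcluster : MapClusterPt (∫ x, f x ∂(ν : Measure Ω)) l
      fun t => ∫ x, f x ∂(lam t : Measure Ω) :=
    hν.tendsto_comp ((FiniteMeasure.continuous_integral_boundedContinuousFunction f).tendsto ν)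
  exact eq_of_nhds_neBot (ClusterPt.mono hcluster hc)

variable {d : ℕ} [NeZero d] {s : ℝ} {T : Set (EuclideanSpace ℝ (Fin d) → ℝ)} {S : Set ℝ}
  {lam : ℝ → FiniteMeasure (EuclideanSpace ℝ (Fin d))}

/-- The measures `lam t`, `t ∈ S`, are linked forward in time by transitions tested on `T`. -/
def IsTransitionFamily (s : ℝ) (T : Set (EuclideanSpace ℝ (Fin d) → ℝ)) (S : Set ℝ)
    (lam : ℝ → FiniteMeasure (EuclideanSpace ℝ (Fin d))) : Prop :=
  ∀ t₁ ∈ S, ∀ t₂ ∈ S, t₁ < t₂ → ∃ V, IsTransition s T V (lam t₁) (lam t₂)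

namespace IsTransitionFamily

lemma mass_eq (h : IsTransitionFamily s T S lam) (h0 : 0 < s) (h1 : s < 1)
    (hT : ∀ q : ℚ, scaledBump d (Real.exp q) ∈ T) {t₁ t₂ : ℝ} (ht₁ : t₁ ∈ S) (ht₂ : t₂ ∈ S) :
    (lam t₁).mass = (lam t₂).mass := by
  wlog hlt : t₁ < t₂ generalizing t₁ t₂
  · rcases (not_lt.1 hlt).eq_or_lt with rfl | hgt
    · rfl
    · exact (this ht₂ ht₁ hgt).symm
  obtain ⟨V, hV⟩ := h t₁ ht₁ t₂ ht₂ hlt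
  exact NNReal.coe_injective (hV.real_univ_eq h0 h1 hT)

lemma antitoneOn_bumpPotential (h : IsTransitionFamily s T S lam) (h0 : 0 < s) (h1 : s < 1)
    (hd : 2 * s < d) (hT : ∀ q : ℚ, scaledBump d (Real.exp q) ∈ T) {L : ℝ} (hL : 0 < L) :
    AntitoneOn (fun t => bumpPotential s L (lam t : Measure (EuclideanSpace ℝ (Fin d)))) S := by
  intro t₁ ht₁ t₂ ht₂ hle
  rcases hle.eq_or_lt with rfl | hlt
  · exact le_rfl
  · obtain ⟨V, hV⟩ := h t₁ ht₁ t₂ ht₂ hlt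
    exact hV.bumpPotential_le h0 h1 hd hT hL

lemma exists_tendsto_integral (h : IsTransitionFamily s T S lam) (h0 : 0 < s) (h1 : s < 1)
    (hd : 2 * s < d) (hT : ∀ q : ℚ, scaledBump d (Real.exp q) ∈ T) (hS : S ⊆ Ioi 0)
    [NeBot (𝓝[S] (0 : ℝ))] {χ : EuclideanSpace ℝ (Fin d) → ℝ} (hχ : IsTest χ) (hχT : χ ∈ T) :
    ∃ c, Tendsto (fun t => ∫ x, χ x ∂(lam t : Measure (EuclideanSpace ℝ (Fin d)))) (𝓝[S] 0)
      (𝓝 c) := by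
  obtain ⟨K, hχK⟩ := hχ.exists_abs_integral_sub_le_bumpPotential_sub h0 h1 hd hχT hT
  refine exists_tendsto_of_abs_sub_le_mul_sub (K := K) hS
    (h.antitoneOn_bumpPotential h0 h1 hd hT one_pos) ?_ fun t₁ ht₁ t₂ ht₂ hlt => ?_
  · obtain rfl | ⟨t₀, ht₀⟩ := S.eq_empty_or_nonempty
    · simp
    refine ⟨(∫ r in Ioi (1 : ℝ), r ^ (-1 - (d : ℝ) + 2 * s)) * (radialBump d 0 * (lam t₀).mass), ?_⟩
    rintro _ ⟨t, ht, rfl⟩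
    rw [h.mass_eq h0 h1 hT ht₀ ht]
    exact bumpPotential_le _ hd one_pos
  · obtain ⟨V, hV⟩ := h t₁ ht₁ t₂ ht₂ hlt
    exact hχK V _ _ hV

theorem exists_tendsto (h : IsTransitionFamily s T S lam) (h0 : 0 < s) (h1 : s < 1)
    (hd : 2 * s < d) (hT : ∀ q : ℚ, scaledBump d (Real.exp q) ∈ T) (hS : S ⊆ Ioi 0)
    [NeBot (𝓝[S] (0 : ℝ))] (hTtest : ∀ χ ∈ T, IsTest χ)
    (hText : ∀ (μ ν : Measure (EuclideanSpace ℝ (Fin d))) [IsFiniteMeasure μ] [IsFiniteMeasure ν],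
      (∀ χ ∈ T, ∫ x, χ x ∂μ = ∫ x, χ x ∂ν) → μ = ν) :
    ∃ μ : FiniteMeasure (EuclideanSpace ℝ (Fin d)), Tendsto lam (𝓝[S] 0) (𝓝 μ) := by
  obtain ⟨t₀, ht₀⟩ : S.Nonempty := nonempty_of_mem (self_mem_nhdsWithin (a := (0 : ℝ)))
  obtain ⟨K, hK, hmem⟩ := exists_isCompact_forall_isTransition_mem h0 h1 hd hT (lam t₀)
  have hlamK : ∀ᶠ t in 𝓝[S] (0 : ℝ), lam t ∈ K := by
    filter_upwards [self_mem_nhdsWithin, mem_nhdsWithin_of_mem_nhds (Iio_mem_nhds (hS ht₀))]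
      with t ht hlt
    exact hmem _ (h t ht t₀ ht₀ hlt)
  obtain ⟨μ, -, hμ⟩ := hK.exists_mapClusterPt (tendsto_principal.2 hlamK)
  refine ⟨μ, hK.tendsto_nhds_of_unique_mapClusterPt hlamK fun ν _ hν => Subtype.ext ?_⟩
  refine @hText _ _ ν.2 μ.2 fun χ hχ => ?_
  obtain ⟨c, hc⟩ := h.exists_tendsto_integral h0 h1 hd hT hS (hTtest χ hχ) hχ
  obtain ⟨C, hC⟩ := (hTtest χ hχ).2.exists_bound_of_continuous (hTtest χ hχ).1.continuous
  let f := BoundedContinuousFunction.ofNormedAddCommGroup χ (hTtest χ hχ).1.continuous C hC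
  exact (integral_eq_of_mapClusterPt hν f hc).trans (integral_eq_of_mapClusterPt hμ f hc).symm

end IsTransitionFamily

end TransitionFamily

section InitialTrace

lemma neBot_nhdsWithin_Ioi_diff {N : Set ℝ} (hN : volume N = 0) :
    NeBot (𝓝[Ioi 0 \ N] (0 : ℝ)) := by
  have hdense : Dense Nᶜ := Measure.dense_of_ae (measure_eq_zero_iff_ae_notMem.1 hN)
  have hsub : closure (Ioi 0) ⊆ closure (Ioi 0 \ N) :=
    closure_minimal (hdense.open_subset_closure_inter isOpen_Ioi) isClosed_closure
  exact mem_closure_iff_nhdsWithin_neBot.1 (hsub (closure_Ioi (0 : ℝ) ▸ self_mem_Ici))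

variable {d : ℕ} {s : ℝ}

lemma IsInitialTrace.unique {ρ : EuclideanSpace ℝ (Fin d) → ℝ}
    {u : EuclideanSpace ℝ (Fin d) → ℝ → ℝ} {μ ν : FiniteMeasure (EuclideanSpace ℝ (Fin d))}
    (hμ : IsInitialTrace ρ u μ) (hν : IsInitialTrace ρ u ν) : ν = μ := by
  obtain ⟨N, hN, -, h⟩ := hμ
  obtain ⟨N', hN', -, h'⟩ := hν
  have := neBot_nhdsWithin_Ioi_diff (measure_union_null hN hN')
  have hmono {A : Set ℝ} (hA : A ⊆ N ∪ N') :
      𝓝[Ioi 0 \ (N ∪ N')] (0 : ℝ) ≤ 𝓝[Ioi 0 \ A] 0 :=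
    nhdsWithin_mono _ (sdiff_subset_sdiff_right hA)
  refine Subtype.ext (@ext_of_forall_integral_eq_of_IsFiniteMeasure
    _ _ _ _ _ _ _ ν.2 μ.2 fun φ => ?_)
  exact tendsto_nhds_unique ((h' φ).mono_left (hmono subset_union_right))
    ((h φ).mono_left (hmono subset_union_left))

variable [NeZero d] {W : EuclideanSpace ℝ (Fin d) → ℝ → ℝ}
  {lam : ℝ → Measure (EuclideanSpace ℝ (Fin d))}

namespace IsDiffusionFlow

lemma intervalIntegrable (h : IsDiffusionFlow s W lam) (h0 : 0 < s) (h1 : s < 1)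
    {χ : EuclideanSpace ℝ (Fin d) → ℝ} (hχ : IsTest χ) {a b : ℝ} (ha : 0 < a) (hb : 0 < b) :
    IntervalIntegrable (fun t => ∫ x, W x t * fracLap s χ x) volume a b := by
  wlog hab : a < b generalizing a b
  · rcases (not_lt.1 hab).eq_or_lt with rfl | hba
    · exact IntervalIntegrable.refl
    · exact (this hb ha hba).symm
  rw [intervalIntegrable_iff_integrableOn_Ioo_of_le hab.le]
  exact (integrable_mul_fracLap_of_integrable_rpow (h.integrable a b ha hab) hχ h0
    h1).integral_prod_right

lemma exists_isTransition (h : IsDiffusionFlow s W lam) (h0 : 0 < s) (h1 : s < 1)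
    {T : Set (EuclideanSpace ℝ (Fin d) → ℝ)} (hT : ∀ χ ∈ T, IsTest χ)
    {c : (EuclideanSpace ℝ (Fin d) → ℝ) → ℝ} {t₁ t₂ : ℝ} (ht₁ : 0 < t₁) (ht : t₁ < t₂)
    (hc₁ : ∀ χ ∈ T, ∫ x, χ x ∂lam t₁ = c χ - ∫ τ in (1 : ℝ)..t₁, ∫ x, W x τ * fracLap s χ x)
    (hc₂ : ∀ χ ∈ T, ∫ x, χ x ∂lam t₂ = c χ - ∫ τ in (1 : ℝ)..t₂, ∫ x, W x τ * fracLap s χ x) :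
    ∃ V, IsTransition s T V (lam t₁) (lam t₂) := by
  have hint := h.integrable t₁ t₂ ht₁ ht
  refine ⟨fun x => ∫ τ in Ioo t₁ t₂, W x τ, ?_, ?_, fun χ hχ => ?_⟩
  · have hle : (volume : Measure (EuclideanSpace ℝ (Fin d))).prod (volume.restrict (Ioo t₁ t₂)) ≤
        volume.prod (volume.restrict (Ioi (0 : ℝ))) :=
      Measure.prod_mono le_rfl
        (Measure.restrict_mono (fun t ht => ht₁.trans ht.1) le_rfl)
    filter_upwards [Measure.ae_ae_of_ae_prod (ae_mono hle h.nonneg)] with x hx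
    exact integral_nonneg_of_ae hx
  · simpa only [integral_mul_const] using hint.integral_prod_left
  · have hχt := hT χ hχ
    rw [hc₁ χ hχ, hc₂ χ hχ, sub_sub_sub_cancel_left, intervalIntegral.integral_interval_sub_left
      (h.intervalIntegrable h0 h1 hχt one_pos (ht₁.trans ht))
      (h.intervalIntegrable h0 h1 hχt one_pos ht₁),
      intervalIntegral.integral_of_le ht.le, integral_Ioc_eq_integral_Ioo]
    simp_rw [← integral_mul_const]
    exact (integral_integral_swap (f := fun x τ => W x τ * fracLap s χ x)
      (integrable_mul_fracLap_of_integrable_rpow hint hχt h0 h1)).symm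

theorem exists_isTransitionFamily (h : IsDiffusionFlow s W lam) (h0 : 0 < s) (h1 : s < 1)
    {T : Set (EuclideanSpace ℝ (Fin d) → ℝ)} (hTc : T.Countable) (hT : ∀ χ ∈ T, IsTest χ) :
    ∃ N : Set ℝ, volume N = 0 ∧
      ∃ lam' : ℝ → FiniteMeasure (EuclideanSpace ℝ (Fin d)),
        (∀ t ∈ Ioi 0 \ N, (lam' t : Measure (EuclideanSpace ℝ (Fin d))) = lam t) ∧
        IsTransitionFamily s T (Ioi 0 \ N) lam' := by
  choose! c hc using fun χ hχ => h.evolution χ (hT χ hχ)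
  have hgood := (ae_restrict_iff' measurableSet_Ioi).1 (h.finite.and ((ae_ball_iff hTc).2 hc))
  obtain ⟨N, hN, hmem⟩ := eventually_iff_exists_mem.1 hgood
  classical
  let lam' (t : ℝ) : FiniteMeasure (EuclideanSpace ℝ (Fin d)) :=
    if ht : IsFiniteMeasure (lam t) then ⟨lam t, ht⟩ else 0
  have hlam' (t : ℝ) (ht : t ∈ Ioi 0 \ Nᶜ) :
      (lam' t : Measure (EuclideanSpace ℝ (Fin d))) = lam t :=
    congrArg Subtype.val (dif_pos (hmem t (not_notMem.1 ht.2) ht.1).1)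
  refine ⟨Nᶜ, hN, lam', hlam', fun t₁ ht₁ t₂ ht₂ hlt => ?_⟩
  rw [hlam' t₁ ht₁, hlam' t₂ ht₂]
  exact h.exists_isTransition h0 h1 hT ht₁.1 hlt
    (hmem t₁ (not_notMem.1 ht₁.2) ht₁.1).2 (hmem t₂ (not_notMem.1 ht₂.2) ht₂.1).2

theorem exists_initial_trace (h : IsDiffusionFlow s W lam) (h0 : 0 < s) (h1 : s < 1)
    (hd : 2 * s < d) :
    ∃ (μ : FiniteMeasure (EuclideanSpace ℝ (Fin d))) (N : Set ℝ), volume N = 0 ∧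
      (∀ φ : EuclideanSpace ℝ (Fin d) →ᵇ ℝ, Tendsto (fun t => ∫ x, φ x ∂lam t)
        (𝓝[Ioi 0 \ N] 0) (𝓝 (∫ x, φ x ∂(μ : Measure (EuclideanSpace ℝ (Fin d)))))) ∧
      ∀ t ∈ Ioi 0 \ N, lam t univ = (μ : Measure (EuclideanSpace ℝ (Fin d))) univ := by
  obtain ⟨D, hDc, hDtest, hDext⟩ := exists_countable_isTest_separating d
  let T : Set (EuclideanSpace ℝ (Fin d) → ℝ) := D ∪ range fun q : ℚ => scaledBump d (Real.exp q)
  have hTbump (q : ℚ) : scaledBump d (Real.exp q) ∈ T := Or.inr (mem_range_self q)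
  have hTtest : ∀ χ ∈ T, IsTest χ := by
    rintro χ (hχ | ⟨q, rfl⟩)
    exacts [hDtest χ hχ, isTest_scaledBump (Real.exp_pos _)]
  obtain ⟨N, hN, lam', hlam', hfamily⟩ :=
    h.exists_isTransitionFamily h0 h1 (hDc.union (countable_range _)) hTtest
  have := neBot_nhdsWithin_Ioi_diff hN
  obtain ⟨μ, hμ⟩ := hfamily.exists_tendsto h0 h1 hd hTbump sdiff_subset hTtest
    fun μ ν _ _ hμν => hDext μ ν fun χ hχ => hμν χ (Or.inl hχ)
  refine ⟨μ, N, hN, fun φ => ?_, fun t ht => ?_⟩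
  · refine (FiniteMeasure.tendsto_iff_forall_integral_tendsto.1 hμ φ).congr' ?_
    filter_upwards [self_mem_nhdsWithin] with t ht
    rw [hlam' t ht]
  · have hmass : (lam' t).mass = μ.mass := by
      refine tendsto_nhds_unique (tendsto_const_nhds.congr' ?_)
        ((FiniteMeasure.continuous_mass.tendsto μ).comp hμ)
      filter_upwards [self_mem_nhdsWithin] with t' ht'
      exact hfamily.mass_eq h0 h1 hTbump ht ht'
    rw [← hlam' t ht, ← FiniteMeasure.ennreal_mass, hmass, FiniteMeasure.ennreal_mass]

end IsDiffusionFlow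

lemma IsWeakSolution.ae_integrable_weightMeasure {m : ℝ} {ρ : EuclideanSpace ℝ (Fin d) → ℝ}
    {u : EuclideanSpace ℝ (Fin d) → ℝ → ℝ} (hu : IsWeakSolution s m ρ u) :
    ∀ᵐ t ∂volume.restrict (Ioi (0 : ℝ)), Integrable (fun x => u x t) (weightMeasure ρ) := by
  obtain ⟨M, hM⟩ := hu.linftyL1
  filter_upwards [hM] with t ht
  exact ⟨ht.1, ht.2.trans_lt ENNReal.coe_lt_top⟩

end InitialTrace

end

end FracPME

theorem theorem3p3_general (d : ℕ) [NeZero d] (s m : ℝ) (hs0 : 0 < s) (hs1 : s < 1)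
    (hd : 2 * s < d) (ρ : EuclideanSpace ℝ (Fin d) → ℝ) (hρm : AEMeasurable ρ volume)
    (hρ0 : ∀ᵐ x, 0 ≤ ρ x) (u : EuclideanSpace ℝ (Fin d) → ℝ → ℝ)
    (hu : FracPME.IsWeakSolution s m ρ u)
    (hint : ∀ t₁ t₂ : ℝ, 0 < t₁ → t₁ < t₂ → Integrable
      (fun z : EuclideanSpace ℝ (Fin d) × ℝ => u z.1 z.2 ^ m * (1 + ‖z.1‖) ^ (-(2 * s)))
      (volume.prod (volume.restrict (Ioo t₁ t₂)))) :
    ∃ μ : FiniteMeasure (EuclideanSpace ℝ (Fin d)),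
      FracPME.IsInitialTrace ρ u μ ∧
      (∀ ν : FiniteMeasure (EuclideanSpace ℝ (Fin d)), FracPME.IsInitialTrace ρ u ν → ν = μ) ∧
      ∀ᵐ t ∂(volume.restrict (Ioi (0 : ℝ))),
        (μ : Measure (EuclideanSpace ℝ (Fin d))) univ =
          ∫⁻ x, ENNReal.ofReal (u x t) ∂(FracPME.weightMeasure ρ) := by
  obtain ⟨μ, N, hN, hlim, hmass⟩ :=
    (hu.isDiffusionFlow hs0 hs1 hd hρm hρ0 hint).exists_initial_trace hs0 hs1 hd
  obtain ⟨G, hG, hgood⟩ := eventually_iff_exists_mem.1 <| (ae_restrict_iff' measurableSet_Ioi).1 <|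
    hu.ae_integrable_weightMeasure.and hu.ae_integral_flowMeasure
  have htrace : FracPME.IsInitialTrace ρ u μ := by
    have hmem {t : ℝ} (ht : t ∈ Ioi 0 \ (N ∪ Gᶜ)) : t ∈ G := by_contra fun h => ht.2 (Or.inr h)
    refine ⟨N ∪ Gᶜ, measure_union_null hN hG, fun t ht => (hgood t (hmem ht) ht.1).1, fun φ => ?_⟩
    refine ((hlim φ).mono_left
      (nhdsWithin_mono _ (sdiff_subset_sdiff_right subset_union_left))).congr' ?_
    filter_upwards [self_mem_nhdsWithin] with t ht
    exact (hgood t (hmem ht) ht.1).2 φ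
  refine ⟨μ, htrace, fun ν hν => htrace.unique hν, (ae_restrict_iff' measurableSet_Ioi).2 ?_⟩
  filter_upwards [measure_eq_zero_iff_ae_notMem.1 hN] with t htN ht
  rw [← hmass t ⟨ht, htN⟩, FracPME.flowMeasure, withDensity_apply _ MeasurableSet.univ,
    Measure.restrict_univ]

theorem theorem3p3 (d : ℕ) [NeZero d] (s m γ γ₀ : ℝ)
    (hs0 : 0 < s) (hs1 : s < 1) (hd : 2 * s < d) (hm : 1 < m)
    (hγ0 : 0 ≤ γ) (hγs : γ < 2 * s) (hγd : γ ≤ d - 2 * s)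
    (hγ₀0 : 0 ≤ γ₀) (hγ₀γ : γ₀ ≤ γ)
    (ρ : EuclideanSpace ℝ (Fin d) → ℝ) (hρm : AEMeasurable ρ volume)
    (hρ : FracPME.WeightBounds γ₀ γ ρ)
    (u : EuclideanSpace ℝ (Fin d) → ℝ → ℝ)
    (hu : FracPME.IsWeakSolution s m ρ u)
    (hb : FracPME.BoundedAwayFromZero u ∨ FracPME.PowerTimeIntegrable m ρ u) :
    ∃ μ : FiniteMeasure (EuclideanSpace ℝ (Fin d)),
      FracPME.IsInitialTrace ρ u μ ∧
      (∀ ν : FiniteMeasure (EuclideanSpace ℝ (Fin d)), FracPME.IsInitialTrace ρ u ν → ν = μ) ∧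
      ∀ᵐ t ∂(volume.restrict (Ioi (0 : ℝ))),
        (μ : Measure (EuclideanSpace ℝ (Fin d))) univ =
          ∫⁻ x, ENNReal.ofReal (u x t) ∂(FracPME.weightMeasure ρ) :=
  theorem3p3_general d s m hs0 hs1 hd ρ hρm hρ.ae_nonneg u hu fun _ _ ht₁ ht =>
    hu.integrable_rpow_mul_one_add_norm_rpow hm.le hρm hρ hγ₀0 (by linarith) hγs.le hb ht₁ ht
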